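/- **Setting.** $\mathsf{PRA}^2$ is the theory in the two-sorted language with number variables, function variables (of every finite arity, ranging over functions on the numbers), the symbols $0,s,<$ and a symbol for every primitive recursive function. A structure is a pair $(M,\mathcal X)$, where the number variables range over $M$ and the function variables over a set $\mathcal X$ of finitary functions on $M$. It is a model of $\mathsf{PRA}^2$ if: $0$ is not a successor and $s$ is injective; the usual recursive clauses for $<$ hold ($x\not<0$, and $x<s(y)\leftrightarrow x<y\vee x=y$); the defining equations of all primitive recursive functions hold; $\mathcal X$ contains the constant functions, the successor and the projections and is closed under composition and primitive recursion; and induction holds for all quantifier-free formulas with number and function parameters. $\mathsf{QF}\text{-}\mathsf{AC}$, with which $\mathsf{RCA}_0$ is identified, is the schema $$\forall n\,\exists m\,\theta(n,m)\rightarrow\exists f\,\forall n\,\theta(n,f(n)),$$ for $\theta$ quantifier-free with number and function parameters. Below, $\mathbb N$ denotes the number sort (possibly nonstandard). All structures have domain $\mathbb N$; their operations are functions of the model, and their relations are given by $\{0,1\}$-valued characteristic functions of the model. *Categoricity* of a class of structures is the statement that for any two structures $\mathcal A,\mathcal B$ in the class there is a function $h$ of the model that is an isomorphism from $\mathcal A$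 onto $\mathcal B$ and whose inverse $h^{-1}$ is also a function of the model. A *random graph* is an irreflexive symmetric relation $E$ on $\mathbb N$ such that for each pair of disjoint non-empty finite sets $X,Y\subseteq\mathbb N$ there is $z\in\mathbb N$ with $x\,E\,z$ for all $x\in X$ and $\neg(y\,E\,z)$ for all $y\in Y$; here a finite set is one with a characteristic function in the model and a bound in $\mathbb N$. A Boolean algebra, in the signature $(\vee,\wedge,\neg,0,1)$, is *atomless* if every $x\neq 0$ equals $y\vee z$ for some non-zero $y,z$ with $y\wedge z=0$. **Theorem.** Over $\mathsf{PRA}^2$, i.e. in every model $(M,\mathcal X)$ of $\mathsf{PRA}^2$, $\mathsf{RCA}_0$ (that is, $\mathsf{QF}\text{-}\mathsf{AC}$) is equivalent to each of the following: 1. categoricity of countable dense linear orders without end points; 2. categoricity of countable random graphs; 3. categoricity of countable atomless Boolean algebras. -/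

import Mathlib

universe u

namespace PRA2

/-- Symbols for the primitive recursive functions, by arity: the basic functions `0`, `s` and the
projections, composition, and primitive recursion. -/
inductive PRFun : ℕ → Type
  | zero : PRFun 0
  | succ : PRFun 1
  | proj {n : ℕ} (i : Fin n) : PRFun n
  | comp {m n : ℕ} (f : PRFun m) (g : Fin m → PRFun n) : PRFun n
  | prec {n : ℕ} (f : PRFun n) (g : PRFun (n + 2)) : PRFun (n + 1)

/-- Number terms of the second-order language: number variables `x_i`, the primitive recursive
function symbols (`0` and `s` are among them), and application of the `i`-th function variable
of arity `n`. -/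
inductive Term : Type
  | var (i : ℕ) : Term
  | prf {n : ℕ} (f : PRFun n) (t : Fin n → Term) : Term
  | app {n : ℕ} (i : ℕ) (t : Fin n → Term) : Term

/-- Quantifier-free formulas; `¬` and `∧` generate the other connectives. -/
inductive QFFormula : Type
  | eq (t₁ t₂ : Term) : QFFormula
  | lt (t₁ t₂ : Term) : QFFormula
  | neg (θ : QFFormula) : QFFormula
  | and (θ₁ θ₂ : QFFormula) : QFFormula

/-- A structure `(M, 𝒳)` for the second-order language: number variables range over `M`, function
variables of arity `n` over the set `fn n` of functions `M ^ n → M`. -/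
structure Str (M : Type u) where
  /-- interpretation of the primitive recursive function symbols -/
  prf : {n : ℕ} → PRFun n → (Fin n → M) → M
  /-- interpretation of the order symbol -/
  lt : M → M → Prop
  /-- the second-order part -/
  fn : (n : ℕ) → Set ((Fin n → M) → M)

namespace Str

variable {M : Type u} (S : Str M)

/-- The element `0`. -/
def zero : M := S.prf PRFun.zero ![]

/-- The successor function `s`. -/
def succ (x : M) : M := S.prf PRFun.succ ![x]

/-- The element `1 = s 0`. -/
def one : M := S.succ S.zero

/-- Value of a term under an assignment `e` of the number variables and `E` of the function
variables. -/
def eval (e : ℕ → M) (E : (n : ℕ) → ℕ → (Fin n → M) → M) : Term → M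
  | Term.var i => e i
  | Term.prf f t => S.prf f (fun j => eval e E (t j))
  | Term.app (n := n) i t => E n i (fun j => eval e E (t j))

/-- Satisfaction of quantifier-free formulas. -/
def Sat (e : ℕ → M) (E : (n : ℕ) → ℕ → (Fin n → M) → M) : QFFormula → Prop
  | QFFormula.eq t₁ t₂ => S.eval e E t₁ = S.eval e E t₂
  | QFFormula.lt t₁ t₂ => S.lt (S.eval e E t₁) (S.eval e E t₂)
  | QFFormula.neg θ => ¬ Sat e E θ
  | QFFormula.and θ₁ θ₂ => Sat e E θ₁ ∧ Sat e E θ₂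

/-- `E` assigns to each function variable a function of the second-order part. -/
def IsAssignment (E : (n : ℕ) → ℕ → (Fin n → M) → M) : Prop :=
  ∀ n i, E n i ∈ S.fn n

/-- Induction for quantifier-free formulas, with number and function parameters. -/
def QFInd : Prop :=
  ∀ (θ : QFFormula) (x : ℕ) (e : ℕ → M) (E : (n : ℕ) → ℕ → (Fin n → M) → M), S.IsAssignment E →
    S.Sat (Function.update e x S.zero) E θ →
    (∀ a : M, S.Sat (Function.update e x a) E θ →
      S.Sat (Function.update e x (S.succ a)) E θ) →
    ∀ a : M, S.Sat (Function.update e x a) E θ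

/-- `(M, 𝒳)` is a model of `PRA²`. -/
structure IsModel : Prop where
  zero_ne_succ : ∀ x, S.zero ≠ S.succ x
  succ_inj : ∀ x y, S.succ x = S.succ y → x = y
  not_lt_zero : ∀ x, ¬ S.lt x S.zero
  lt_succ : ∀ x y, S.lt x (S.succ y) ↔ S.lt x y ∨ x = y
  /-- defining equations of the primitive recursive functions -/
  prf_proj : ∀ {n : ℕ} (i : Fin n) (x : Fin n → M), S.prf (PRFun.proj i) x = x i
  prf_comp : ∀ {m n : ℕ} (f : PRFun m) (g : Fin m → PRFun n) (x : Fin n → M),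
    S.prf (PRFun.comp f g) x = S.prf f (fun j => S.prf (g j) x)
  prf_prec_zero : ∀ {n : ℕ} (f : PRFun n) (g : PRFun (n + 2)) (x : Fin n → M),
    S.prf (PRFun.prec f g) (Matrix.vecCons S.zero x) = S.prf f x
  prf_prec_succ : ∀ {n : ℕ} (f : PRFun n) (g : PRFun (n + 2)) (a : M) (x : Fin n → M),
    S.prf (PRFun.prec f g) (Matrix.vecCons (S.succ a) x) =
      S.prf g (Matrix.vecCons a
        (Matrix.vecCons (S.prf (PRFun.prec f g) (Matrix.vecCons a x)) x))
  /-- closure under primitive recursive functionals, which may have number parameters: the basic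
  functions and constants exist, and functions are closed under composition and primitive
  recursion -/
  const_mem : ∀ (n : ℕ) (c : M), (fun _ : Fin n → M => c) ∈ S.fn n
  succ_mem : (fun x : Fin 1 → M => S.succ (x 0)) ∈ S.fn 1
  proj_mem : ∀ {n : ℕ} (i : Fin n), (fun x : Fin n → M => x i) ∈ S.fn n
  comp_mem : ∀ {m n : ℕ}, ∀ f ∈ S.fn m, ∀ g : Fin m → (Fin n → M) → M, (∀ j, g j ∈ S.fn n) →
    (fun x => f (fun j => g j x)) ∈ S.fn n
  prec_mem : ∀ {n : ℕ}, ∀ f ∈ S.fn n, ∀ g ∈ S.fn (n + 2), ∃ h ∈ S.fn (n + 1),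
    (∀ x, h (Matrix.vecCons S.zero x) = f x) ∧
    ∀ a x, h (Matrix.vecCons (S.succ a) x) =
      g (Matrix.vecCons a (Matrix.vecCons (h (Matrix.vecCons a x)) x))
  qfInd : S.QFInd

/-- The unary function `f` belongs to the second-order part. -/
def IsFun₁ (f : M → M) : Prop := (fun x : Fin 1 → M => f (x 0)) ∈ S.fn 1

/-- The binary function `f` belongs to the second-order part. -/
def IsFun₂ (f : M → M → M) : Prop := (fun x : Fin 2 → M => f (x 0) (x 1)) ∈ S.fn 2

/-- The quantifier-free axiom of choice `QF-AC` (identified with `RCA₀`), with number and function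
parameters: `∀ n ∃ m θ(n, m) → ∃ f ∀ n θ(n, f n)`. -/
def QFAC : Prop :=
  ∀ (θ : QFFormula) (x y : ℕ), x ≠ y →
    ∀ (e : ℕ → M) (E : (n : ℕ) → ℕ → (Fin n → M) → M), S.IsAssignment E →
    (∀ a : M, ∃ b : M, S.Sat (Function.update (Function.update e x a) y b) E θ) →
    ∃ f : M → M, S.IsFun₁ f ∧
      ∀ a : M, S.Sat (Function.update (Function.update e x a) y (f a)) E θ

/-- `r` is the characteristic function, belonging to the second-order part, of a binary relation;
the relation holds of `a, b` when `r a b = 1`. -/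
def IsRel (r : M → M → M) : Prop :=
  S.IsFun₂ r ∧ ∀ a b, r a b = S.zero ∨ r a b = S.one

/-- `h` is a bijection such that both `h` and its inverse belong to the second-order part. -/
def IsBij (h : M → M) : Prop :=
  S.IsFun₁ h ∧ ∃ k : M → M, S.IsFun₁ k ∧ (∀ a, k (h a) = a) ∧ ∀ b, h (k b) = b

/-- An isomorphism, with inverse, between relations on `M` given by their characteristic
functions. -/
def IsRelIso (r r' : M → M → M) (h : M → M) : Prop :=
  S.IsBij h ∧ ∀ a b, r a b = S.one ↔ r' (h a) (h b) = S.one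

/-- `(ℕ, r)` is a dense linear order without end points. -/
structure IsDLO (r : M → M → M) : Prop where
  rel : S.IsRel r
  irrefl : ∀ a, r a a ≠ S.one
  trans : ∀ a b c, r a b = S.one → r b c = S.one → r a c = S.one
  total : ∀ a b, r a b = S.one ∨ a = b ∨ r b a = S.one
  dense : ∀ a b, r a b = S.one → ∃ c, r a c = S.one ∧ r c b = S.one
  noMin : ∀ a, ∃ b, r b a = S.one
  noMax : ∀ a, ∃ b, r a b = S.one

/-- Categoricity of countable dense linear orders without end points. -/
def CatDLO : Prop :=
  ∀ r r' : M → M → M, S.IsDLO r → S.IsDLO r' → ∃ h, S.IsRelIso r r' h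

/-- `f` is the characteristic function of a finite set `{a | f a = 1}` in the sense of the model:
it belongs to the second-order part, and its support is bounded by an element `d` of `M`. -/
def IsFinSet (f : M → M) : Prop :=
  S.IsFun₁ f ∧ (∀ a, f a = S.zero ∨ f a = S.one) ∧ ∃ d, ∀ a, S.lt d a → f a = S.zero

/-- `(ℕ, r)` is a random graph. -/
structure IsRandomGraph (r : M → M → M) : Prop where
  rel : S.IsRel r
  irrefl : ∀ a, r a a ≠ S.one
  symm : ∀ a b, r a b = S.one → r b a = S.one
  random : ∀ f g : M → M, S.IsFinSet f → S.IsFinSet g →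
    (∃ a, f a = S.one) → (∃ a, g a = S.one) → (∀ a, ¬ (f a = S.one ∧ g a = S.one)) →
    ∃ c, (∀ a, f a = S.one → r a c = S.one) ∧ ∀ b, g b = S.one → r b c ≠ S.one

/-- Categoricity of countable random graphs. -/
def CatRandomGraph : Prop :=
  ∀ r r' : M → M → M, S.IsRandomGraph r → S.IsRandomGraph r' → ∃ h, S.IsRelIso r r' h

end Str

/-- Operations and constants on `M` in the signature `(∨, ∧, ¬, 0, 1)`. -/
structure BoolOps (M : Type u) where
  join : M → M → M
  meet : M → M → M
  compl : M → M
  bot : M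
  top : M

namespace Str

variable {M : Type u} (S : Str M)

/-- `B` is an atomless Boolean algebra with domain `ℕ` whose operations belong to the second-order
part. -/
structure IsAtomlessBA (B : BoolOps M) : Prop where
  fun_join : S.IsFun₂ B.join
  fun_meet : S.IsFun₂ B.meet
  fun_compl : S.IsFun₁ B.compl
  join_comm : ∀ a b, B.join a b = B.join b a
  meet_comm : ∀ a b, B.meet a b = B.meet b a
  join_assoc : ∀ a b c, B.join (B.join a b) c = B.join a (B.join b c)
  meet_assoc : ∀ a b c, B.meet (B.meet a b) c = B.meet a (B.meet b c)
  join_meet_self : ∀ a b, B.join a (B.meet a b) = a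
  meet_join_self : ∀ a b, B.meet a (B.join a b) = a
  join_meet_distrib : ∀ a b c, B.join a (B.meet b c) = B.meet (B.join a b) (B.join a c)
  meet_join_distrib : ∀ a b c, B.meet a (B.join b c) = B.join (B.meet a b) (B.meet a c)
  join_bot : ∀ a, B.join a B.bot = a
  meet_top : ∀ a, B.meet a B.top = a
  join_compl : ∀ a, B.join a (B.compl a) = B.top
  meet_compl : ∀ a, B.meet a (B.compl a) = B.bot
  atomless : ∀ a, a ≠ B.bot → ∃ b c, b ≠ B.bot ∧ c ≠ B.bot ∧ B.join b c = a ∧ B.meet b c = B.bot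

/-- An isomorphism, with inverse, between Boolean algebras with domain `ℕ`. -/
structure IsBAIso (A B : BoolOps M) (h : M → M) : Prop where
  bij : S.IsBij h
  map_join : ∀ a b, h (A.join a b) = B.join (h a) (h b)
  map_meet : ∀ a b, h (A.meet a b) = B.meet (h a) (h b)
  map_compl : ∀ a, h (A.compl a) = B.compl (h a)
  map_bot : h A.bot = B.bot
  map_top : h A.top = B.top

/-- Categoricity of countable atomless Boolean algebras. -/
def CatAtomlessBA : Prop :=
  ∀ A B : BoolOps M, S.IsAtomlessBA A → S.IsAtomlessBA B → ∃ h, S.IsBAIso A B h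

end Str

end PRA2

/-!
In a model of `PRA²` the instances of `QF-AC` are the instances of `PRAModel.Choice`, the axiom of
choice for binary relations with a characteristic function in the model
(`PRAModel.qfac_iff_choice`). The rest of the argument takes place inside the model and uses
primitive recursion, induction for relations with a characteristic function, and bounded
quantifiers; finite sets are coded by binary digits. There is no `Σ₁` induction and no collection.

*Choice implies categoricity.* For dense orders and random graphs every finite partial isomorphism
extends to one more point. The relation "this pair may be added to the list of pairs that has
been built so far" has a characteristic function, so Choice provides a function that performs one
step, and this function is iterated by primitive recursion (`exists_iso_of_extends`). For Boolean
algebras finitely generated subalgebras are replaced by binary trees: the non-zero nodes of level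
`n` play the role of the atoms after `n` elements have been dealt with, and only splitting a
non-zero element needs Choice. The two trees have corresponding non-zero nodes, an element of one
algebra is sent to the finite join of nodes in the same position of the other tree, and such a
counterpart is unique (`Respects.right_unique`).

*Categoricity implies Choice.* Let every `n` have a `Θ`-witness. Two structures are constructed in
which the same configuration is realized: in the first it is realized by an explicit function of
the model, while in the second every realization over the parameter `n` is numerically larger than
some `Θ`-witness for `n`. An isomorphism of the model carries the first function to one that bounds
a witness for each `n`, and a bounded search then finds a witness. Since collection is not
available, each configuration depends on a single instance `∃ m, Θ n m`.

* For graphs, a vertex `z` is joined to its elements only if a `Θ`-witness for its least element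
  lies below `z` (`choice_of_catRandomGraph`).
* For orders, the lexicographic order of finite sets is transported along a permutation `twist Θ`
  that, for every `n`, exchanges one known point with a point whose place depends on the least
  witness for `n`. The permutation is not a function of the model, but the order is a relation of
  the model (`lex_twist_bound`), and only large numbers lie in certain known intervals
  (`choice_of_catDLO`).
* For Boolean algebras, the same two orders are replaced by their interval algebras; a proper part
  of such a known interval has an end point inside the interval (`choice_of_catAtomlessBA`).
-/

open PRA2

/-- A type carrying a fixed model of `PRA²`. -/
class PRAModel (M : Type u) where
  /-- the underlying two-sorted structure -/
  str : Str M
  isModel : str.IsModel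

namespace PRAModel

variable {M : Type u} [PRAModel M]

/-! ### Functions and relations of the model -/

/-- `φ` is a function of the model. -/
@[fun_prop] def Fn {n : ℕ} (φ : (Fin n → M) → M) : Prop := φ ∈ (str (M := M)).fn n

instance : Zero M := ⟨(str (M := M)).zero⟩

instance : One M := ⟨(str (M := M)).one⟩

/-- The successor function of the model. -/
def suc (x : M) : M := (str (M := M)).succ x

lemma one_eq_suc : (1 : M) = suc 0 := rfl

lemma zero_ne_suc (x : M) : (0 : M) ≠ suc x := isModel.zero_ne_succ x

lemma zero_ne_one_model : (0 : M) ≠ 1 := zero_ne_suc 0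

lemma fn_comp {m n : ℕ} {f : (Fin m → M) → M} (hf : Fn f) {g : Fin m → (Fin n → M) → M}
    (hg : ∀ j, Fn (g j)) : Fn (fun x => f (fun j => g j x)) :=
  isModel.comp_mem f hf g hg

@[fun_prop] lemma fn_proj {n : ℕ} (i : Fin n) : Fn (fun x : Fin n → M => x i) :=
  isModel.proj_mem i

@[fun_prop] lemma fn_const {n : ℕ} (c : M) : Fn (fun _ : Fin n → M => c) :=
  isModel.const_mem n c

lemma fn_comp₁ {n : ℕ} {f : M → M} (hf : Fn (fun x : Fin 1 → M => f (x 0)))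
    {φ : (Fin n → M) → M} (hφ : Fn φ) : Fn (fun x => f (φ x)) :=
  fn_comp hf (g := fun _ => φ) (fun _ => hφ)

lemma fn_comp₂ {n : ℕ} {f : M → M → M} (hf : Fn (fun x : Fin 2 → M => f (x 0) (x 1)))
    {φ ψ : (Fin n → M) → M} (hφ : Fn φ) (hψ : Fn ψ) : Fn (fun x => f (φ x) (ψ x)) := by
  have := fn_comp hf (g := ![φ, ψ]) (by intro j; fin_cases j <;> simpa)
  simpa using this

lemma fn_comp₃ {n : ℕ} {f : M → M → M → M} (hf : Fn (fun x : Fin 3 → M => f (x 0) (x 1) (x 2)))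
    {φ ψ χ : (Fin n → M) → M} (hφ : Fn φ) (hψ : Fn ψ) (hχ : Fn χ) :
    Fn (fun x => f (φ x) (ψ x) (χ x)) := by
  have := fn_comp hf (g := ![φ, ψ, χ]) (by intro j; fin_cases j <;> simpa)
  simpa using this

lemma Fn.shift {n : ℕ} {f : M → (Fin n → M) → M}
    (hf : Fn (fun y : Fin (n + 1) → M => f (y 0) (fun i => y i.succ))) :
    Fn (fun y : Fin (n + 2) → M => f (y 0) (fun i => y i.succ.succ)) := by
  refine fn_comp hf
    (g := Matrix.vecCons (fun y : Fin (n + 2) → M => y 0) (fun i y => y i.succ.succ)) ?_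
  intro j
  refine Fin.cases ?_ (fun j => ?_) j
  · exact fn_proj 0
  · exact fn_proj _

lemma Fn.weaken {n : ℕ} {φ : (Fin n → M) → M} (hφ : Fn φ) :
    Fn (fun y : Fin (n + 1) → M => φ (fun i => y i.succ)) :=
  fn_comp hφ (fun _ => fn_proj _)

@[fun_prop] lemma fn_suc {n : ℕ} {φ : (Fin n → M) → M} (hφ : Fn φ) : Fn (fun x => suc (φ x)) :=
  fn_comp₁ (f := suc) isModel.succ_mem hφ

/-- The assignment interpreting the unary function variables by `F`. -/
def unaryAssign (F : ℕ → M → M) : (n : ℕ) → ℕ → (Fin n → M) → M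
  | 1, i => fun x => F i (x 0)
  | _, _ => fun _ => 0

/-- The term applying the `i`-th unary function variable to the number variable `x₀`. -/
def unaryTerm (i : ℕ) : Term := Term.app (n := 1) i (fun _ => Term.var 0)

/-- Quantifier-free induction for formulas whose terms apply unary functions `F i` of the model to
the induction variable. -/
lemma qf_induction (F : ℕ → M → M) (hF : ∀ i, Fn (fun x : Fin 1 → M => F i (x 0))) (θ : QFFormula)
    {P : M → Prop} (hP : ∀ a, (str (M := M)).Sat (Function.update (fun _ => 0) 0 a)
      (unaryAssign F) θ ↔ P a)
    (h0 : P 0) (hs : ∀ a, P a → P (suc a)) (a : M) : P a := by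
  refine (hP a).1 (isModel.qfInd θ 0 (fun _ => 0) (unaryAssign F) ?_ ((hP _).2 h0)
    (fun a h => (hP _).2 (hs a ((hP a).1 h))) a)
  intro n i
  match n with
  | 1 => exact hF i
  | 0 => exact fn_const 0
  | n + 2 => exact fn_const 0

@[simp] lemma eval_unaryTerm (F : ℕ → M → M) (e : ℕ → M) (i : ℕ) :
    (str (M := M)).eval e (unaryAssign F) (unaryTerm i) = F i (e 0) := rfl

/-- Induction for equations between functions of the model. -/
lemma eq_induction {f g : M → M} (h0 : f 0 = g 0) (hs : ∀ a, f a = g a → f (suc a) = g (suc a))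
    (a : M) (hf : Fn (fun x : Fin 1 → M => f (x 0)) := by fun_prop)
    (hg : Fn (fun x : Fin 1 → M => g (x 0)) := by fun_prop) : f a = g a := by
  refine qf_induction (fun i => if i = 0 then f else g) ?_
    (QFFormula.eq (unaryTerm 0) (unaryTerm 1)) (P := fun a => f a = g a) ?_ h0 hs a
  · intro i; split_ifs <;> assumption
  · intro a; simp [Str.Sat]

/-! ### The order of the model -/

instance : LT M := ⟨(str (M := M)).lt⟩

lemma not_lt_zero' (x : M) : ¬ x < 0 := isModel.not_lt_zero x

lemma lt_suc {x y : M} : x < suc y ↔ x < y ∨ x = y := isModel.lt_succ x y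

lemma lt_suc_self (x : M) : x < suc x := lt_suc.2 (Or.inr rfl)

lemma model_lt_trans {x y z : M} (hxy : x < y) (hyz : y < z) : x < z := by
  revert hyz
  refine qf_induction (fun i => if i = 0 then fun _ => x else if i = 1 then fun _ => y else id) ?_
    (QFFormula.neg (QFFormula.and (QFFormula.lt (unaryTerm 1) (unaryTerm 2))
      (QFFormula.neg (QFFormula.lt (unaryTerm 0) (unaryTerm 2)))))
    (P := fun z => y < z → x < z) ?_ ?_ ?_ z
  · intro i; split_ifs
    · exact fn_const _
    · exact fn_const _
    · exact fn_proj 0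
  · intro a; simp [Str.Sat]; rfl
  · intro h; exact absurd h (not_lt_zero' _)
  · intro a ih h
    rcases lt_suc.1 h with h | rfl
    · exact lt_suc.2 (Or.inl (ih h))
    · exact lt_suc.2 (Or.inl hxy)

lemma suc_lt_suc {x y : M} (hxy : x < y) : suc x < suc y := by
  revert hxy
  refine qf_induction (fun i => if i = 0 then fun _ => x else if i = 1 then fun _ => suc x else
      if i = 2 then id else suc) ?_
    (QFFormula.neg (QFFormula.and (QFFormula.lt (unaryTerm 0) (unaryTerm 2))
      (QFFormula.neg (QFFormula.lt (unaryTerm 1) (unaryTerm 3)))))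
    (P := fun y => x < y → suc x < suc y) ?_ ?_ ?_ y
  · intro i; split_ifs
    · exact fn_const _
    · exact fn_const _
    · exact fn_proj 0
    · exact fn_suc (fn_proj 0)
  · intro a; simp [Str.Sat]; rfl
  · intro h; exact absurd h (not_lt_zero' _)
  · intro a ih h
    rcases lt_suc.1 h with h | rfl
    · exact lt_suc.2 (Or.inl (ih h))
    · exact lt_suc_self _

lemma model_lt_irrefl (x : M) : ¬ x < x := by
  refine qf_induction (fun _ => id) (fun _ => fn_proj 0)
    (QFFormula.neg (QFFormula.lt (unaryTerm 0) (unaryTerm 0)))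
    (P := fun x => ¬ x < x) ?_ (not_lt_zero' _) ?_ x
  · intro a; simp [Str.Sat]; rfl
  · intro a ih h
    rcases lt_suc.1 h with h | h
    · exact ih (model_lt_trans (lt_suc_self a) h)
    · have := lt_suc_self a
      rw [h] at this
      exact ih this

lemma suc_lt_or_eq {x y : M} (h : x < y) : suc x < y ∨ suc x = y :=
  lt_suc.1 (suc_lt_suc h)

lemma model_lt_trichotomy (x y : M) : x < y ∨ x = y ∨ y < x := by
  by_contra h
  revert h
  refine qf_induction (fun i => if i = 0 then fun _ => x else id) ?_
    (QFFormula.neg (QFFormula.and (QFFormula.neg (QFFormula.lt (unaryTerm 0) (unaryTerm 1)))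
      (QFFormula.and (QFFormula.neg (QFFormula.eq (unaryTerm 0) (unaryTerm 1)))
      (QFFormula.neg (QFFormula.lt (unaryTerm 1) (unaryTerm 0))))))
    (P := fun y => ¬ ¬ (x < y ∨ x = y ∨ y < x)) ?_ ?_ ?_ y
  · intro i; split_ifs
    · exact fn_const _
    · exact fn_proj 0
  · intro a; simp [Str.Sat, not_or]; rfl
  · refine qf_induction (fun i => if i = 0 then fun _ => 0 else id) ?_
      (QFFormula.neg (QFFormula.and (QFFormula.neg (QFFormula.lt (unaryTerm 1) (unaryTerm 0)))
        (QFFormula.and (QFFormula.neg (QFFormula.eq (unaryTerm 1) (unaryTerm 0)))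
        (QFFormula.neg (QFFormula.lt (unaryTerm 0) (unaryTerm 1))))))
      (P := fun x => ¬ ¬ (x < 0 ∨ x = 0 ∨ 0 < x)) ?_ ?_ ?_ x
    · intro i; split_ifs
      · exact fn_const _
      · exact fn_proj 0
    · intro a; simp [Str.Sat, not_or]; rfl
    · simp
    · intro a ih
      rw [not_not] at ih ⊢
      rcases ih with h | rfl | h
      · exact absurd h (not_lt_zero' _)
      · exact Or.inr (Or.inr (lt_suc_self _))
      · exact Or.inr (Or.inr (lt_suc.2 (Or.inl h)))
  · intro a ih
    rw [not_not] at ih ⊢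
    rcases ih with h | rfl | h
    · exact Or.inl (lt_suc.2 (Or.inl h))
    · exact Or.inl (lt_suc_self _)
    · rcases suc_lt_or_eq h with h | h
      · exact Or.inr (Or.inr h)
      · exact Or.inr (Or.inl h.symm)

open Classical in
noncomputable instance : LinearOrder M where
  le x y := x < y ∨ x = y
  le_refl x := Or.inr rfl
  le_trans x y z h h' := by
    rcases h with h | rfl
    · rcases h' with h' | rfl
      · exact Or.inl (model_lt_trans h h')
      · exact Or.inl h
    · exact h'
  le_antisymm x y h h' := by
    rcases h with h | rfl
    · rcases h' with h' | rfl
      · exact absurd (model_lt_trans h h') (model_lt_irrefl _)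
      · rfl
    · rfl
  lt_iff_le_not_ge x y := by
    constructor
    · intro h
      refine ⟨Or.inl h, ?_⟩
      rintro (h' | rfl)
      · exact model_lt_irrefl _ (model_lt_trans h h')
      · exact model_lt_irrefl _ h
    · rintro ⟨h | rfl, h'⟩
      · exact h
      · exact absurd (Or.inr rfl) h'
  le_total x y := by
    rcases model_lt_trichotomy x y with h | h | h
    · exact Or.inl (Or.inl h)
    · exact Or.inl (Or.inr h)
    · exact Or.inr (Or.inl h)
  toDecidableLE := Classical.decRel _

lemma lt_suc_iff {x y : M} : x < suc y ↔ x ≤ y := by rw [lt_suc, le_iff_lt_or_eq]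

lemma suc_le_iff {x y : M} : suc x ≤ y ↔ x < y := by
  constructor
  · exact fun h => (lt_suc_self x).trans_le h
  · intro h; rcases suc_lt_or_eq h with h | h
    · exact h.le
    · exact h.le

lemma model_zero_le (x : M) : 0 ≤ x := not_lt.1 (not_lt_zero' x)

/-! ### Primitive recursion -/

/-- The function defined by primitive recursion from the initial value `z` and the step function
`g`, and a constant function if the model has no such function. -/
noncomputable def prec (z : M) (g : M → M → M) : M → M :=
  open Classical in
  if h : ∃ f : M → M, Fn (fun x : Fin 1 → M => f (x 0)) ∧ f 0 = z ∧ ∀ a, f (suc a) = g a (f a) then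
    h.choose else fun _ => 0

/-- Primitive recursion with parameters. -/
lemma exists_prec {n : ℕ} {f : (Fin n → M) → M} {g : M → M → (Fin n → M) → M} (hf : Fn f)
    (hg : Fn (fun y : Fin (n + 2) → M => g (y 0) (y 1) (fun i => y i.succ.succ))) :
    ∃ h : M → (Fin n → M) → M, Fn (fun y : Fin (n + 1) → M => h (y 0) (fun i => y i.succ)) ∧
      (∀ x, h 0 x = f x) ∧ ∀ a x, h (suc a) x = g a (h a x) x := by
  obtain ⟨h, h1, h2, h3⟩ := isModel.prec_mem f hf _ hg
  refine ⟨fun a x => h (Matrix.vecCons a x), ?_, h2, ?_⟩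
  · change (fun y : Fin (n + 1) → M => h (Matrix.vecCons (y 0) (fun i => y i.succ))) ∈ _
    convert h1 using 1
    funext y
    congr 1
    funext i
    refine Fin.cases ?_ (fun j => ?_) i <;> rfl
  · intro a x
    exact h3 a x

lemma prec_spec {z : M} {g : M → M → M} (hg : Fn (fun y : Fin 2 → M => g (y 0) (y 1))) :
    Fn (fun x : Fin 1 → M => prec z g (x 0)) ∧ prec z g 0 = z ∧
      ∀ a, prec z g (suc a) = g a (prec z g a) := by
  have h : ∃ f : M → M, Fn (fun x : Fin 1 → M => f (x 0)) ∧ f 0 = z ∧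
      ∀ a, f (suc a) = g a (f a) := by
    obtain ⟨h, h1, h2, h3⟩ := exists_prec (n := 0) (f := fun _ => z) (g := fun a b _ => g a b)
      (fn_const z) hg
    refine ⟨fun a => h a ![], ?_, h2 _, fun a => h3 a _⟩
    convert h1 using 3
  unfold prec
  rw [dif_pos h]
  exact h.choose_spec

lemma prec_zero {z : M} {g : M → M → M}
    (hg : Fn (fun y : Fin 2 → M => g (y 0) (y 1)) := by fun_prop) : prec z g 0 = z :=
  (prec_spec hg).2.1

lemma prec_suc {z : M} {g : M → M → M} {a : M}
    (hg : Fn (fun y : Fin 2 → M => g (y 0) (y 1)) := by fun_prop) :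
    prec z g (suc a) = g a (prec z g a) :=
  (prec_spec hg).2.2 a

@[fun_prop] lemma fn_prec {n : ℕ} {f φ : (Fin n → M) → M} {g : M → M → (Fin n → M) → M} (hf : Fn f)
    (hg : Fn (fun y : Fin (n + 2) → M => g (y 0) (y 1) (fun i => y i.succ.succ))) (hφ : Fn φ) :
    Fn (fun x => prec (f x) (fun a b => g a b x) (φ x)) := by
  obtain ⟨h, h1, h2, h3⟩ := exists_prec hf hg
  have key : ∀ x a, prec (f x) (fun a b => g a b x) a = h a x := by
    intro x a
    have hg' : Fn (fun y : Fin 2 → M => g (y 0) (y 1) x) := by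
      have := fn_comp hg (g := Matrix.vecCons (fun y : Fin 2 → M => y 0)
        (Matrix.vecCons (fun y : Fin 2 → M => y 1) (fun i _ => x i))) ?_
      · exact this
      · intro j
        refine Fin.cases ?_ (fun j => Fin.cases ?_ (fun j => ?_) j) j
        · exact fn_proj 0
        · exact fn_proj 1
        · exact fn_const _
    have hh : Fn (fun y : Fin 1 → M => h (y 0) x) := by
      have := fn_comp h1 (g := Matrix.vecCons (fun y : Fin 1 → M => y 0) (fun i _ => x i)) ?_
      · exact this
      · intro j
        refine Fin.cases ?_ (fun j => ?_) j
        · exact fn_proj 0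
        · exact fn_const _
    refine eq_induction (f := prec (f x) fun a b => g a b x) (g := fun a => h a x) ?_ ?_ a
      (prec_spec hg').1 hh
    · rw [prec_zero hg', h2]
    · intro a ih
      rw [prec_suc hg', h3, ih]
  have := fn_comp h1 (g := Matrix.vecCons φ (fun i x => x i)) ?_
  · convert this using 2 with x
    exact key x _
  · intro j
    refine Fin.cases ?_ (fun j => ?_) j
    · exact hφ
    · exact fn_proj _

/-! ### Addition and truncated subtraction -/

noncomputable instance : Add M := ⟨fun x y => prec x (fun _ b => suc b) y⟩

lemma add_def (x y : M) : x + y = prec x (fun _ b => suc b) y := rfl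

@[fun_prop] lemma fn_add {n : ℕ} {φ ψ : (Fin n → M) → M} (hφ : Fn φ) (hψ : Fn ψ) :
    Fn (fun x => φ x + ψ x) := by
  simp only [add_def]
  fun_prop

lemma model_add_zero (x : M) : x + 0 = x := prec_zero

lemma model_add_suc (x y : M) : x + suc y = suc (x + y) := prec_suc

lemma model_zero_add (x : M) : 0 + x = x :=
  eq_induction (f := fun a : M => (0 : M) + a) (g := fun a => a) (model_add_zero 0)
    (fun a h => by rw [model_add_suc, h]) x

lemma model_suc_add (x y : M) : suc x + y = suc (x + y) :=
  eq_induction (f := fun y => suc x + y) (g := fun y => suc (x + y))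
    (by simp only [model_add_zero]) (fun a h => by simp only [model_add_suc, h]) y

lemma model_add_comm (x y : M) : x + y = y + x :=
  eq_induction (f := fun y => x + y) (g := fun y => y + x)
    (by rw [model_add_zero, model_zero_add])
    (fun a h => by rw [model_add_suc, model_suc_add, h]) y

lemma model_add_assoc (x y z : M) : x + y + z = x + (y + z) :=
  eq_induction (f := fun z => x + y + z) (g := fun z => x + (y + z))
    (by simp only [model_add_zero]) (fun a h => by simp only [model_add_suc, h]) z

/-- The predecessor function. -/
noncomputable def pre (x : M) : M := prec 0 (fun a _ => a) x

@[fun_prop] lemma fn_pre {n : ℕ} {φ : (Fin n → M) → M} (hφ : Fn φ) : Fn (fun x => pre (φ x)) := by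
  unfold pre; fun_prop

@[simp] lemma pre_zero : pre (0 : M) = 0 := prec_zero

@[simp] lemma pre_suc (x : M) : pre (suc x) = x := prec_suc

/-- Truncated subtraction. -/
noncomputable def tsub (x y : M) : M := prec x (fun _ b => pre b) y

@[fun_prop] lemma fn_tsub {n : ℕ} {φ ψ : (Fin n → M) → M} (hφ : Fn φ) (hψ : Fn ψ) :
    Fn (fun x => tsub (φ x) (ψ x)) := by
  unfold tsub; fun_prop

lemma tsub_zero' (x : M) : tsub x 0 = x := prec_zero

lemma tsub_suc (x y : M) : tsub x (suc y) = pre (tsub x y) := prec_suc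

lemma tsub_suc_suc (x y : M) : tsub (suc x) (suc y) = tsub x y :=
  eq_induction (f := fun y => tsub (suc x) (suc y)) (g := fun y => tsub x y)
    (by simp only [tsub_suc, tsub_zero', pre_suc])
    (fun a h => by rw [tsub_suc, h, tsub_suc]) y

lemma add_tsub_self (x y : M) : tsub (x + y) x = y :=
  eq_induction (f := fun x => tsub (x + y) x) (g := fun _ => y)
    (by simp only [tsub_zero', model_zero_add])
    (fun a h => by rw [model_suc_add, tsub_suc_suc, h]) x

lemma tsub_add_self (x y : M) : tsub x (x + y) = 0 :=
  eq_induction (f := fun x => tsub x (x + y)) (g := fun _ => 0)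
    (by
      simp only [model_zero_add]
      exact eq_induction (f := fun y => tsub 0 y) (g := fun _ => 0) (tsub_zero' 0)
        (fun a h => by rw [tsub_suc, h, pre_zero]) y)
    (fun a h => by rw [model_suc_add, tsub_suc_suc, h]) x

lemma eq_zero_or_suc (x : M) : x = 0 ∨ x = suc (pre x) := by
  refine qf_induction (fun i => if i = 0 then id else if i = 1 then fun _ => (0 : M) else
      fun x => suc (pre x)) ?_
    (QFFormula.neg (QFFormula.and (QFFormula.neg (QFFormula.eq (unaryTerm 0) (unaryTerm 1)))
      (QFFormula.neg (QFFormula.eq (unaryTerm 0) (unaryTerm 2)))))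
    (P := fun x : M => x = (0 : M) ∨ x = suc (pre x)) ?_ (Or.inl rfl)
    (fun a _ => Or.inr (by simp)) x
  · intro i; split_ifs
    · exact fn_proj 0
    · exact fn_const _
    · fun_prop
  · intro a; simp [Str.Sat, or_iff_not_imp_left]

lemma add_tsub_of_le {x y : M} (h : x ≤ y) : x + tsub y x = y := by
  have key : ∀ d, tsub (x + d) x = d := add_tsub_self x
  rw [← lt_suc_iff] at h
  revert h
  refine qf_induction (fun i => if i = 0 then fun _ => x else if i = 1 then suc else
      if i = 2 then fun y => x + tsub y x else id) ?_
    (QFFormula.neg (QFFormula.and (QFFormula.lt (unaryTerm 0) (unaryTerm 1))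
      (QFFormula.neg (QFFormula.eq (unaryTerm 2) (unaryTerm 3)))))
    (P := fun y => x < suc y → x + tsub y x = y) ?_ ?_ ?_ y
  · intro i; split_ifs
    · exact fn_const _
    · exact fn_suc (fn_proj 0)
    · fun_prop
    · exact fn_proj 0
  · intro a; simp [Str.Sat]; rfl
  · intro h
    rw [lt_suc_iff] at h
    rw [le_antisymm h (model_zero_le x), model_zero_add, tsub_zero']
  · intro a ih h
    rcases lt_suc.1 h with h | rfl
    · have h1 := ih h
      have h2 : suc a = x + suc (tsub a x) := by rw [model_add_suc, h1]
      have h3 := key (suc (tsub a x))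
      rw [← h2] at h3
      rw [h3, ← h2]
    · have := key 0
      rw [model_add_zero] at this
      rw [this, model_add_zero]

lemma lt_iff_tsub_ne_zero {x y : M} : x < y ↔ tsub y x ≠ 0 := by
  constructor
  · intro h h0
    have := add_tsub_of_le h.le
    rw [h0, model_add_zero] at this
    exact h.ne this
  · intro h
    by_contra h'
    have := add_tsub_of_le (not_lt.1 h')
    apply h
    rw [← this, tsub_add_self]

/-! ### Decidable relations and their closure properties -/

/-- The relation `P` has a characteristic function in the model. -/
@[fun_prop] def Dp {n : ℕ} (P : (Fin n → M) → Prop) : Prop :=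
  open Classical in Fn (fun x => if P x then (1 : M) else 0)

@[fun_prop] lemma dp_const {n : ℕ} (p : Prop) : Dp (fun _ : Fin n → M => p) := fn_const _

lemma Dp.congr {n : ℕ} {P Q : (Fin n → M) → Prop} (h : Dp P) (hPQ : ∀ x, P x ↔ Q x) : Dp Q := by
  have : P = Q := funext fun x => propext (hPQ x)
  rwa [← this]

lemma one_ne_zero' : (1 : M) ≠ 0 := zero_ne_one_model.symm

/-- Definition by cases: `b` if `c = 0`, and `a` otherwise. -/
noncomputable def sel (c a b : M) : M := prec b (fun _ _ => a) c

lemma sel_zero (a b : M) : sel 0 a b = b := prec_zero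

lemma sel_of_ne {c : M} (hc : c ≠ 0) (a b : M) : sel c a b = a := by
  rcases eq_zero_or_suc c with h | h
  · exact absurd h hc
  · rw [h]; exact prec_suc

@[fun_prop] lemma fn_sel {n : ℕ} {φ ψ χ : (Fin n → M) → M} (hφ : Fn φ) (hψ : Fn ψ) (hχ : Fn χ) :
    Fn (fun x => sel (φ x) (ψ x) (χ x)) :=
  fn_comp₃ (f := sel) (by unfold sel; fun_prop) hφ hψ hχ

lemma dp_ne_zero {n : ℕ} {φ : (Fin n → M) → M} (hφ : Fn φ) : Dp (fun x => φ x ≠ 0) := by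
  classical
  have : Fn (fun x => sel (φ x) 1 0) := by fun_prop
  unfold Dp
  convert this using 2 with x
  split_ifs with h
  · rw [sel_of_ne h]
  · rw [not_not.1 h, sel_zero]

@[fun_prop] lemma Fn.ite {n : ℕ} {P : (Fin n → M) → Prop} [∀ x, Decidable (P x)] (hP : Dp P)
    {φ ψ : (Fin n → M) → M} (hφ : Fn φ) (hψ : Fn ψ) : Fn (fun x => if P x then φ x else ψ x) := by
  classical
  have := fn_sel (φ := fun x => if P x then 1 else 0) (by unfold Dp at hP; convert hP) hφ hψ
  convert this using 2 with x
  split_ifs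
  · rw [sel_of_ne one_ne_zero']
  · rw [sel_zero]

@[fun_prop] lemma dp_not {n : ℕ} {P : (Fin n → M) → Prop} (hP : Dp P) : Dp (fun x => ¬ P x) := by
  classical
  have := Fn.ite hP (fn_const 0) (fn_const 1)
  unfold Dp
  convert this using 2 with x
  by_cases h : P x <;> simp [h]

@[fun_prop] lemma dp_and {n : ℕ} {P Q : (Fin n → M) → Prop} (hP : Dp P) (hQ : Dp Q) :
    Dp (fun x => P x ∧ Q x) := by
  classical
  have := Fn.ite hP (Fn.ite hQ (fn_const 1) (fn_const 0)) (fn_const 0)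
  unfold Dp
  convert this using 2 with x
  split_ifs <;> simp_all

@[fun_prop] lemma dp_or {n : ℕ} {P Q : (Fin n → M) → Prop} (hP : Dp P) (hQ : Dp Q) :
    Dp (fun x => P x ∨ Q x) :=
  (dp_not (dp_and (dp_not hP) (dp_not hQ))).congr (fun x => by tauto)

@[fun_prop] lemma dp_imp {n : ℕ} {P Q : (Fin n → M) → Prop} (hP : Dp P) (hQ : Dp Q) :
    Dp (fun x => P x → Q x) :=
  (dp_or (dp_not hP) hQ).congr (fun x => by tauto)

@[fun_prop] lemma dp_iff {n : ℕ} {P Q : (Fin n → M) → Prop} (hP : Dp P) (hQ : Dp Q) :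
    Dp (fun x => P x ↔ Q x) :=
  (dp_and (dp_imp hP hQ) (dp_imp hQ hP)).congr (fun x => by tauto)

@[fun_prop] lemma dp_lt {n : ℕ} {φ ψ : (Fin n → M) → M} (hφ : Fn φ) (hψ : Fn ψ) :
    Dp (fun x => φ x < ψ x) :=
  (dp_ne_zero (fn_tsub hψ hφ)).congr (fun _ => lt_iff_tsub_ne_zero.symm)

@[fun_prop] lemma dp_le {n : ℕ} {φ ψ : (Fin n → M) → M} (hφ : Fn φ) (hψ : Fn ψ) :
    Dp (fun x => φ x ≤ ψ x) :=
  (dp_not (dp_lt hψ hφ)).congr (fun _ => not_lt)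

@[fun_prop] lemma dp_eq {n : ℕ} {φ ψ : (Fin n → M) → M} (hφ : Fn φ) (hψ : Fn ψ) :
    Dp (fun x => φ x = ψ x) :=
  (dp_and (dp_le hφ hψ) (dp_le hψ hφ)).congr (fun _ => le_antisymm_iff.symm)

lemma Dp.comp {m n : ℕ} {P : (Fin m → M) → Prop} (hP : Dp P) {g : Fin m → (Fin n → M) → M}
    (hg : ∀ j, Fn (g j)) : Dp (fun x => P (fun j => g j x)) :=
  fn_comp hP hg

lemma Dp.shift {n : ℕ} {P : M → (Fin n → M) → Prop}
    (hP : Dp (fun y : Fin (n + 1) → M => P (y 0) (fun i => y i.succ))) :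
    Dp (fun y : Fin (n + 2) → M => P (y 0) (fun i => y i.succ.succ)) :=
  Fn.shift (f := fun a x => open Classical in if P a x then (1 : M) else 0) hP

lemma Dp.fix {n : ℕ} {P : M → (Fin n → M) → Prop}
    (hP : Dp (fun y : Fin (n + 1) → M => P (y 0) (fun i => y i.succ))) (x : Fin n → M) :
    Dp (fun y : Fin 1 → M => P (y 0) x) := by
  refine Dp.comp hP (g := Matrix.vecCons (fun y : Fin 1 → M => y 0) (fun i _ => x i)) ?_
  intro j
  refine Fin.cases ?_ (fun j => ?_) j
  · exact fn_proj 0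
  · exact fn_const _

/-- Induction for relations with a characteristic function in the model. -/
lemma dp_induction {P : M → Prop} (h0 : P 0) (hs : ∀ a, P a → P (suc a)) (a : M)
    (hP : Dp (fun x : Fin 1 → M => P (x 0)) := by fun_prop) : P a := by
  classical
  have := eq_induction (f := fun a => if P a then (1 : M) else 0) (g := fun _ => 1)
    (by simp [h0]) (fun a h => by
      have : P a := by by_contra hn; simp [hn, one_ne_zero'.symm] at h
      simp [hs a this]) a (by unfold Dp at hP; convert hP) (fn_const 1)
  by_contra hn
  simp [hn, one_ne_zero'.symm] at this

@[fun_prop] lemma dp_forall_lt {n : ℕ} {b : (Fin n → M) → M} {P : M → (Fin n → M) → Prop}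
    (hb : Fn b) (hP : Dp (fun y : Fin (n + 1) → M => P (y 0) (fun i => y i.succ))) :
    Dp (fun x => ∀ i, i < b x → P i x) := by
  classical
  have hP' : ∀ x, Dp (fun y : Fin 2 → M => P (y 0) x) := fun x =>
    (hP.fix x).comp (g := fun _ y => y 0) (fun _ => fn_proj 0)
  have hF : Fn (fun x => prec 1 (fun i c => if P i x then c else 0) (b x)) := by
    have : Fn (fun y : Fin (n + 2) → M => if P (y 0) (fun i => y i.succ.succ) then y 1 else 0) :=
      Fn.ite hP.shift (fn_proj 1) (fn_const 0)
    exact fn_prec (fn_const 1) this hb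
  have key : ∀ x a, (prec 1 (fun i c => if P i x then c else 0) a ≠ (0 : M)) ↔
      ∀ i, i < a → P i x := by
    intro x a
    have hg : Fn (fun y : Fin 2 → M => if P (y 0) x then y 1 else 0) :=
      Fn.ite (hP' x) (fn_proj 1) (fn_const 0)
    have hF1 : Fn (fun y : Fin 1 → M => prec 1 (fun i c => if P i x then c else 0) (y 0)) :=
      (prec_spec hg).1
    constructor
    · have h1 : ∀ i a, i < a → prec 1 (fun i c => if P i x then c else 0) a ≠ (0 : M) →
          P i x := by
        intro i a
        refine dp_induction (P := fun a => i < a →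
          prec 1 (fun i c => if P i x then c else 0) a ≠ (0 : M) → P i x) ?_ ?_ a ?_
        · intro h; exact absurd h (not_lt_zero' _)
        · intro a ih hi h
          rw [prec_suc hg] at h
          split_ifs at h with h'
          · rcases lt_suc.1 hi with hi | rfl
            · exact ih hi h
            · exact h'
          · exact absurd rfl h
        · fun_prop
      exact fun h i hi => h1 i a hi h
    · intro h
      have h2 : ∀ c, c ≤ a → prec 1 (fun i c => if P i x then c else 0) c = (1 : M) := by
        intro c
        refine dp_induction (P := fun c => c ≤ a →
          prec 1 (fun i c => if P i x then c else 0) c = (1 : M)) ?_ ?_ c ?_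
        · intro _; exact prec_zero hg
        · intro c ih hc
          rw [prec_suc hg, if_pos (h c (suc_le_iff.1 hc)), ih (suc_le_iff.1 hc).le]
        · fun_prop
      rw [h2 a le_rfl]
      exact one_ne_zero'
  exact (dp_ne_zero hF).congr (fun x => key x _)

@[fun_prop] lemma dp_exists_lt {n : ℕ} {b : (Fin n → M) → M} {P : M → (Fin n → M) → Prop}
    (hb : Fn b) (hP : Dp (fun y : Fin (n + 1) → M => P (y 0) (fun i => y i.succ))) :
    Dp (fun x => ∃ i, i < b x ∧ P i x) :=
  (dp_not (dp_forall_lt (P := fun i x => ¬ P i x) hb (dp_not hP))).congr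
    (fun x => by push Not; rfl)

@[fun_prop] lemma dp_forall_le {n : ℕ} {b : (Fin n → M) → M} {P : M → (Fin n → M) → Prop}
    (hb : Fn b) (hP : Dp (fun y : Fin (n + 1) → M => P (y 0) (fun i => y i.succ))) :
    Dp (fun x => ∀ i, i ≤ b x → P i x) :=
  (dp_forall_lt (fn_suc hb) hP).congr (fun x => by simp only [lt_suc_iff])

@[fun_prop] lemma dp_exists_le {n : ℕ} {b : (Fin n → M) → M} {P : M → (Fin n → M) → Prop}
    (hb : Fn b) (hP : Dp (fun y : Fin (n + 1) → M => P (y 0) (fun i => y i.succ))) :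
    Dp (fun x => ∃ i, i ≤ b x ∧ P i x) :=
  (dp_exists_lt (fn_suc hb) hP).congr (fun x => by simp only [lt_suc_iff])

/-- The least number principle. -/
lemma exists_least {P : M → Prop} (h : ∃ a, P a)
    (hP : Dp (fun x : Fin 1 → M => P (x 0)) := by fun_prop) : ∃ a, P a ∧ ∀ b, b < a → ¬ P b := by
  by_contra hn
  push Not at hn
  obtain ⟨a, ha⟩ := h
  have : ∀ c b, b < c → ¬ P b := by
    intro c
    refine dp_induction (P := fun c => ∀ b, b < c → ¬ P b) ?_ ?_ c ?_
    · intro b hb; exact absurd hb (not_lt_zero' _)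
    · intro c ih b hb hPb
      rcases lt_suc.1 hb with hb | rfl
      · exact ih b hb hPb
      · obtain ⟨d, hd, hd'⟩ := hn b hPb
        exact ih d hd hd'
    · have := hP.comp (n := 2) (g := fun _ y => y 0) (fun _ => fn_proj 0)
      exact dp_forall_lt (P := fun i _ => ¬ P i) (fn_proj 0) (dp_not this)
  exact this (suc a) a (lt_suc_self a) ha

lemma strong_induction {P : M → Prop} (h : ∀ a, (∀ b, b < a → P b) → P a) (a : M)
    (hP : Dp (fun x : Fin 1 → M => P (x 0)) := by fun_prop) : P a := by
  by_contra hn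
  obtain ⟨b, hb, hb'⟩ := exists_least (P := fun a => ¬ P a) ⟨a, hn⟩ (dp_not hP)
  exact hb (h b (fun c hc => not_not.1 (hb' c hc)))

/-- The least `i` satisfying `P`, and `0` if there is none. -/
noncomputable def mu (P : M → Prop) : M :=
  open Classical in if h : ∃ a, P a ∧ ∀ b, b < a → ¬ P b then h.choose else 0

lemma mu_spec {P : M → Prop} (h : ∃ a, P a)
    (hP : Dp (fun x : Fin 1 → M => P (x 0)) := by fun_prop) :
    P (mu P) ∧ ∀ b, b < mu P → ¬ P b := by
  unfold mu
  rw [dif_pos (exists_least h hP)]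
  exact (exists_least h hP).choose_spec

lemma mu_le {P : M → Prop} {a : M} (h : P a)
    (hP : Dp (fun x : Fin 1 → M => P (x 0)) := by fun_prop) : mu P ≤ a :=
  not_lt.1 fun h' => (mu_spec ⟨a, h⟩ hP).2 a h' h

/-! ### Ordered arithmetic -/

noncomputable instance : AddCommMonoid M where
  add_assoc := model_add_assoc
  zero_add := model_zero_add
  add_zero := model_add_zero
  add_comm := model_add_comm
  nsmul := nsmulRec

lemma suc_eq (x : M) : suc x = x + 1 := by
  rw [one_eq_suc, model_add_suc, model_add_zero]

lemma lt_add_one_iff {x y : M} : x < y + 1 ↔ x ≤ y := by rw [← suc_eq, lt_suc_iff]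

lemma add_one_le_iff {x y : M} : x + 1 ≤ y ↔ x < y := by rw [← suc_eq, suc_le_iff]

lemma induct {P : M → Prop} (h0 : P 0) (hs : ∀ a, P a → P (a + 1)) (a : M)
    (hP : Dp (fun x : Fin 1 → M => P (x 0)) := by fun_prop) : P a :=
  dp_induction h0 (fun a h => by rw [suc_eq]; exact hs a h) a hP

lemma prec_add_one {z : M} {g : M → M → M} {a : M}
    (hg : Fn (fun y : Fin 2 → M => g (y 0) (y 1)) := by fun_prop) :
    prec z g (a + 1) = g a (prec z g a) := by
  rw [← suc_eq, prec_suc hg]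

lemma eq_zero_or_add_one (x : M) : x = 0 ∨ ∃ y, x = y + 1 := by
  rcases eq_zero_or_suc x with h | h
  · exact Or.inl h
  · exact Or.inr ⟨_, h.trans (suc_eq _)⟩

lemma add_lt_add_left' {x y : M} (h : x < y) (z : M) : x + z < y + z := by
  refine induct (P := fun z => x + z < y + z) (by simpa) (fun a ih => ?_) z
  rw [← add_assoc, ← add_assoc, ← suc_eq, ← suc_eq]
  exact suc_lt_suc ih

instance : IsOrderedCancelAddMonoid M :=
  IsOrderedCancelAddMonoid.of_add_lt_add_left (fun a b c h => by
    rw [add_comm a, add_comm a]; exact add_lt_add_left' h a)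

lemma zero_le' (x : M) : 0 ≤ x := model_zero_le x

instance : CanonicallyOrderedAdd M where
  exists_add_of_le h := ⟨_, (add_tsub_of_le h).symm⟩
  le_add_self a b := by have := zero_le' b; grind
  le_self_add a b := by have := zero_le' b; grind

lemma zero_lt_one' : (0 : M) < 1 := by
  rw [one_eq_suc]; exact lt_suc_self 0

lemma pos_of_ne {x : M} (h : x ≠ 0) : 0 < x := pos_iff_ne_zero.2 h

/-! ### Definability by graphs and bounded search -/

/-- A bounded function whose graph has a characteristic function in the model is a function of
the model. -/
lemma Fn.of_graph {n : ℕ} {φ b : (Fin n → M) → M} (hb : Fn b) (hφ : ∀ x, φ x ≤ b x)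
    (hgr : Dp (fun y : Fin (n + 1) → M => y 0 = φ (fun i => y i.succ))) : Fn φ := by
  classical
  have hg : ∀ x, Fn (fun y : Fin 2 → M => if y 0 = φ x then y 0 else y 1) := by
    intro x; fun_prop
  have hF : Fn (fun x => prec 0 (fun i c => if i = φ x then i else c) (b x + 1)) := by
    refine fn_prec (g := fun i c x => if i = φ x then i else c) (fn_const 0) ?_
      (fn_add hb (fn_const 1))
    exact Fn.ite (Dp.shift (P := fun a x => a = φ x) hgr) (fn_proj 0) (fn_proj 1)
  have key : ∀ x k, φ x < k → prec 0 (fun i c => if i = φ x then i else c) k = φ x := by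
    intro x k
    have := (prec_spec (z := (0 : M)) (g := fun i c => if i = φ x then i else c) (hg x)).1
    refine induct (P := fun k => φ x < k → prec 0 (fun i c => if i = φ x then i else c) k = φ x)
      (fun h => absurd h (not_lt_zero' _)) (fun a ih h => ?_) k (by fun_prop)
    rw [prec_add_one (hg x)]
    split_ifs with h'
    · exact h'
    · exact ih (lt_of_le_of_ne (lt_add_one_iff.1 h) (Ne.symm h'))
  convert hF using 2 with x
  exact (key x _ (lt_add_one_iff.2 (hφ x))).symm

lemma mu_eq_zero {P : M → Prop} (h : ∀ a, ¬ P a) : mu P = 0 := by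
  unfold mu
  rw [dif_neg]
  rintro ⟨a, ha, _⟩
  exact h a ha

@[fun_prop] lemma fn_mu {n : ℕ} {b : (Fin n → M) → M} {P : M → (Fin n → M) → Prop} (hb : Fn b)
    (hP : Dp (fun y : Fin (n + 1) → M => P (y 0) (fun i => y i.succ))) :
    Fn (fun x => mu (fun i => i < b x ∧ P i x)) := by
  have hP' : ∀ x, Dp (fun y : Fin 1 → M => y 0 < b x ∧ P (y 0) x) := fun x =>
    dp_and (by fun_prop) (hP.fix x)
  have h1 := fun x (h : ∃ a, a < b x ∧ P a x) => mu_spec h (hP' x)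
  have h2 := fun x (h : ∀ a, ¬ (a < b x ∧ P a x)) => mu_eq_zero h
  refine Fn.of_graph hb ?_ ?_
  · intro x
    by_cases h : ∃ a, a < b x ∧ P a x
    · exact (h1 x h).1.1.le
    · push Not at h
      rw [h2 x (by simpa using h)]
      exact zero_le' _
  · have hd1 : Dp (fun y : Fin (n + 1) → M => ∀ j, j < y 0 → ¬ P j (fun i => y i.succ)) :=
      dp_forall_lt (P := fun j y => ¬ P j (fun i => y i.succ)) (fn_proj 0) (dp_not hP.shift)
    have hd2 : Dp (fun y : Fin (n + 1) → M => ∀ j, j < b (fun i => y i.succ) →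
        ¬ P j (fun i => y i.succ)) :=
      dp_forall_lt (P := fun j y => ¬ P j (fun i => y i.succ)) hb.weaken (dp_not hP.shift)
    have : Dp (fun y : Fin (n + 1) → M => (y 0 < b (fun i => y i.succ) ∧ P (y 0) (fun i => y i.succ)
        ∧ ∀ j, j < y 0 → ¬ P j (fun i => y i.succ)) ∨
        (y 0 = 0 ∧ ∀ j, j < b (fun i => y i.succ) → ¬ P j (fun i => y i.succ))) :=
      dp_or (dp_and (dp_lt (fn_proj 0) hb.weaken) (dp_and hP hd1)) (dp_and (by fun_prop) hd2)
    refine this.congr (fun y => ?_)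
    by_cases h : ∃ a, a < b (fun i => y i.succ) ∧ P a (fun i => y i.succ)
    · obtain ⟨⟨h3, h4⟩, h5⟩ := h1 _ h
      constructor
      · rintro (⟨h6, h7, h8⟩ | ⟨_, h6⟩)
        · refine le_antisymm (not_lt.1 fun h => h8 _ h h4) (not_lt.1 fun h => h5 _ h ⟨h6, h7⟩)
        · obtain ⟨a, ha, ha'⟩ := h
          exact absurd ha' (h6 a ha)
      · intro h6
        rw [h6]
        exact Or.inl ⟨h3, h4, fun j hj hPj => h5 j hj ⟨hj.trans h3, hPj⟩⟩
    · push Not at h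
      rw [h2 _ (by simpa using h)]
      constructor
      · rintro (⟨h6, h7, h8⟩ | ⟨h6, _⟩)
        · exact absurd h7 (h _ h6)
        · exact h6
      · exact fun h6 => Or.inr ⟨h6, h⟩

/-! ### Bundled functions and relations -/

variable (M) in
/-- A unary function of the model. -/
structure Fun₁ where
  /-- the underlying function -/
  toFun : M → M
  fn : Fn (fun x : Fin 1 → M => toFun (x 0))

variable (M) in
/-- A set of numbers with a characteristic function in the model. -/
structure Rel₁ where
  /-- the underlying predicate -/
  rel : M → Prop
  dp : Dp (fun x : Fin 1 → M => rel (x 0))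

variable (M) in
/-- A binary relation with a characteristic function in the model. -/
structure Rel₂ where
  /-- the underlying relation -/
  rel : M → M → Prop
  dp : Dp (fun x : Fin 2 → M => rel (x 0) (x 1))

instance : CoeFun (Fun₁ M) (fun _ => M → M) := ⟨Fun₁.toFun⟩

instance : CoeFun (Rel₁ M) (fun _ => M → Prop) := ⟨Rel₁.rel⟩

instance : CoeFun (Rel₂ M) (fun _ => M → M → Prop) := ⟨Rel₂.rel⟩

@[fun_prop] lemma fn_fun₁ {n : ℕ} (F : Fun₁ M) {φ : (Fin n → M) → M} (hφ : Fn φ) :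
    Fn (fun x => F (φ x)) := fn_comp₁ F.fn hφ

@[fun_prop] lemma dp_rel₁ {n : ℕ} (R : Rel₁ M) {φ : (Fin n → M) → M} (hφ : Fn φ) :
    Dp (fun x => R (φ x)) := R.dp.comp (g := fun _ => φ) (fun _ => hφ)

lemma Dp.comp₂ {n : ℕ} {R : M → M → Prop} (hR : Dp (fun x : Fin 2 → M => R (x 0) (x 1)))
    {φ ψ : (Fin n → M) → M} (hφ : Fn φ) (hψ : Fn ψ) : Dp (fun x => R (φ x) (ψ x)) := by
  have := hR.comp (g := ![φ, ψ]) (by intro j; fin_cases j <;> simpa)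
  simpa using this

@[fun_prop] lemma dp_rel₂ {n : ℕ} (R : Rel₂ M) {φ ψ : (Fin n → M) → M} (hφ : Fn φ) (hψ : Fn ψ) :
    Dp (fun x => R (φ x) (ψ x)) := R.dp.comp₂ hφ hψ

/-! ### Numbers as finite sets -/

/-- The parity of a number. -/
noncomputable def par (x : M) : M :=
  open Classical in prec 0 (fun _ b => if b = 0 then 1 else 0) x

@[fun_prop] lemma fn_par {n : ℕ} {φ : (Fin n → M) → M} (hφ : Fn φ) : Fn (fun x => par (φ x)) := by
  unfold par; fun_prop

/-- Half of a number, rounded down. -/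
noncomputable def half (x : M) : M :=
  open Classical in prec 0 (fun a b => if par a = 0 then b else b + 1) x

@[fun_prop] lemma fn_half {n : ℕ} {φ : (Fin n → M) → M} (hφ : Fn φ) : Fn (fun x => half (φ x)) := by
  unfold half; fun_prop

@[simp] lemma par_zero : par (0 : M) = 0 := prec_zero

lemma par_add_one (x : M) [Decidable (par x = 0)] : par (x + 1) = if par x = 0 then 1 else 0 := by
  unfold par
  rw [prec_add_one]
  congr

@[simp] lemma half_zero : half (0 : M) = 0 := prec_zero

lemma half_add_one (x : M) [Decidable (par x = 0)] :
    half (x + 1) = if par x = 0 then half x else half x + 1 := by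
  unfold half
  rw [prec_add_one]
  congr

lemma par_eq (x : M) : par x = 0 ∨ par x = 1 := by
  classical
  refine induct (P := fun x => par x = 0 ∨ par x = 1) (by simp) (fun a _ => ?_) x
  rw [par_add_one]
  split_ifs <;> simp

lemma half_add_half (x : M) : half x + half x + par x = x := by
  classical
  refine induct (P := fun x => half x + half x + par x = x) (by simp) (fun a ih => ?_) x
  rw [par_add_one, half_add_one]
  split_ifs with h
  · rw [h] at ih; rw [← ih]; grind
  · have := (par_eq a).resolve_left h
    grind

lemma par_double (x : M) : par (x + x) = 0 := by
  classical
  refine induct (P := fun x => par (x + x) = 0) (by simp) (fun a ih => ?_) x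
  have : a + 1 + (a + 1) = a + a + 1 + 1 := by grind
  rw [this, par_add_one, par_add_one, if_pos ih, if_neg one_ne_zero']

lemma par_double_add_one (x : M) : par (x + x + 1) = 1 := by
  classical
  rw [par_add_one, if_pos (par_double x)]

lemma half_double (x : M) : half (x + x) = x := by
  have h := half_add_half (x + x)
  rw [par_double] at h
  rcases lt_trichotomy (half (x + x)) x with h' | h' | h' <;> grind

lemma half_double_add_one (x : M) : half (x + x + 1) = x := by
  classical
  rw [half_add_one, if_pos (par_double x), half_double]

lemma half_lt {x : M} (h : x ≠ 0) : half x < x := by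
  have h1 := half_add_half x
  by_contra h2
  have h3 := zero_le' (par x)
  have h4 := pos_of_ne h
  grind

lemma half_le (x : M) : half x ≤ x := by
  have h1 := half_add_half x
  have h2 := zero_le' (par x)
  have h3 := zero_le' (half x)
  grind

/-- Ackermann's membership relation: `i ∈ x` if the `i`-th binary digit of `x` is `1`. -/
instance : Membership M M := ⟨fun x i => par (prec x (fun _ b => half b) i) = 1⟩

lemma mem_def {i x : M} : i ∈ x ↔ par (prec x (fun _ b => half b) i) = 1 := Iff.rfl

@[fun_prop] lemma dp_mem {n : ℕ} {φ ψ : (Fin n → M) → M} (hφ : Fn φ) (hψ : Fn ψ) :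
    Dp (fun x => φ x ∈ ψ x) := by
  simp only [mem_def]; fun_prop

lemma zero_mem {x : M} : 0 ∈ x ↔ par x = 1 := by
  rw [mem_def, prec_zero]

lemma add_one_mem {i x : M} : i + 1 ∈ x ↔ i ∈ half x := by
  rw [mem_def, mem_def]
  have : prec x (fun _ b => half b) (i + 1) = prec (half x) (fun _ b => half b) i := by
    refine induct (P := fun i => prec x (fun _ b => half b) (i + 1) =
      prec (half x) (fun _ b => half b) i) ?_ (fun a ih => ?_) i
    · rw [prec_add_one, prec_zero, prec_zero]
    · rw [prec_add_one, ih, prec_add_one]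
  rw [this]

lemma lt_of_mem {i x : M} (h : i ∈ x) : i < x := by
  have : ∀ j, j ≤ i → j ∈ x → j < x := by
    refine strong_induction (P := fun x => ∀ j, j ≤ i → j ∈ x → j < x) (fun x ih j hj hjx => ?_) x
    by_cases hx : x = 0
    · have : prec (0 : M) (fun _ b => half b) j = 0 :=
        induct (P := fun j => prec (0 : M) (fun _ b => half b) j = 0) prec_zero
          (fun a ih => by rw [prec_add_one, ih, half_zero]) j
      rw [mem_def, hx, this, par_zero] at hjx
      exact absurd hjx.symm one_ne_zero'
    · rcases eq_zero_or_add_one j with rfl | ⟨k, rfl⟩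
      · exact pos_of_ne hx
      · have h1 := ih _ (half_lt hx) k ((add_one_le_iff.1 hj).le) (add_one_mem.1 hjx)
        exact (add_one_le_iff.2 h1).trans_lt (half_lt hx)
  exact this i le_rfl h

@[simp] lemma notMem_zero (i : M) : i ∉ (0 : M) := fun h => not_lt_zero' _ (lt_of_mem h)

/-- Codes are monotone, so all subsets of a finite set are bounded by its code. -/
lemma le_of_subset {x y : M} (h : ∀ i, i ∈ x → i ∈ y) : x ≤ y := by
  have : ∀ z, z ≤ y → (∀ i, i < x → i ∈ x → i ∈ z) → x ≤ z := by
    refine strong_induction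
      (P := fun x => ∀ z, z ≤ y → (∀ i, i < x → i ∈ x → i ∈ z) → x ≤ z) (fun x ih z hz h => ?_) x
    by_cases hx : x = 0
    · rw [hx]; exact zero_le' _
    · have h1 := ih (half x) (half_lt hx) (half z) ((half_le z).trans hz) (fun i _ hi =>
        add_one_mem.1 (h (i + 1) (lt_of_mem (add_one_mem.2 hi)) (add_one_mem.2 hi)))
      have h2 : par x ≤ par z := by
        rcases par_eq x with h3 | h3
        · rw [h3]; exact zero_le' _
        · rw [h3, zero_mem.1 (h 0 (pos_of_ne hx) (zero_mem.2 h3))]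
      have h3 := half_add_half x
      have h4 := half_add_half z
      grind
  exact this y le_rfl (fun i _ => h i)

lemma set_ext {x y : M} (h : ∀ i, i ∈ x ↔ i ∈ y) : x = y :=
  le_antisymm (le_of_subset fun i => (h i).1) (le_of_subset fun i => (h i).2)

/-- The set of all numbers below `n`. -/
noncomputable def seg (n : M) : M := prec 0 (fun _ b => b + b + 1) n

@[fun_prop] lemma fn_seg {n : ℕ} {φ : (Fin n → M) → M} (hφ : Fn φ) : Fn (fun x => seg (φ x)) := by
  unfold seg; fun_prop

lemma seg_zero : seg (0 : M) = 0 := prec_zero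

lemma seg_add_one (n : M) : seg (n + 1) = seg n + seg n + 1 := prec_add_one

@[simp] lemma mem_seg {i n : M} : i ∈ seg n ↔ i < n := by
  have : ∀ j, j ≤ i → (j ∈ seg n ↔ j < n) := by
    refine induct (P := fun n => ∀ j, j ≤ i → (j ∈ seg n ↔ j < n)) ?_ (fun n ih j hj => ?_) n
    · intro j _
      rw [seg_zero]
      exact iff_of_false (notMem_zero j) (not_lt_zero' j)
    · rw [seg_add_one]
      rcases eq_zero_or_add_one j with rfl | ⟨k, rfl⟩
      · rw [zero_mem, par_double_add_one, lt_add_one_iff]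
        exact iff_of_true rfl (zero_le' _)
      · rw [add_one_mem, half_double_add_one, ih k (add_one_le_iff.1 hj).le]
        constructor <;> intro h <;> grind
  exact this i le_rfl

/-- The digits of the code are found from the top: the `d` digits from place `j` on determine the
`d + 1` digits from place `j - 1` on. The bounds make the claim an instance of induction for
relations with a characteristic function. -/
lemma exists_code {P : M → Prop} (hP : Dp (fun x : Fin 1 → M => P (x 0))) (N : M) :
    ∃ c : M, ∀ i, i ∈ c ↔ i < N ∧ P i := by
  classical
  obtain ⟨R, rfl⟩ : ∃ R : Rel₁ M, R.rel = P := ⟨⟨P, hP⟩, rfl⟩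
  have key : ∀ d, ∀ j, j ≤ N → j + d = N → ∃ c : M, c ≤ seg d ∧
      ∀ i, i ≤ seg N + N → (i ∈ c ↔ i < d ∧ R (i + j)) := by
    intro d
    refine induct (P := fun d => ∀ j, j ≤ N → j + d = N → ∃ c : M, c ≤ seg d ∧
      ∀ i, i ≤ seg N + N → (i ∈ c ↔ i < d ∧ R (i + j))) ?_ (fun d ih j hj hjd => ?_) d ?_
    · intro j _ _
      refine ⟨0, zero_le' _, fun i _ => iff_of_false (notMem_zero _) ?_⟩
      exact fun h => not_lt_zero' _ h.1
    · obtain ⟨c, hc, hc'⟩ := ih (j + 1) (by have := zero_le' d; grind) (by grind)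
      refine ⟨c + c + if R j then 1 else 0, ?_, fun i hi => ?_⟩
      · rw [seg_add_one]
        have := zero_lt_one' (M := M)
        split_ifs <;> grind
      · rcases eq_zero_or_add_one i with rfl | ⟨k, rfl⟩
        · rw [zero_mem, zero_add]
          have : 0 < d + 1 := lt_add_one_iff.2 (zero_le' _)
          split_ifs with h
          · exact iff_of_true (par_double_add_one c) ⟨this, h⟩
          · rw [add_zero, par_double]
            exact iff_of_false one_ne_zero'.symm (fun h' => h h'.2)
        · have h1 : half (c + c + if R j then 1 else 0) = c := by
            split_ifs
            · exact half_double_add_one c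
            · rw [add_zero, half_double]
          rw [add_one_mem, h1, hc' k ((add_one_le_iff.1 hi).le)]
          have h2 : k + (j + 1) = k + 1 + j := by grind
          have h3 : k + 1 < d + 1 ↔ k < d := by constructor <;> intro h <;> grind
          rw [h2, h3]
    · fun_prop
  obtain ⟨c, hc, hc'⟩ := key N 0 (zero_le' _) (zero_add _)
  refine ⟨c, fun i => ?_⟩
  by_cases hi : i ≤ seg N + N
  · rw [hc' i hi, add_zero]
  · have h0 := zero_le' N
    have h1 := zero_le' (seg N)
    refine iff_of_false (fun h => hi ?_) (fun h => hi ?_)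
    · have := lt_of_mem h; grind
    · have := h.1; grind

/-- The code of the finite set `{i < N | P i}`, for a relation `P` with a characteristic function
in the model. -/
noncomputable def code (P : M → Prop) (N : M) : M :=
  open Classical in if h : ∃ c : M, ∀ i, i ∈ c ↔ i < N ∧ P i then h.choose else 0

lemma mem_code {P : M → Prop} {N i : M}
    (hP : Dp (fun x : Fin 1 → M => P (x 0)) := by fun_prop) : i ∈ code P N ↔ i < N ∧ P i := by
  unfold code
  rw [dif_pos (exists_code hP N)]
  exact (exists_code hP N).choose_spec i

@[fun_prop] lemma fn_code {n : ℕ} {b : (Fin n → M) → M} {P : M → (Fin n → M) → Prop} (hb : Fn b)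
    (hP : Dp (fun y : Fin (n + 1) → M => P (y 0) (fun i => y i.succ))) :
    Fn (fun x => code (fun i => P i x) (b x)) := by
  have h1 := fun x i => mem_code (P := fun i => P i x) (N := b x) (i := i) (hP.fix x)
  refine Fn.of_graph (fn_seg hb) (fun x => le_of_subset fun i hi => ?_) ?_
  · exact mem_seg.2 ((h1 x i).1 hi).1
  · have : Dp (fun y : Fin (n + 1) → M => ∀ j, j < y 0 + b (fun i => y i.succ) →
        (j ∈ y 0 ↔ j < b (fun i => y i.succ) ∧ P j (fun i => y i.succ))) := by
      refine dp_forall_lt (P := fun j y => (j ∈ y 0 ↔ j < b (fun i => y i.succ) ∧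
        P j (fun i => y i.succ))) (fn_add (fn_proj 0) hb.weaken) (dp_iff (by fun_prop)
        (dp_and (dp_lt (fn_proj 0) hb.weaken.weaken) hP.shift))
    refine this.congr (fun y => ⟨fun h => set_ext fun i => ?_, fun h j _ => ?_⟩)
    · rw [h1]
      by_cases hi : i < y 0 + b (fun i => y i.succ)
      · exact h i hi
      · have h2 := zero_le' (y 0)
        have h3 := zero_le' (b (fun i => y i.succ))
        refine iff_of_false (fun h => hi ?_) (fun h => hi ?_)
        · have := lt_of_mem h; grind
        · have := h.1; grind
    · rw [h, h1]

/-! ### Pairing and bounds -/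

/-- The pair `(a, b)`, coded by the set `{a, a + 1 + b}`. -/
noncomputable def pr (a b : M) : M := code (fun i => i = a ∨ i = a + 1 + b) (a + 1 + b + 1)

@[fun_prop] lemma fn_pr {n : ℕ} {φ ψ : (Fin n → M) → M} (hφ : Fn φ) (hψ : Fn ψ) :
    Fn (fun x => pr (φ x) (ψ x)) := fn_comp₂ (f := pr) (by unfold pr; fun_prop) hφ hψ

lemma mem_pr {a b i : M} : i ∈ pr a b ↔ i = a ∨ i = a + 1 + b := by
  unfold pr
  rw [mem_code]
  refine ⟨And.right, fun h => ⟨?_, h⟩⟩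
  have := zero_le' b
  have := zero_lt_one' (M := M)
  rcases h with rfl | rfl <;> grind

lemma pr_inj {a b a' b' : M} (h : pr a b = pr a' b') : a = a' ∧ b = b' := by
  have h1 : a = a' ∨ a = a' + 1 + b' := mem_pr.1 (h ▸ mem_pr.2 (Or.inl rfl))
  have h2 : a' = a ∨ a' = a + 1 + b := mem_pr.1 (h.symm ▸ mem_pr.2 (Or.inl rfl))
  have h3 : a + 1 + b = a' ∨ a + 1 + b = a' + 1 + b' := mem_pr.1 (h ▸ mem_pr.2 (Or.inr rfl))
  have := zero_le' b
  have := zero_le' b'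
  have := zero_lt_one' (M := M)
  have : a = a' := by
    rcases h1 with h1 | h1
    · exact h1
    · rcases h2 with h2 | h2 <;> grind
  exact ⟨this, by rcases h3 with h3 | h3 <;> grind⟩

lemma left_lt_pr (a b : M) : a < pr a b := lt_of_mem (mem_pr.2 (Or.inl rfl))

lemma right_lt_pr (a b : M) : b < pr a b := by
  have h := lt_of_mem (mem_pr.2 (Or.inr rfl) : a + 1 + b ∈ pr a b)
  have := zero_le' a
  have := zero_lt_one' (M := M)
  grind

/-- The first component of a pair. -/
noncomputable def fst (z : M) : M := mu (fun a => a < z ∧ ∃ b, b < z ∧ z = pr a b)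

/-- The second component of a pair. -/
noncomputable def snd (z : M) : M := mu (fun b => b < z ∧ ∃ a, a < z ∧ z = pr a b)

@[fun_prop] lemma fn_fst {n : ℕ} {φ : (Fin n → M) → M} (hφ : Fn φ) : Fn (fun x => fst (φ x)) :=
  fn_comp₁ (f := fst) (by unfold fst; fun_prop) hφ

@[fun_prop] lemma fn_snd {n : ℕ} {φ : (Fin n → M) → M} (hφ : Fn φ) : Fn (fun x => snd (φ x)) :=
  fn_comp₁ (f := snd) (by unfold snd; fun_prop) hφ

@[simp] lemma fst_pr (a b : M) : fst (pr a b) = a := by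
  obtain ⟨⟨_, c, _, h⟩, _⟩ := mu_spec (P := fun a' => a' < pr a b ∧ ∃ c, c < pr a b ∧
    pr a b = pr a' c) ⟨a, left_lt_pr a b, b, right_lt_pr a b, rfl⟩
  exact (pr_inj h).1.symm

@[simp] lemma snd_pr (a b : M) : snd (pr a b) = b := by
  obtain ⟨⟨_, c, _, h⟩, _⟩ := mu_spec (P := fun b' => b' < pr a b ∧ ∃ c, c < pr a b ∧
    pr a b = pr c b') ⟨b, right_lt_pr a b, a, left_lt_pr a b, rfl⟩
  exact (pr_inj h).2.symm

/-- A strict upper bound of the values `f i`, `i < n`. -/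
noncomputable def bnd (f : M → M) (n : M) : M := prec 0 (fun i b => b + f i + 1) n

lemma lt_bnd {f : M → M} {i n : M} (hi : i < n)
    (hf : Fn (fun x : Fin 1 → M => f (x 0)) := by fun_prop) : f i < bnd f n := by
  obtain ⟨F, rfl⟩ : ∃ F : Fun₁ M, F.toFun = f := ⟨⟨f, hf⟩, rfl⟩
  unfold bnd
  revert hi
  refine induct (P := fun n => i < n → F i < prec 0 (fun i b => b + F i + 1) n)
    (fun h => absurd h (not_lt_zero' _)) (fun n ih hi => ?_) n
  rw [prec_add_one]
  have := zero_lt_one' (M := M)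
  have := zero_le' (F n)
  have := zero_le' (prec 0 (fun i b => b + F i + 1) n)
  rcases (lt_add_one_iff.1 hi).lt_or_eq with h | rfl
  · have := ih h
    grind
  · grind

@[fun_prop] lemma fn_bnd {n : ℕ} {φ : (Fin n → M) → M} {f : M → (Fin n → M) → M}
    (hf : Fn (fun y : Fin (n + 1) → M => f (y 0) (fun i => y i.succ))) (hφ : Fn φ) :
    Fn (fun x => bnd (fun i => f i x) (φ x)) := by
  exact fn_prec (g := fun i b x => b + f i x + 1) (fn_const 0)
    (fn_add (fn_add (fn_proj 1) hf.shift) (fn_const 1)) hφ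

/-! ### Quantifier-free choice in terms of characteristic functions -/

variable (M) in
/-- The axiom of choice for relations with a characteristic function in the model. -/
def Choice : Prop := ∀ R : Rel₂ M, (∀ a, ∃ b, R a b) → ∃ f : Fun₁ M, ∀ a, R a (f a)

/-- The assignment interpreting the function variables of arity `n` by `f`. -/
def constAssign {n : ℕ} (f : (Fin n → M) → M) : (m : ℕ) → ℕ → (Fin m → M) → M :=
  fun m _ => if h : m = n then h ▸ f else fun _ => 0

lemma constAssign_self {n : ℕ} (f : (Fin n → M) → M) (i : ℕ) : constAssign f n i = f := by
  simp [constAssign]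

lemma isAssignment_constAssign {n : ℕ} {f : (Fin n → M) → M} (hf : Fn f) :
    (str (M := M)).IsAssignment (constAssign f) := by
  intro m i
  by_cases h : m = n
  · subst h; rw [constAssign_self]; exact hf
  · simp only [constAssign, dif_neg h]; exact fn_const 0

/-- Every primitive recursive function symbol denotes a function of the model. -/
lemma fn_prf {n : ℕ} (f : PRFun n) : Fn (fun x : Fin n → M => (str (M := M)).prf f x) := by
  induction f with
  | zero =>
    have : (fun x : Fin 0 → M => (str (M := M)).prf PRFun.zero x) = fun _ => 0 := by
      funext x; rw [Subsingleton.elim x ![]]; rfl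
    rw [this]; exact fn_const 0
  | succ =>
    have : (fun x : Fin 1 → M => (str (M := M)).prf PRFun.succ x) = fun x => suc (x 0) := by
      funext x
      rw [show x = ![x 0] from funext fun i => by fin_cases i; rfl]
      rfl
    rw [this]; fun_prop
  | proj i => simp only [isModel.prf_proj]; fun_prop
  | comp f g hf hg => simp only [isModel.prf_comp]; exact fn_comp hf hg
  | @prec n f g hf hg =>
    have hg' : Fn (fun y : Fin (n + 2) → M => (str (M := M)).prf g
        (Matrix.vecCons (y 0) (Matrix.vecCons (y 1) (fun i => y i.succ.succ)))) := by
      convert hg using 3 with y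
      funext i
      refine Fin.cases ?_ (fun j => Fin.cases ?_ (fun j => ?_) j) i <;> rfl
    obtain ⟨h, h1, h2, h3⟩ := exists_prec hf (g := fun a b x => (str (M := M)).prf g
      (Matrix.vecCons a (Matrix.vecCons b x))) hg'
    -- The function symbol is not yet known to denote a function of the model, so the induction is
    -- applied to an equation that contains the symbol itself.
    have key : ∀ a x, (str (M := M)).prf (PRFun.prec f g) (Matrix.vecCons a x) = h a x := by
      intro a x
      let e : ℕ → M := fun i => if hi : i - 1 < n then x ⟨i - 1, hi⟩ else 0
      let H : (Fin (n + 1) → M) → M := fun y => h (y 0) (fun i => y i.succ)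
      have he : ∀ a, (fun i : Fin (n + 1) => Function.update e 0 a i) = Matrix.vecCons a x := by
        intro a
        funext i
        refine Fin.cases ?_ (fun j => ?_) i
        · simp
        · simp [e]
      have hSat : ∀ a, (str (M := M)).Sat (Function.update e 0 a) (constAssign H)
          (QFFormula.eq (Term.prf (PRFun.prec f g) (fun i => Term.var i))
            (Term.app (n := n + 1) 0 (fun i => Term.var i))) ↔
          (str (M := M)).prf (PRFun.prec f g) (Matrix.vecCons a x) = h a x := by
        intro a
        simp only [Str.Sat, Str.eval, constAssign_self, he]
        rfl
      refine (hSat a).1 (isModel.qfInd _ 0 e _ (isAssignment_constAssign h1) ((hSat _).2 ?_)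
        (fun a ih => (hSat _).2 ?_) a)
      · exact (isModel.prf_prec_zero f g x).trans (h2 x).symm
      · exact (isModel.prf_prec_succ f g a x).trans (by rw [(hSat a).1 ih]; exact (h3 a x).symm)
    convert h1 using 2 with y
    rw [← key]
    congr 1
    funext i
    refine Fin.cases ?_ (fun j => ?_) i <;> rfl

lemma fn_eval {n : ℕ} {e : (Fin n → M) → ℕ → M} (he : ∀ i, Fn (fun x => e x i))
    {E : (n : ℕ) → ℕ → (Fin n → M) → M} (hE : (str (M := M)).IsAssignment E) (t : Term) :
    Fn (fun x => (str (M := M)).eval (e x) E t) := by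
  induction t with
  | var i => exact he i
  | prf f t ih => exact fn_comp (fn_prf f) ih
  | app i t ih => exact fn_comp (hE _ i) ih

lemma dp_sat {n : ℕ} {e : (Fin n → M) → ℕ → M} (he : ∀ i, Fn (fun x => e x i))
    {E : (n : ℕ) → ℕ → (Fin n → M) → M} (hE : (str (M := M)).IsAssignment E) (θ : QFFormula) :
    Dp (fun x => (str (M := M)).Sat (e x) E θ) := by
  induction θ with
  | eq t₁ t₂ => exact dp_eq (fn_eval he hE t₁) (fn_eval he hE t₂)
  | lt t₁ t₂ => exact dp_lt (fn_eval he hE t₁) (fn_eval he hE t₂)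
  | neg θ ih => exact dp_not ih
  | and θ₁ θ₂ ih₁ ih₂ => exact dp_and ih₁ ih₂

/-- `QF-AC` is the axiom of choice for relations with a characteristic function: the truth of a
quantifier-free formula has one, and conversely `χ (n, m) = 1` is a quantifier-free formula. -/
lemma qfac_iff_choice : (str (M := M)).QFAC ↔ Choice M := by
  classical
  constructor
  · intro h R hR
    have hχ : Fn (fun x : Fin 2 → M => if R (x 0) (x 1) then (1 : M) else 0) := by fun_prop
    have key : ∀ a b, (str (M := M)).Sat (Function.update (Function.update (fun _ => 0) 0 a) 1 b)
        (constAssign fun x : Fin 2 → M => if R (x 0) (x 1) then (1 : M) else 0)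
        (QFFormula.eq (Term.app (n := 2) 0 ![Term.var 0, Term.var 1])
          (Term.prf PRFun.succ ![Term.prf PRFun.zero ![]])) ↔ R a b := by
      intro a b
      have h1 : (str (M := M)).prf PRFun.succ ![(str (M := M)).prf PRFun.zero ![]] = 1 := rfl
      simp only [Str.Sat, Str.eval, constAssign_self]
      change (if R (Function.update (Function.update (fun _ => (0 : M)) 0 a) 1 b 0)
        (Function.update (Function.update (fun _ => (0 : M)) 0 a) 1 b 1) then (1 : M) else 0) =
        (str (M := M)).prf PRFun.succ _ ↔ _
      rw [show (fun j : Fin 1 => (str (M := M)).eval (Function.update (Function.update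
        (fun _ => (0 : M)) 0 a) 1 b) (constAssign fun x : Fin 2 → M =>
        if R (x 0) (x 1) then (1 : M) else 0) (![Term.prf PRFun.zero ![]] j)) =
        ![(str (M := M)).prf PRFun.zero ![]] from ?_, h1]
      · simp [one_ne_zero'.symm]
      · funext j
        rw [Subsingleton.elim j 0]
        simp only [Str.eval, Matrix.cons_val_fin_one]
        exact congrArg _ (Subsingleton.elim _ _)
    obtain ⟨f, hf, hf'⟩ := h _ 0 1 zero_ne_one (fun _ => 0)
      (constAssign fun x : Fin 2 → M => if R (x 0) (x 1) then (1 : M) else 0)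
      (isAssignment_constAssign hχ) (fun a => (hR a).imp fun b => (key a b).2)
    exact ⟨⟨f, hf⟩, fun a => (key _ _).1 (hf' a)⟩
  · intro h θ x y hxy e E hE hθ
    have he : ∀ i, Fn (fun v : Fin 2 → M =>
        Function.update (Function.update e x (v 0)) y (v 1) i) := by
      intro i
      simp only [Function.update_apply]
      fun_prop
    obtain ⟨f, hf⟩ := h ⟨fun a b => (str (M := M)).Sat
      (Function.update (Function.update e x a) y b) E θ, dp_sat he hE θ⟩ hθ
    exact ⟨f, f.fn, hf⟩

/-! ### Back and forth -/

/-- One-point extension: every finite partial isomorphism from `R` to `R'`, given as the list of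
pairs `(α i, β i)`, `i < n`, extends to any further point `a`. -/
def Extends (R R' : M → M → Prop) : Prop :=
  ∀ (α β : Fun₁ M) (n : M),
    (∀ i, i < n → ∀ j, j < n → (α i = α j ↔ β i = β j) ∧ (R (α i) (α j) ↔ R' (β i) (β j))) →
    ∀ a, ∃ b, (∀ i, i < n → (α i = a ↔ β i = b) ∧ (R (α i) a ↔ R' (β i) b) ∧
      (R a (α i) ↔ R' b (β i))) ∧ (R a a ↔ R' b b)

/-- The `j`-th entry of the list `c`, which is a nested pair with the first entry as its first
component. -/
noncomputable def entry (c j : M) : M := fst (prec c (fun _ b => snd b) j)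

@[fun_prop] lemma fn_entry {n : ℕ} {φ ψ : (Fin n → M) → M} (hφ : Fn φ) (hψ : Fn ψ) :
    Fn (fun x => entry (φ x) (ψ x)) := fn_comp₂ (f := entry) (by unfold entry; fun_prop) hφ hψ

/-- Back and forth: Choice provides a function that adds one pair to a finite partial isomorphism,
and primitive recursion iterates it. -/
lemma exists_iso_of_extends (hC : Choice M) (R R' : Rel₂ M) (h1 : Extends R R')
    (h2 : Extends R' R) : ∃ h g : Fun₁ M, (∀ a, g (h a) = a) ∧ (∀ b, h (g b) = b) ∧
      ∀ a b, R a b ↔ R' (h a) (h b) := by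
  let K : Rel₂ M := ⟨fun p q => (fst p = fst q ↔ snd p = snd q) ∧
    (R (fst p) (fst q) ↔ R' (snd p) (snd q)), by fun_prop⟩
  have hK : ∀ p q, K p q ↔ (fst p = fst q ↔ snd p = snd q) ∧
    (R (fst p) (fst q) ↔ R' (snd p) (snd q)) := fun p q => Iff.rfl
  -- Stage `fst k`, with the list `snd k` of the pairs chosen so far; even stages serve the domain,
  -- odd stages the range.
  let Φ : Rel₂ M := ⟨fun k y =>
    (∀ i, i < fst k → ∀ j, j < fst k → K (entry (snd k) i) (entry (snd k) j)) →
      (∀ i, i < fst k → K (entry (snd k) i) y ∧ K y (entry (snd k) i)) ∧ K y y ∧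
      (par (fst k) = 0 → fst y = half (fst k)) ∧ (par (fst k) = 1 → snd y = half (fst k)),
    by fun_prop⟩
  have hΦ : ∀ k, ∃ y, Φ k y := by
    intro k
    by_cases hk : ∀ i, i < fst k → ∀ j, j < fst k → K (entry (snd k) i) (entry (snd k) j)
    swap
    · exact ⟨0, fun h => absurd h hk⟩
    let α : Fun₁ M := ⟨fun i => fst (entry (snd k) i), by fun_prop⟩
    let β : Fun₁ M := ⟨fun i => snd (entry (snd k) i), by fun_prop⟩
    rcases par_eq (fst k) with hp | hp
    · obtain ⟨b, hb, hb'⟩ := h1 α β (fst k) hk (half (fst k))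
      refine ⟨pr (half (fst k)) b, fun _ => ⟨fun i hi => ?_, ?_, ?_, ?_⟩⟩
      · obtain ⟨h3, h4, h5⟩ := hb i hi
        simp only [hK, fst_pr, snd_pr]
        exact ⟨⟨h3, h4⟩, by rw [eq_comm, h3, eq_comm], h5⟩
      · simp only [hK, fst_pr, snd_pr]
        exact ⟨by simp, hb'⟩
      · intro _; exact fst_pr _ _
      · intro h; rw [hp] at h; exact absurd h.symm one_ne_zero'
    · obtain ⟨b, hb, hb'⟩ := h2 β α (fst k) (fun i hi j hj => ⟨(hk i hi j hj).1.symm,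
        (hk i hi j hj).2.symm⟩) (half (fst k))
      refine ⟨pr b (half (fst k)), fun _ => ⟨fun i hi => ?_, ?_, ?_, ?_⟩⟩
      · obtain ⟨h3, h4, h5⟩ := hb i hi
        simp only [hK, fst_pr, snd_pr]
        exact ⟨⟨h3.symm, h4.symm⟩, by rw [eq_comm, ← h3, eq_comm], h5.symm⟩
      · simp only [hK, fst_pr, snd_pr]
        exact ⟨by simp, hb'.symm⟩
      · intro h; rw [hp] at h; exact absurd h one_ne_zero'
      · intro _; exact snd_pr _ _
  obtain ⟨F, hF⟩ := hC Φ hΦ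
  let s : Fun₁ M := ⟨fun n => prec 0 (fun n c => pr (F (pr n c)) c) n, by fun_prop⟩
  let y : Fun₁ M := ⟨fun n => F (pr n (s n)), by fun_prop⟩
  have hs : ∀ n, s (n + 1) = pr (y n) (s n) := fun n =>
    prec_add_one (g := fun n c => pr (F (pr n c)) c)
  have htl : ∀ m j i, i ≤ m → i + j = m → prec (s m) (fun _ b => snd b) j = s i := by
    intro m j
    refine induct (P := fun j => ∀ i, i ≤ m → i + j = m →
      prec (s m) (fun _ b => snd b) j = s i) ?_ (fun j ih i hi hij => ?_) j
    · intro i _ h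
      rw [prec_zero, ← h, add_zero]
    · rw [prec_add_one, ih (i + 1) (by have := zero_le' j; grind) (by grind), hs, snd_pr]
  have hent : ∀ m j i, i + 1 + j = m → entry (s m) j = y i := by
    intro m j i h
    unfold entry
    rw [htl m j (i + 1) (by have := zero_le' j; grind) h, hs, fst_pr]
  have hentry : ∀ m j, j < m → ∃ i, i < m ∧ entry (s m) j = y i := by
    intro m j h
    obtain ⟨d, hd⟩ := exists_add_of_le (add_one_le_iff.2 h)
    refine ⟨d, ?_, hent m j d (by rw [hd]; grind)⟩
    have := zero_le' j
    have := zero_lt_one' (M := M)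
    grind
  have hentry' : ∀ m i, i < m → ∃ j, j < m ∧ entry (s m) j = y i := by
    intro m i h
    obtain ⟨d, hd⟩ := exists_add_of_le (add_one_le_iff.2 h)
    refine ⟨d, ?_, hent m d i hd.symm⟩
    have := zero_le' i
    have := zero_lt_one' (M := M)
    grind
  have hy : ∀ n, (∀ i, i < n → ∀ j, j < n → K (y i) (y j)) →
      (∀ i, i < n → K (y i) (y n) ∧ K (y n) (y i)) ∧ K (y n) (y n) ∧
      (par n = 0 → fst (y n) = half n) ∧ (par n = 1 → snd (y n) = half n) := by
    intro n hn
    have h3 := hF (pr n (s n))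
    simp only [Φ, fst_pr, snd_pr] at h3
    obtain ⟨h4, h5⟩ := h3 (fun i hi j hj => by
      obtain ⟨i', hi', h6⟩ := hentry n i hi
      obtain ⟨j', hj', h7⟩ := hentry n j hj
      rw [h6, h7]
      exact hn i' hi' j' hj')
    refine ⟨fun i hi => ?_, h5⟩
    obtain ⟨j, hj, h6⟩ := hentry' n i hi
    rw [← h6]
    exact h4 j hj
  have hyn : ∀ n i, i < n → ∀ j, j < n → K (y i) (y j) := by
    intro n
    refine induct (P := fun n => ∀ i, i < n → ∀ j, j < n → K (y i) (y j))
      (fun i h => absurd h (not_lt_zero' _)) (fun n ih i hi j hj => ?_) n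
    obtain ⟨h3, h4, _⟩ := hy n ih
    rcases (lt_add_one_iff.1 hi).lt_or_eq with hi | rfl <;>
      rcases (lt_add_one_iff.1 hj).lt_or_eq with hj | rfl
    · exact ih i hi j hj
    · exact (h3 i hi).1
    · exact (h3 j hj).2
    · exact h4
  have hK' : ∀ i j, K (y i) (y j) := by
    intro i j
    refine hyn (i + j + 1) i ?_ j ?_ <;> rw [lt_add_one_iff]
    · exact le_self_add
    · exact le_add_self
  have hleft : ∀ a, fst (y (a + a)) = a := by
    intro a
    rw [(hy _ (fun i _ j _ => hK' i j)).2.2.1 (par_double a), half_double]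
  have hright : ∀ b, snd (y (b + b + 1)) = b := by
    intro b
    rw [(hy _ (fun i _ j _ => hK' i j)).2.2.2 (par_double_add_one b), half_double_add_one]
  refine ⟨⟨fun a => snd (y (a + a)), by fun_prop⟩, ⟨fun b => fst (y (b + b + 1)), by fun_prop⟩,
    fun a => ?_, fun b => ?_, fun a b => ?_⟩
  · have := (hK' (snd (y (a + a)) + snd (y (a + a)) + 1) (a + a)).1.2 (hright _)
    rw [hleft] at this
    exact this
  · have := (hK' (fst (y (b + b + 1)) + fst (y (b + b + 1))) (b + b + 1)).1.1 (hleft _)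
    rw [hright] at this
    exact this
  · have := (hK' (a + a) (b + b)).2
    rw [hleft, hleft] at this
    exact this

lemma isRelIso_of_extends (hC : Choice M) {r r' : M → M → M} (hr : (str (M := M)).IsRel r)
    (hr' : (str (M := M)).IsRel r') (h1 : Extends (fun a b => r a b = 1) (fun a b => r' a b = 1))
    (h2 : Extends (fun a b => r' a b = 1) (fun a b => r a b = 1)) :
    ∃ h, (str (M := M)).IsRelIso r r' h := by
  obtain ⟨h, g, hgh, hhg, hh⟩ := exists_iso_of_extends hC
    ⟨fun a b => r a b = 1, dp_eq hr.1 (fn_const 1)⟩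
    ⟨fun a b => r' a b = 1, dp_eq hr'.1 (fn_const 1)⟩
    h1 h2
  exact ⟨h, ⟨h.fn, g, g.fn, hgh, hhg⟩, hh⟩

/-! ### Categoricity of dense linear orders -/

/-- Among the `α i` with `i < n` and `P i`, if any, there is one without `R`-successor. -/
lemma exists_maximal (R : Rel₂ M) (hirr : ∀ a, ¬ R a a)
    (htrans : ∀ a b c, R a b → R b c → R a c) (α : Fun₁ M) (P : Rel₁ M) (n : M) :
    (∀ i, i < n → ¬ P i) ∨ ∃ i, i < n ∧ P i ∧ ∀ j, j < n → P j → ¬ R (α i) (α j) := by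
  refine induct (P := fun n => (∀ i, i < n → ¬ P i) ∨
    ∃ i, i < n ∧ P i ∧ ∀ j, j < n → P j → ¬ R (α i) (α j))
    (Or.inl fun i h => absurd h (not_lt_zero' _)) (fun n ih => ?_) n
  by_cases hn : P n
  · right
    rcases ih with ih | ⟨i, hi, hPi, ih⟩
    · refine ⟨n, lt_add_one_iff.2 le_rfl, hn, fun j hj hPj => ?_⟩
      rcases (lt_add_one_iff.1 hj).lt_or_eq with h | rfl
      · exact absurd hPj (ih j h)
      · exact hirr _
    · by_cases hin : R (α i) (α n)
      · refine ⟨n, lt_add_one_iff.2 le_rfl, hn, fun j hj hPj => ?_⟩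
        rcases (lt_add_one_iff.1 hj).lt_or_eq with h | rfl
        · exact fun h' => ih j h hPj (htrans _ _ _ hin h')
        · exact hirr _
      · refine ⟨i, lt_add_one_iff.2 hi.le, hPi, fun j hj hPj => ?_⟩
        rcases (lt_add_one_iff.1 hj).lt_or_eq with h | rfl
        · exact ih j h hPj
        · exact hin
  · rcases ih with ih | ⟨i, hi, hPi, ih⟩
    · refine Or.inl fun i hi => ?_
      rcases (lt_add_one_iff.1 hi).lt_or_eq with h | rfl
      · exact ih i h
      · exact hn
    · refine Or.inr ⟨i, lt_add_one_iff.2 hi.le, hPi, fun j hj hPj => ?_⟩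
      rcases (lt_add_one_iff.1 hj).lt_or_eq with h | rfl
      · exact ih j h hPj
      · exact absurd hPj hn

/-- The new point goes between the images of the greatest of the points below `a` and of the least
of the points above `a`; these exist by induction on the number of points. -/
lemma extends_of_dlo {r r' : M → M → M} (hr : (str (M := M)).IsDLO r)
    (hr' : (str (M := M)).IsDLO r') : Extends (fun a b => r a b = 1) (fun a b => r' a b = 1) := by
  intro α β n hp a
  dsimp only at hp ⊢
  by_cases ha : ∃ i, i < n ∧ α i = a
  · obtain ⟨i, hi, rfl⟩ := ha
    exact ⟨β i, fun j hj => ⟨(hp j hj i hi).1, (hp j hj i hi).2, (hp i hi j hj).2⟩,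
      (hp i hi i hi).2⟩
  push Not at ha
  let R : Rel₂ M := ⟨fun a b => r a b = 1, dp_eq hr.rel.1 (fn_const 1)⟩
  have hR : ∀ a b, R a b ↔ r a b = 1 := fun _ _ => Iff.rfl
  simp only [← hR] at hp ⊢
  have hirr : ∀ a, ¬ R a a := hr.irrefl
  have htrans : ∀ a b c, R a b → R b c → R a c := hr.trans
  have htot : ∀ a b, R a b ∨ a = b ∨ R b a := hr.total
  have htrans' : ∀ a b c, r' a b = 1 → r' b c = 1 → r' a c = 1 := hr'.trans
  have hirr' : ∀ a, r' a a ≠ 1 := hr'.irrefl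
  obtain ⟨b, hb1, hb2⟩ : ∃ b, (∀ i, i < n → R (α i) a → r' (β i) b = 1) ∧
      (∀ i, i < n → R a (α i) → r' b (β i) = 1) := by
    have hlow : ∀ i, i < n → (∀ j, j < n → R (α j) a → ¬ R (α i) (α j)) → ∀ b, r' (β i) b = 1 →
        ∀ j, j < n → R (α j) a → r' (β j) b = 1 := by
      intro i hi h b hb j hj hja
      rcases htot (α i) (α j) with h1 | h1 | h1
      · exact absurd h1 (h j hj hja)
      · rw [← (hp i hi j hj).1.1 h1]; exact hb
      · exact htrans' _ _ _ ((hp j hj i hi).2.1 h1) hb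
    have hupp : ∀ i, i < n → (∀ j, j < n → R a (α j) → ¬ R (α j) (α i)) → ∀ b, r' b (β i) = 1 →
        ∀ j, j < n → R a (α j) → r' b (β j) = 1 := by
      intro i hi h b hb j hj hja
      rcases htot (α i) (α j) with h1 | h1 | h1
      · exact htrans' _ _ _ hb ((hp i hi j hj).2.1 h1)
      · rw [← (hp i hi j hj).1.1 h1]; exact hb
      · exact absurd h1 (h j hj hja)
    rcases exists_maximal R hirr htrans α ⟨fun i => R (α i) a, by fun_prop⟩ n with
      h1 | ⟨i, hi, hia, h1⟩ <;>
    rcases exists_maximal ⟨fun a b => R b a, by fun_prop⟩ hirr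
      (fun a b c h h' => htrans _ _ _ h' h) α ⟨fun i => R a (α i), by fun_prop⟩ n with
      h2 | ⟨j, hj, hja, h2⟩
    · exact ⟨0, fun i hi h => absurd h (h1 i hi), fun i hi h => absurd h (h2 i hi)⟩
    · obtain ⟨b, hb⟩ := hr'.noMin (β j)
      exact ⟨b, fun i hi h => absurd h (h1 i hi), hupp j hj h2 b hb⟩
    · obtain ⟨b, hb⟩ := hr'.noMax (β i)
      exact ⟨b, hlow i hi h1 b hb, fun i hi h => absurd h (h2 i hi)⟩
    · obtain ⟨b, hb, hb'⟩ := hr'.dense (β i) (β j) ((hp i hi j hj).2.1 (htrans _ _ _ hia hja))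
      exact ⟨b, hlow i hi h1 b hb, hupp j hj h2 b hb'⟩
  refine ⟨b, fun i hi => ?_, iff_of_false (hirr _) (hirr' _)⟩
  rcases htot (α i) a with h | h | h
  · have h3 := hb1 i hi h
    refine ⟨iff_of_false (ha i hi) ?_, iff_of_true h h3, iff_of_false ?_ ?_⟩
    · rintro rfl; exact hirr' _ h3
    · exact fun h' => hirr _ (htrans _ _ _ h h')
    · exact fun h' => hirr' _ (htrans' _ _ _ h3 h')
  · exact absurd h (ha i hi)
  · have h3 := hb2 i hi h
    refine ⟨iff_of_false (ha i hi) ?_, iff_of_false ?_ ?_, iff_of_true h h3⟩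
    · rintro rfl; exact hirr' _ h3
    · exact fun h' => hirr _ (htrans _ _ _ h h')
    · exact fun h' => hirr' _ (htrans' _ _ _ h3 h')

lemma catDLO_of_choice (hC : Choice M) : (str (M := M)).CatDLO := fun _ _ hr hr' =>
  isRelIso_of_extends hC hr.rel hr'.rel (extends_of_dlo hr hr') (extends_of_dlo hr' hr)

/-! ### Categoricity of random graphs -/

/-- A random graph satisfies the extension property for the disjoint sets `P` and `Q` below `d`,
which may be empty, with a vertex outside both of them. -/
lemma exists_vertex {r : M → M → M} (hr : (str (M := M)).IsRandomGraph r) (P Q : Rel₁ M) (d : M)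
    (hPd : ∀ a, P a → a < d) (hQd : ∀ a, Q a → a < d) (hPQ : ∀ a, ¬ (P a ∧ Q a)) :
    ∃ c, (∀ a, P a → r a c = 1 ∧ a ≠ c) ∧ ∀ b, Q b → r b c ≠ 1 ∧ b ≠ c := by
  classical
  have hsymm : ∀ a b, r a b = 1 → r b a = 1 := hr.symm
  have hirr : ∀ a, r a a ≠ 1 := hr.irrefl
  have hran : ∀ P Q : Rel₁ M, ∀ d, (∀ a, P a → a ≤ d) → (∀ a, Q a → a ≤ d) → (∃ a, P a) →
      (∃ a, Q a) → (∀ a, ¬ (P a ∧ Q a)) → ∃ c, (∀ a, P a → r a c = 1) ∧ ∀ b, Q b → r b c ≠ 1 := by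
    intro P Q d h1 h2 h3 h4 h5
    have key : ∀ (P : Rel₁ M) a, (if P a then (1 : M) else 0) = 1 ↔ P a := by
      intro P a; split_ifs with h <;> simp [h, one_ne_zero'.symm]
    have hfin : ∀ P : Rel₁ M, (∀ a, P a → a ≤ d) →
        (str (M := M)).IsFinSet (fun a => if P a then (1 : M) else 0) := by
      intro P hP
      have : Fn (fun x : Fin 1 → M => if P (x 0) then (1 : M) else 0) := by fun_prop
      refine ⟨this, fun a => ?_, d, fun a ha => ?_⟩
      · by_cases h : P a
        · right; simp only [h, if_true]; rfl
        · left; simp only [h, if_false]; rfl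
      · exact if_neg fun h => not_lt.2 (hP a h) ha
    obtain ⟨c, hc, hc'⟩ := hr.random _ _ (hfin P h1) (hfin Q h2)
      (h3.imp fun a => (key P a).2) (h4.imp fun a => (key Q a).2)
      (fun a h => h5 a ⟨(key P a).1 h.1, (key Q a).1 h.2⟩)
    exact ⟨c, fun a h => hc a ((key P a).2 h), fun a h => hc' a ((key Q a).2 h)⟩
  have hd : d < d + 1 := lt_add_one_iff.2 le_rfl
  -- A vertex `w` adjacent to all of `P` and `Q`; a vertex not adjacent to `w` is then outside `Q`.
  obtain ⟨w, hw, -⟩ := hran ⟨fun a => P a ∨ Q a ∨ a = d, by fun_prop⟩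
    ⟨fun a => a = d + 1, by fun_prop⟩
    (d + 1) (by
      rintro a (h | h | rfl)
      · exact ((hPd a h).trans hd).le
      · exact ((hQd a h).trans hd).le
      · exact hd.le) (fun a h => le_of_eq h) ⟨d, Or.inr (Or.inr rfl)⟩ ⟨d + 1, rfl⟩ (by
      rintro a ⟨h | h | h, rfl⟩
      · exact lt_asymm hd (hPd _ h)
      · exact lt_asymm hd (hQd _ h)
      · exact hd.ne' h)
  obtain ⟨c, hc, hc'⟩ := hran ⟨fun a => P a ∨ a = d, by fun_prop⟩
    ⟨fun a => Q a ∨ a = w, by fun_prop⟩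
    (d + w) (by
      rintro a (h | h)
      · exact (hPd a h).le.trans le_self_add
      · rw [h]; exact le_self_add) (by
      rintro a (h | h)
      · exact (hQd a h).le.trans le_self_add
      · rw [h]; exact le_add_self) ⟨d, Or.inr rfl⟩ ⟨w, Or.inr rfl⟩ (by
      rintro a ⟨h | h, h' | h'⟩
      · exact hPQ a ⟨h, h'⟩
      · rw [h'] at h
        exact hirr w (hw w (Or.inl h))
      · rw [h] at h'
        exact lt_irrefl _ (hQd _ h')
      · refine hirr w (hw w (Or.inr (Or.inr ?_)))
        rw [← h', h])
  refine ⟨c, fun a ha => ⟨hc a (Or.inl ha), ?_⟩, fun b hb => ⟨hc' b (Or.inl hb), ?_⟩⟩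
  · rintro rfl
    exact hirr _ (hc a (Or.inl ha))
  · rintro rfl
    exact hc' w (Or.inr rfl) (hsymm _ _ (hw b (Or.inr (Or.inl hb))))

/-- The two finite sets consist of the images of the neighbours and of the non-neighbours of `a`. -/
lemma extends_of_randomGraph {r r' : M → M → M} (hr : (str (M := M)).IsRandomGraph r)
    (hr' : (str (M := M)).IsRandomGraph r') :
    Extends (fun a b => r a b = 1) (fun a b => r' a b = 1) := by
  intro α β n hp a
  dsimp only at hp ⊢
  by_cases ha : ∃ i, i < n ∧ α i = a
  · obtain ⟨i, hi, rfl⟩ := ha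
    exact ⟨β i, fun j hj => ⟨(hp j hj i hi).1, (hp j hj i hi).2, (hp i hi j hj).2⟩,
      (hp i hi i hi).2⟩
  push Not at ha
  have hsymm : ∀ a b, r a b = 1 → r b a = 1 := hr.symm
  have hsymm' : ∀ a b, r' a b = 1 → r' b a = 1 := hr'.symm
  have hirr : ∀ a, r a a ≠ 1 := hr.irrefl
  have hirr' : ∀ a, r' a a ≠ 1 := hr'.irrefl
  let R : Rel₂ M := ⟨fun a b => r a b = 1, dp_eq hr.rel.1 (fn_const 1)⟩
  have hlt : ∀ i, i < n → β i < bnd β n := fun i hi => lt_bnd hi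
  obtain ⟨b, hb, hb'⟩ := exists_vertex hr' ⟨fun b => ∃ i, i < n ∧ β i = b ∧ R (α i) a, by fun_prop⟩
    ⟨fun b => ∃ i, i < n ∧ β i = b ∧ ¬ R (α i) a, by fun_prop⟩ (bnd β n)
    (by rintro _ ⟨i, hi, rfl, -⟩; exact hlt i hi) (by rintro _ ⟨i, hi, rfl, -⟩; exact hlt i hi) (by
      rintro _ ⟨⟨i, hi, rfl, h⟩, ⟨j, hj, hji, h'⟩⟩
      rw [(hp j hj i hi).1.2 hji] at h'
      exact h' h)
  refine ⟨b, fun i hi => ?_, iff_of_false (hirr a) (hirr' b)⟩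
  by_cases h : r (α i) a = 1
  · obtain ⟨h1, h2⟩ := hb (β i) ⟨i, hi, rfl, h⟩
    exact ⟨iff_of_false (ha i hi) h2, iff_of_true h h1, iff_of_true (hsymm _ _ h) (hsymm' _ _ h1)⟩
  · obtain ⟨h1, h2⟩ := hb' (β i) ⟨i, hi, rfl, h⟩
    exact ⟨iff_of_false (ha i hi) h2, iff_of_false h h1,
      iff_of_false (fun h' => h (hsymm _ _ h')) (fun h' => h1 (hsymm' _ _ h'))⟩

lemma catRandomGraph_of_choice (hC : Choice M) : (str (M := M)).CatRandomGraph :=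
  fun _ _ hr hr' => isRelIso_of_extends hC hr.rel hr'.rel (extends_of_randomGraph hr hr')
    (extends_of_randomGraph hr' hr)

/-! ### Atomless Boolean algebras of the model as Boolean algebras -/

/-- The elements of the Boolean algebra `B`. -/
@[ext] structure BAElt (B : BoolOps M) where
  /-- the number that the element is -/
  val : M

namespace BAElt

variable {B : BoolOps M}

/-- `φ` is a function of the model with values in the Boolean algebra `B`. -/
@[fun_prop] def FnB {n : ℕ} (φ : (Fin n → M) → BAElt B) : Prop := Fn (fun x => (φ x).val)

@[fun_prop] lemma fn_val {n : ℕ} {φ : (Fin n → M) → BAElt B} (hφ : FnB φ) :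
    Fn (fun x => (φ x).val) := hφ

@[fun_prop] lemma fnB_mk {n : ℕ} {φ : (Fin n → M) → M} (hφ : Fn φ) :
    FnB (fun x => (⟨φ x⟩ : BAElt B)) := hφ

@[fun_prop] lemma fnB_const {n : ℕ} (c : BAElt B) : FnB (fun _ : Fin n → M => c) :=
  fn_const (M := M) _

@[fun_prop] lemma dp_eqB {n : ℕ} {φ ψ : (Fin n → M) → BAElt B} (hφ : FnB φ) (hψ : FnB ψ) :
    Dp (fun x => φ x = ψ x) := (dp_eq hφ hψ).congr (fun _ => BAElt.ext_iff.symm)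

@[fun_prop] lemma fnB_ite {n : ℕ} {P : (Fin n → M) → Prop} [∀ x, Decidable (P x)] (hP : Dp P)
    {φ ψ : (Fin n → M) → BAElt B} (hφ : FnB φ) (hψ : FnB ψ) :
    FnB (fun x => if P x then φ x else ψ x) := by
  unfold FnB
  simp only [apply_ite BAElt.val]
  fun_prop

variable [hB : Fact ((str (M := M)).IsAtomlessBA B)]

instance : Max (BAElt B) := ⟨fun a b => ⟨B.join a.val b.val⟩⟩

instance : Min (BAElt B) := ⟨fun a b => ⟨B.meet a.val b.val⟩⟩

instance : Lattice (BAElt B) := Lattice.mk'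
  (fun _ _ => BAElt.ext (hB.out.join_comm _ _)) (fun _ _ _ => BAElt.ext (hB.out.join_assoc _ _ _))
  (fun _ _ => BAElt.ext (hB.out.meet_comm _ _)) (fun _ _ _ => BAElt.ext (hB.out.meet_assoc _ _ _))
  (fun _ _ => BAElt.ext (hB.out.join_meet_self _ _))
  (fun _ _ => BAElt.ext (hB.out.meet_join_self _ _))

instance : DistribLattice (BAElt B) where
  le_sup_inf _ _ _ := le_of_eq (BAElt.ext (hB.out.join_meet_distrib _ _ _).symm)

instance : BooleanAlgebra (BAElt B) where
  compl a := ⟨B.compl a.val⟩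
  top := ⟨B.top⟩
  bot := ⟨B.bot⟩
  inf_compl_le_bot _ := le_of_eq (BAElt.ext (hB.out.meet_compl _))
  top_le_sup_compl _ := le_of_eq (BAElt.ext (hB.out.join_compl _).symm)
  le_top _ := inf_eq_left.1 (BAElt.ext (hB.out.meet_top _))
  bot_le _ := sup_eq_left.1 (BAElt.ext (hB.out.join_bot _))

@[fun_prop] lemma fnB_sup {n : ℕ} {φ ψ : (Fin n → M) → BAElt B} (hφ : FnB φ) (hψ : FnB ψ) :
    FnB (fun x => φ x ⊔ ψ x) := fn_comp₂ hB.out.fun_join hφ hψ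

@[fun_prop] lemma fnB_inf {n : ℕ} {φ ψ : (Fin n → M) → BAElt B} (hφ : FnB φ) (hψ : FnB ψ) :
    FnB (fun x => φ x ⊓ ψ x) := fn_comp₂ hB.out.fun_meet hφ hψ

@[fun_prop] lemma fnB_compl {n : ℕ} {φ : (Fin n → M) → BAElt B} (hφ : FnB φ) :
    FnB (fun x => (φ x)ᶜ) := fn_comp₁ hB.out.fun_compl hφ

@[fun_prop] lemma dp_leB {n : ℕ} {φ ψ : (Fin n → M) → BAElt B} (hφ : FnB φ) (hψ : FnB ψ) :
    Dp (fun x => φ x ≤ ψ x) := (dp_eqB (fnB_inf hφ hψ) hφ).congr (fun _ => inf_eq_left)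

lemma top_ne_bot : (⊤ : BAElt B) ≠ ⊥ := fun h => zero_ne_one_model (M := M) (congrArg BAElt.val
  ((eq_bot_of_bot_eq_top h.symm (⟨0⟩ : BAElt B)).trans (eq_bot_of_bot_eq_top h.symm ⟨1⟩).symm))

/-- The join of the elements `f u`, `u < N`. -/
noncomputable def bigSup (f : M → BAElt B) (N : M) : BAElt B :=
  ⟨prec (⊥ : BAElt B).val (fun u b => ((⟨b⟩ : BAElt B) ⊔ f u).val) N⟩

lemma bigSup_spec {f : M → BAElt B} (hf : FnB (fun x : Fin 1 → M => f (x 0))) :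
    FnB (fun x : Fin 1 → M => bigSup f (x 0)) ∧ bigSup f 0 = ⊥ ∧
      ∀ u, bigSup f (u + 1) = bigSup f u ⊔ f u := by
  have hg : Fn (fun y : Fin 2 → M => ((⟨y 1⟩ : BAElt B) ⊔ f (y 0)).val) :=
    fnB_sup (fnB_mk (fn_proj 1)) (fn_comp₁ (f := fun a => (f a).val) hf (fn_proj 0))
  obtain ⟨h1, h2, _⟩ := prec_spec (z := (⊥ : BAElt B).val)
    (g := fun u b => ((⟨b⟩ : BAElt B) ⊔ f u).val) hg
  exact ⟨h1, BAElt.ext h2, fun u => BAElt.ext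
    (prec_add_one (g := fun u b => ((⟨b⟩ : BAElt B) ⊔ f u).val) hg)⟩

lemma le_bigSup {f : M → BAElt B} {u N : M} (hu : u < N)
    (hf : FnB (fun x : Fin 1 → M => f (x 0)) := by fun_prop) : f u ≤ bigSup f N := by
  obtain ⟨h1, h2, h3⟩ := bigSup_spec hf
  revert hu
  refine induct (P := fun N => u < N → f u ≤ bigSup f N) (fun h => absurd h (not_lt_zero' _))
    (fun n ih hn => ?_) N
  rw [h3]
  rcases (lt_add_one_iff.1 hn).lt_or_eq with h | rfl
  · exact (ih h).trans le_sup_left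
  · exact le_sup_right

lemma disjoint_bigSup {f : M → BAElt B} {z : BAElt B} (N : M) (hz : ∀ u, z ⊓ f u = ⊥)
    (hf : FnB (fun x : Fin 1 → M => f (x 0)) := by fun_prop) : z ⊓ bigSup f N = ⊥ := by
  obtain ⟨h1, h2, h3⟩ := bigSup_spec hf
  refine induct (P := fun N => z ⊓ bigSup f N = ⊥) (by rw [h2, inf_bot_eq]) (fun n ih => ?_) N
  rw [h3, inf_sup_left, ih, hz, bot_sup_eq]

@[fun_prop] lemma fnB_bigSup {n : ℕ} {φ : (Fin n → M) → M} {f : M → (Fin n → M) → BAElt B}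
    (hf : FnB (fun y : Fin (n + 1) → M => f (y 0) (fun i => y i.succ))) (hφ : Fn φ) :
    FnB (fun x => bigSup (fun u => f u x) (φ x)) := by
  have : FnB (fun y : Fin (n + 2) → M => f (y 0) (fun i => y i.succ.succ)) :=
    Fn.shift (f := fun u x => (f u x).val) hf
  exact fn_prec (g := fun u b x => ((⟨b⟩ : BAElt B) ⊔ f u x).val) (fn_const _)
    (fnB_sup (fnB_mk (fn_proj 1)) this) hφ

end BAElt

open BAElt

/-! ### Binary trees of elements -/

/-- A binary tree of elements of `B`, given by functions of the model. A node of level `n` is named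
by any set `u`, of which only the part below `n` matters; its two successors are its meets with
`cut n u` (if `n ∈ u`) and with the complement (if `n ∉ u`). -/
structure BATree (B : BoolOps M) [Fact ((str (M := M)).IsAtomlessBA B)] where
  /-- the element at a node -/
  node : M → M → BAElt B
  /-- the element that cuts a node in two -/
  cut : M → M → BAElt B
  fnB_node : FnB (fun x : Fin 2 → M => node (x 0) (x 1))
  node_zero : ∀ u, node 0 u = ⊤
  node_mem : ∀ n u, n ∈ u → node (n + 1) u = node n u ⊓ cut n u
  node_notMem : ∀ n u, n ∉ u → node (n + 1) u = node n u ⊓ (cut n u)ᶜ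
  congr : ∀ n u v, (∀ i, i < n → (i ∈ u ↔ i ∈ v)) → node n u = node n v ∧ cut n u = cut n v

namespace BATree

variable {B : BoolOps M} [hB : Fact ((str (M := M)).IsAtomlessBA B)] (T : BATree B)

@[fun_prop] lemma fnB_node' {n : ℕ} {φ ψ : (Fin n → M) → M} (hφ : Fn φ) (hψ : Fn ψ) :
    FnB (fun x => T.node (φ x) (ψ x)) :=
  fn_comp₂ (f := fun a b => (T.node a b).val) T.fnB_node hφ hψ

lemma node_add_one_le (n u : M) : T.node (n + 1) u ≤ T.node n u := by
  by_cases h : n ∈ u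
  · rw [T.node_mem n u h]; exact inf_le_left
  · rw [T.node_notMem n u h]; exact inf_le_left

lemma node_anti {m n : M} (h : m ≤ n) (u : M) : T.node n u ≤ T.node m u := by
  revert h
  refine induct (P := fun n => m ≤ n → T.node n u ≤ T.node m u) (fun h => ?_) (fun n ih h => ?_) n
  · rw [nonpos_iff_eq_zero.1 h]
  · rcases h.lt_or_eq with h | rfl
    · exact (T.node_add_one_le n u).trans (ih (lt_add_one_iff.1 h))
    · exact le_rfl

lemma node_disjoint (n : M) {u v : M} (h : ∃ i, i < n ∧ ¬ (i ∈ u ↔ i ∈ v)) :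
    T.node n u ⊓ T.node n v = ⊥ := by
  revert h
  refine induct (P := fun n => (∃ i, i < n ∧ ¬ (i ∈ u ↔ i ∈ v)) → T.node n u ⊓ T.node n v = ⊥)
    (fun h => ?_) (fun n ih h => ?_) n
  · obtain ⟨i, hi, _⟩ := h; exact absurd hi (not_lt_zero' _)
  · by_cases h' : ∃ i, i < n ∧ ¬ (i ∈ u ↔ i ∈ v)
    · exact le_bot_iff.1 ((inf_le_inf (T.node_add_one_le n u) (T.node_add_one_le n v)).trans
        (ih h').le)
    · obtain ⟨i, hi, hi'⟩ := h
      rcases (lt_add_one_iff.1 hi).lt_or_eq with hi | rfl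
      · exact absurd ⟨i, hi, hi'⟩ h'
      · push Not at h'
        obtain ⟨h1, h2⟩ := T.congr i u v (fun j hj => by have := h' j hj; tauto)
        have key : ∀ a b : BAElt B, a ⊓ b ⊓ (a ⊓ bᶜ) = ⊥ := by
          intro a b
          rw [inf_inf_inf_comm, inf_compl_self, inf_bot_eq]
        by_cases hu : i ∈ u
        · have hv : i ∉ v := by tauto
          rw [T.node_mem i u hu, T.node_notMem i v hv, h1, h2, key]
        · have hv : i ∈ v := by tauto
          rw [T.node_notMem i u hu, T.node_mem i v hv, h1, h2, inf_comm, key]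

/-- The nodes of each level cover the algebra. -/
lemma exists_node_ne_bot {z : BAElt B} (hz : z ≠ ⊥) (n : M) : ∃ u, z ⊓ T.node n u ≠ ⊥ := by
  have : ∃ u, u ≤ seg n ∧ z ⊓ T.node n u ≠ ⊥ := by
    refine induct (P := fun n => ∃ u, u ≤ seg n ∧ z ⊓ T.node n u ≠ ⊥)
      ⟨0, zero_le' _, by rwa [T.node_zero, inf_top_eq]⟩ (fun n ih => ?_) n
    obtain ⟨u, _, hu⟩ := ih
    have h0 : ∀ i, i ∈ code (fun i => i ∈ u) n ↔ i < n ∧ i ∈ u := fun i => mem_code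
    have h1 : ∀ i, i ∈ code (fun i => i ∈ u ∨ i = n) (n + 1) ↔ i < n + 1 ∧ (i ∈ u ∨ i = n) :=
      fun i => mem_code
    obtain ⟨h2, h3⟩ := T.congr n (code (fun i => i ∈ u) n) u (fun i hi => by rw [h0]; tauto)
    obtain ⟨h4, h5⟩ := T.congr n (code (fun i => i ∈ u ∨ i = n) (n + 1)) u (fun i hi => by
      rw [h1]
      have := hi.ne
      have : i < n + 1 := lt_add_one_iff.2 hi.le
      tauto)
    by_cases h : z ⊓ T.node n u ⊓ T.cut n u = ⊥
    · refine ⟨code (fun i => i ∈ u) n, le_of_subset fun i hi => ?_, ?_⟩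
      · exact mem_seg.2 (lt_add_one_iff.2 ((h0 i).1 hi).1.le)
      · rw [T.node_notMem n _ (fun h => lt_irrefl _ ((h0 n).1 h).1), h2, h3, ← inf_assoc]
        intro h'
        apply hu
        rw [← inf_top_eq (z ⊓ T.node n u), ← sup_compl_eq_top (x := T.cut n u), inf_sup_left, h, h',
          bot_sup_eq]
    · refine ⟨code (fun i => i ∈ u ∨ i = n) (n + 1), le_of_subset fun i hi => ?_, ?_⟩
      · exact mem_seg.2 ((h1 i).1 hi).1
      · rw [T.node_mem n _ ((h1 n).2 ⟨lt_add_one_iff.2 le_rfl, Or.inr rfl⟩), h4, h5, ← inf_assoc]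
        exact h
  obtain ⟨u, _, hu⟩ := this
  exact ⟨u, hu⟩

/-- The join of the nodes of level `n + 1` whose names contain `n`. -/
noncomputable def side (n : M) : BAElt B :=
  open Classical in
  bigSup (fun u => if n ∈ u then T.node (n + 1) u else ⊥) (seg (n + 1) + 1)

@[fun_prop] lemma fnB_side {n : ℕ} {φ : (Fin n → M) → M} (hφ : Fn φ) :
    FnB (fun x => T.side (φ x)) :=
  fn_comp₁ (f := fun n => (T.side n).val)
    (show FnB (fun x : Fin 1 → M => T.side (x 0)) by unfold side; fun_prop) hφ

lemma node_le_side {n m u : M} (hm : n + 1 ≤ m) (hu : n ∈ u) : T.node m u ≤ T.side n := by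
  classical
  have h0 : ∀ i, i ∈ code (fun i => i ∈ u) (n + 1) ↔ i < n + 1 ∧ i ∈ u := fun i => mem_code
  have h1 := (T.congr (n + 1) (code (fun i => i ∈ u) (n + 1)) u
    (fun i hi => by rw [h0]; tauto)).1
  have h2 : code (fun i => i ∈ u) (n + 1) < seg (n + 1) + 1 :=
    lt_add_one_iff.2 (le_of_subset fun i hi => mem_seg.2 ((h0 i).1 hi).1)
  refine (T.node_anti hm u).trans ?_
  have h3 := le_bigSup (f := fun u => if n ∈ u then T.node (n + 1) u else ⊥) h2
  rw [if_pos ((h0 n).2 ⟨lt_add_one_iff.2 le_rfl, hu⟩), h1] at h3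
  unfold side
  convert h3

lemma node_inf_side {n m u : M} (hm : n + 1 ≤ m) (hu : n ∉ u) : T.node m u ⊓ T.side n = ⊥ := by
  classical
  have : T.node m u ⊓ bigSup (fun u => if n ∈ u then T.node (n + 1) u else ⊥) (seg (n + 1) + 1) =
      ⊥ := by
    refine disjoint_bigSup _ (fun v => ?_)
    split_ifs with hv
    · have h1 := T.node_disjoint (n + 1) (u := u) (v := v)
        ⟨n, lt_add_one_iff.2 le_rfl, fun h => hu (h.2 hv)⟩
      exact le_bot_iff.1 ((inf_le_inf_right _ (T.node_anti hm u)).trans h1.le)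
    · exact inf_bot_eq _
  unfold side
  convert this

lemma node_le_cut {n m u : M} (hm : n + 1 ≤ m) (hu : n ∈ u) : T.node m u ≤ T.cut n u := by
  refine (T.node_anti hm u).trans ?_
  rw [T.node_mem n u hu]
  exact inf_le_right

lemma node_inf_cut {n m u : M} (hm : n + 1 ≤ m) (hu : n ∉ u) : T.node m u ⊓ T.cut n u = ⊥ := by
  refine le_bot_iff.1 ((inf_le_inf_right _ (T.node_anti hm u)).trans ?_)
  rw [T.node_notMem n u hu, inf_assoc, compl_inf_self, inf_bot_eq]

end BATree

/-! ### Categoricity of atomless Boolean algebras -/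

/-- Choice provides a function that splits every non-zero element of an atomless algebra. -/
lemma exists_split (hC : Choice M) (B : BoolOps M) [hB : Fact ((str (M := M)).IsAtomlessBA B)] :
    ∃ s : Fun₁ M, ∀ x : BAElt B, x ≠ ⊥ → x ⊓ ⟨s x.val⟩ ≠ ⊥ ∧ x ⊓ (⟨s x.val⟩ : BAElt B)ᶜ ≠ ⊥ := by
  obtain ⟨s, hs⟩ := hC ⟨fun x y => (⟨x⟩ : BAElt B) ≠ ⊥ → (⟨x⟩ : BAElt B) ⊓ ⟨y⟩ ≠ ⊥ ∧
    (⟨x⟩ : BAElt B) ⊓ (⟨y⟩ : BAElt B)ᶜ ≠ ⊥, by simp only [ne_eq]; fun_prop⟩ (fun x => by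
      by_cases hx : (⟨x⟩ : BAElt B) = ⊥
      · exact ⟨0, fun h => absurd hx h⟩
      · obtain ⟨b, c, hb, hc, hbc, hbc'⟩ := hB.out.atomless x (fun h => hx (BAElt.ext h))
        have h1 : (⟨b⟩ : BAElt B) ⊔ ⟨c⟩ = ⟨x⟩ := BAElt.ext hbc
        have h2 : (⟨b⟩ : BAElt B) ⊓ ⟨c⟩ = ⊥ := BAElt.ext hbc'
        have h3 : (⟨c⟩ : BAElt B) ≤ (⟨b⟩ : BAElt B)ᶜ :=
          le_compl_iff_disjoint_left.2 (disjoint_iff.2 h2)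
        refine ⟨b, fun _ => ⟨?_, ?_⟩⟩
        · rw [← h1, inf_comm, inf_sup_self]
          exact fun h => hb (congrArg BAElt.val h)
        · intro h
          apply hc
          have : (⟨c⟩ : BAElt B) ≤ ⊥ := by rw [← h]; exact le_inf (h1 ▸ le_sup_right) h3
          exact congrArg BAElt.val (le_bot_iff.1 this))
  exact ⟨s, fun x => hs x.val⟩

section Transfer

variable {A B : BoolOps M} [hA : Fact ((str (M := M)).IsAtomlessBA A)]
  [hB : Fact ((str (M := M)).IsAtomlessBA B)]

/-- An element cutting `b` as `k` cuts `a`: zero and non-zero parts correspond, provided that `s`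
splits `b` in the remaining case. -/
noncomputable def transfer (a k : BAElt A) (b : BAElt B) (s : M → M) : BAElt B :=
  open Classical in if a ⊓ k = ⊥ then ⊥ else if a ⊓ kᶜ = ⊥ then ⊤ else ⟨s b.val⟩

@[fun_prop] lemma fnB_transfer {n : ℕ} {φ ψ : (Fin n → M) → BAElt A} {χ : (Fin n → M) → BAElt B}
    (s : Fun₁ M) (hφ : FnB φ) (hψ : FnB ψ) (hχ : FnB χ) :
    FnB (fun x => transfer (φ x) (ψ x) (χ x) s) := by
  unfold transfer; fun_prop

/-- The cuts `k` of `a` and `transfer a k b s` of `b` have corresponding zero parts. -/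
lemma transfer_spec {a k : BAElt A} {b : BAElt B} {s : M → M}
    (hs : ∀ x : BAElt B, x ≠ ⊥ → x ⊓ ⟨s x.val⟩ ≠ ⊥ ∧ x ⊓ (⟨s x.val⟩ : BAElt B)ᶜ ≠ ⊥)
    (hab : a = ⊥ ↔ b = ⊥) : (a ⊓ k = ⊥ ↔ b ⊓ transfer a k b s = ⊥) ∧
      (a ⊓ kᶜ = ⊥ ↔ b ⊓ (transfer a k b s)ᶜ = ⊥) := by
  have key : a = a ⊓ k ⊔ a ⊓ kᶜ := by rw [← inf_sup_left, sup_compl_eq_top, inf_top_eq]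
  unfold transfer
  split_ifs with h1 h2
  · rw [h1, bot_sup_eq] at key
    rw [h1, inf_bot_eq, compl_bot, inf_top_eq, ← key, hab]
    simp
  · rw [h2, sup_bot_eq] at key
    rw [h2, inf_top_eq, compl_top, inf_bot_eq, ← key, hab]
    simp
  · have ha : a ≠ ⊥ := by
      rintro rfl; exact h1 (bot_inf_eq _)
    obtain ⟨h3, h4⟩ := hs b (fun h => ha (hab.2 h))
    exact ⟨iff_of_false h1 h3, iff_of_false h2 h4⟩

variable (A B) in
/-- Corresponding nodes `(a, b)` of the two trees at level `n` are cut, for even `n`, by the element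
`n / 2` of `A` and its transfer to `B`, and for odd `n` the other way round. The pair of cuts is
`(leftCut, rightCut)`. -/
noncomputable def leftCut (s : M → M) (n p : M) : BAElt A :=
  open Classical in if par n = 0 then ⟨half n⟩ else
    transfer (⟨snd p⟩ : BAElt B) ⟨half n⟩ (⟨fst p⟩ : BAElt A) s

variable (A B) in
/-- The counterpart of `leftCut` in the second algebra. -/
noncomputable def rightCut (t : M → M) (n p : M) : BAElt B :=
  open Classical in if par n = 0 then
    transfer (⟨fst p⟩ : BAElt A) ⟨half n⟩ (⟨snd p⟩ : BAElt B) t else ⟨half n⟩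

variable (A B) in
/-- The pair of nodes at the node `u` of level `n`. -/
noncomputable def nodePair (s t : M → M) (n u : M) : M :=
  open Classical in
  prec (pr (⊤ : BAElt A).val (⊤ : BAElt B).val) (fun n p => pr
    (if n ∈ u then (⟨fst p⟩ : BAElt A) ⊓ leftCut A B s n p
      else (⟨fst p⟩ : BAElt A) ⊓ (leftCut A B s n p)ᶜ).val
    (if n ∈ u then (⟨snd p⟩ : BAElt B) ⊓ rightCut A B t n p
      else (⟨snd p⟩ : BAElt B) ⊓ (rightCut A B t n p)ᶜ).val) n

@[fun_prop] lemma fnB_leftCut {n : ℕ} (s : Fun₁ M) {φ ψ : (Fin n → M) → M} (hφ : Fn φ)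
    (hψ : Fn ψ) : FnB (fun x => leftCut A B s (φ x) (ψ x)) := by
  unfold leftCut; fun_prop

@[fun_prop] lemma fnB_rightCut {n : ℕ} (s : Fun₁ M) {φ ψ : (Fin n → M) → M} (hφ : Fn φ)
    (hψ : Fn ψ) : FnB (fun x => rightCut A B s (φ x) (ψ x)) := by
  unfold rightCut; fun_prop

@[fun_prop] lemma fn_nodePair {n : ℕ} (s t : Fun₁ M) {φ ψ : (Fin n → M) → M} (hφ : Fn φ)
    (hψ : Fn ψ) : Fn (fun x => nodePair A B s t (φ x) (ψ x)) :=
  fn_comp₂ (f := nodePair A B s t) (by unfold nodePair; fun_prop) hφ hψ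

lemma nodePair_zero (s t : Fun₁ M) (u : M) :
    nodePair A B s t 0 u = pr (⊤ : BAElt A).val (⊤ : BAElt B).val := by
  classical
  unfold nodePair
  exact prec_zero

lemma nodePair_add_one (s t : Fun₁ M) (n u : M) [Decidable (n ∈ u)] :
    nodePair A B s t (n + 1) u = pr
      (if n ∈ u then (⟨fst (nodePair A B s t n u)⟩ : BAElt A) ⊓
          leftCut A B s n (nodePair A B s t n u)
        else (⟨fst (nodePair A B s t n u)⟩ : BAElt A) ⊓
          (leftCut A B s n (nodePair A B s t n u))ᶜ).val
      (if n ∈ u then (⟨snd (nodePair A B s t n u)⟩ : BAElt B) ⊓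
          rightCut A B t n (nodePair A B s t n u)
        else (⟨snd (nodePair A B s t n u)⟩ : BAElt B) ⊓
          (rightCut A B t n (nodePair A B s t n u))ᶜ).val := by
  classical
  unfold nodePair
  rw [prec_add_one]
  congr

lemma nodePair_congr (s t : Fun₁ M) (n u v : M) (h : ∀ i, i < n → (i ∈ u ↔ i ∈ v)) :
    nodePair A B s t n u = nodePair A B s t n v := by
  classical
  have : ∀ m, m ≤ n → nodePair A B s t m u = nodePair A B s t m v := by
    intro m
    refine induct (P := fun m => m ≤ n → nodePair A B s t m u = nodePair A B s t m v) (fun _ => ?_)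
      (fun m ih hm => ?_) m
    · rw [nodePair_zero, nodePair_zero]
    · have h1 := add_one_le_iff.1 hm
      rw [nodePair_add_one, nodePair_add_one, ih h1.le]
      simp only [h m h1]
  exact this n le_rfl

variable (A B) in
/-- The tree of first components. -/
noncomputable def leftTree (s t : Fun₁ M) : BATree A where
  node n u := ⟨fst (nodePair A B s t n u)⟩
  cut n u := leftCut A B s n (nodePair A B s t n u)
  fnB_node := by fun_prop
  node_zero u := by rw [nodePair_zero, fst_pr]
  node_mem n u h := by classical rw [nodePair_add_one, fst_pr, if_pos h]
  node_notMem n u h := by classical rw [nodePair_add_one, fst_pr, if_neg h]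
  congr n u v h := by rw [nodePair_congr s t n u v h]; exact ⟨rfl, rfl⟩

variable (A B) in
/-- The tree of second components. -/
noncomputable def rightTree (s t : Fun₁ M) : BATree B where
  node n u := ⟨snd (nodePair A B s t n u)⟩
  cut n u := rightCut A B t n (nodePair A B s t n u)
  fnB_node := by fun_prop
  node_zero u := by rw [nodePair_zero, snd_pr]
  node_mem n u h := by classical rw [nodePair_add_one, snd_pr, if_pos h]
  node_notMem n u h := by classical rw [nodePair_add_one, snd_pr, if_neg h]
  congr n u v h := by rw [nodePair_congr s t n u v h]; exact ⟨rfl, rfl⟩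

/-- Corresponding nodes of the two trees are zero at the same time. -/
lemma node_eq_bot_iff {s t : Fun₁ M}
    (hs : ∀ x : BAElt A, x ≠ ⊥ → x ⊓ ⟨s x.val⟩ ≠ ⊥ ∧ x ⊓ (⟨s x.val⟩ : BAElt A)ᶜ ≠ ⊥)
    (ht : ∀ x : BAElt B, x ≠ ⊥ → x ⊓ ⟨t x.val⟩ ≠ ⊥ ∧ x ⊓ (⟨t x.val⟩ : BAElt B)ᶜ ≠ ⊥) (n u : M) :
    (leftTree A B s t).node n u = ⊥ ↔ (rightTree A B s t).node n u = ⊥ := by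
  classical
  have key : ∀ n, ((leftTree A B s t).node n u = ⊥ ↔ (rightTree A B s t).node n u = ⊥) →
      ((leftTree A B s t).node n u ⊓ (leftTree A B s t).cut n u = ⊥ ↔
        (rightTree A B s t).node n u ⊓ (rightTree A B s t).cut n u = ⊥) ∧
      ((leftTree A B s t).node n u ⊓ ((leftTree A B s t).cut n u)ᶜ = ⊥ ↔
        (rightTree A B s t).node n u ⊓ ((rightTree A B s t).cut n u)ᶜ = ⊥) := by
    intro n ih
    simp only [leftTree, rightTree, leftCut, rightCut] at ih ⊢
    split_ifs
    · exact transfer_spec ht ih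
    · exact ⟨(transfer_spec hs ih.symm).1.symm, (transfer_spec hs ih.symm).2.symm⟩
  refine induct (P := fun n => (leftTree A B s t).node n u = ⊥ ↔ (rightTree A B s t).node n u = ⊥)
    ?_ (fun n ih => ?_) n
  · rw [BATree.node_zero, BATree.node_zero]
    exact iff_of_false top_ne_bot top_ne_bot
  · by_cases hu : n ∈ u
    · rw [BATree.node_mem _ n u hu, BATree.node_mem _ n u hu]
      exact (key n ih).1
    · rw [BATree.node_notMem _ n u hu, BATree.node_notMem _ n u hu]
      exact (key n ih).2

/-- The pair `(a, b)` respects level `n` of a pair of trees: each node of the first tree is below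
`a` or disjoint from it, and the corresponding node of the second tree has the same position with
respect to `b`. -/
def Respects (T : BATree A) (T' : BATree B) (n : M) (a : BAElt A) (b : BAElt B) : Prop :=
  ∀ u, (T.node n u ≤ a ∧ T'.node n u ≤ b) ∨ (T.node n u ⊓ a = ⊥ ∧ T'.node n u ⊓ b = ⊥)

namespace Respects

variable {T : BATree A} {T' : BATree B} {m n : M} {a a₁ : BAElt A} {b b₁ : BAElt B}

lemma swap (h : Respects T T' n a b) : Respects T' T n b a := fun u => by
  rcases h u with h | h
  · exact Or.inl h.symm
  · exact Or.inr h.symm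

lemma mono (h : Respects T T' m a b) (hmn : m ≤ n) : Respects T T' n a b := fun u => by
  have h1 := T.node_anti hmn u
  have h2 := T'.node_anti hmn u
  rcases h u with ⟨h3, h4⟩ | ⟨h3, h4⟩
  · exact Or.inl ⟨h1.trans h3, h2.trans h4⟩
  · exact Or.inr ⟨le_bot_iff.1 ((inf_le_inf_right _ h1).trans h3.le),
      le_bot_iff.1 ((inf_le_inf_right _ h2).trans h4.le)⟩

lemma compl (h : Respects T T' n a b) : Respects T T' n aᶜ bᶜ := fun u => by
  rcases h u with ⟨h3, h4⟩ | ⟨h3, h4⟩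
  · refine Or.inr ⟨?_, ?_⟩ <;> rw [← disjoint_iff, disjoint_compl_right_iff] <;> assumption
  · exact Or.inl ⟨le_compl_iff_disjoint_right.2 (disjoint_iff.2 h3),
      le_compl_iff_disjoint_right.2 (disjoint_iff.2 h4)⟩

lemma sup (h : Respects T T' n a b) (h' : Respects T T' n a₁ b₁) :
    Respects T T' n (a ⊔ a₁) (b ⊔ b₁) := fun u => by
  rcases h u with ⟨h1, h2⟩ | ⟨h1, h2⟩
  · exact Or.inl ⟨h1.trans le_sup_left, h2.trans le_sup_left⟩
  · rcases h' u with ⟨h3, h4⟩ | ⟨h3, h4⟩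
    · exact Or.inl ⟨h3.trans le_sup_right, h4.trans le_sup_right⟩
    · exact Or.inr ⟨by rw [inf_sup_left, h1, h3, bot_sup_eq],
        by rw [inf_sup_left, h2, h4, bot_sup_eq]⟩

lemma inf (h : Respects T T' n a b) (h' : Respects T T' n a₁ b₁) :
    Respects T T' n (a ⊓ a₁) (b ⊓ b₁) := by
  have := (h.compl.sup h'.compl).compl
  rwa [compl_sup, compl_compl, compl_compl, compl_sup, compl_compl, compl_compl] at this

lemma bot : Respects T T' n ⊥ ⊥ := fun _ => Or.inr ⟨inf_bot_eq _, inf_bot_eq _⟩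

lemma top : Respects T T' n ⊤ ⊤ := fun _ => Or.inl ⟨le_top, le_top⟩

/-- If corresponding nodes are zero at the same time, then `b` is at most every other counterpart
`b₁` of `a`. -/
lemma le_of_left_eq (hT : ∀ n u, T.node n u = ⊥ ↔ T'.node n u = ⊥) (h : Respects T T' n a b)
    (h' : Respects T T' n a b₁) : b ≤ b₁ := by
  rw [← disjoint_compl_right_iff, disjoint_iff]
  by_contra hne
  obtain ⟨u, hu⟩ := T'.exists_node_ne_bot hne n
  -- The node `u` is below `b` and not below `b₁`, so its counterpart is below `a` and disjoint
  -- from `a`.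
  have hb : T'.node n u ⊓ b ≠ ⊥ := fun h0 => hu (le_bot_iff.1 (by
    rw [← h0]; exact le_inf inf_le_right (inf_le_left.trans inf_le_left)))
  have hb₁ : ¬ T'.node n u ≤ b₁ := fun h0 => hu (le_bot_iff.1 (by
    rw [← inf_compl_self b₁]
    exact le_inf (inf_le_right.trans h0) (inf_le_left.trans inf_le_right)))
  have h1 := (h u).resolve_right (fun h0 => hb h0.2)
  have h2 := (h' u).resolve_left (fun h0 => hb₁ h0.2)
  have h3 : T.node n u = ⊥ := by rw [← h2.1, inf_eq_left.2 h1.1]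
  rw [hT] at h3
  exact hb (by rw [h3, bot_inf_eq])

/-- A counterpart of `a` is determined by `a`, whatever the levels of the trees. -/
lemma right_unique (hT : ∀ n u, T.node n u = ⊥ ↔ T'.node n u = ⊥) (h : Respects T T' m a b)
    (h' : Respects T T' n a b₁) : b = b₁ :=
  le_antisymm (le_of_left_eq hT (h.mono (n := m + n) le_self_add) (h'.mono le_add_self))
    (le_of_left_eq hT (h'.mono (n := m + n) le_add_self) (h.mono le_self_add))

end Respects

end Transfer

/-- The isomorphism sends `a` to the join of the nodes of the second tree on the side of the cut by
`a`; the levels `2 a` and `2 b + 1` deal with the elements `a` and `b` of the two algebras. -/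
lemma catAtomlessBA_of_choice (hC : Choice M) : (str (M := M)).CatAtomlessBA := by
  intro A B hA hB
  have : Fact ((str (M := M)).IsAtomlessBA A) := ⟨hA⟩
  have : Fact ((str (M := M)).IsAtomlessBA B) := ⟨hB⟩
  obtain ⟨s, hs⟩ := exists_split hC A
  obtain ⟨t, ht⟩ := exists_split hC B
  set T := leftTree A B s t with hTdef
  set T' := rightTree A B s t with hTdef'
  have hT : ∀ n u, T.node n u = ⊥ ↔ T'.node n u = ⊥ := node_eq_bot_iff hs ht
  have hT' : ∀ n u, T'.node n u = ⊥ ↔ T.node n u = ⊥ := fun n u => (hT n u).symm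
  have h1 : ∀ a : BAElt A, Respects T T' (a.val + a.val + 1) a (T'.side (a.val + a.val)) := by
    intro a u
    have hcut : T.cut (a.val + a.val) u = a := by
      simp only [hTdef, leftTree, leftCut, par_double, half_double, if_true]
    by_cases hu : a.val + a.val ∈ u
    · have := T.node_le_cut le_rfl hu
      rw [hcut] at this
      exact Or.inl ⟨this, T'.node_le_side le_rfl hu⟩
    · have := T.node_inf_cut le_rfl hu
      rw [hcut] at this
      exact Or.inr ⟨this, T'.node_inf_side le_rfl hu⟩
  have h2 : ∀ b : BAElt B,
      Respects T T' (b.val + b.val + 1 + 1) (T.side (b.val + b.val + 1)) b := by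
    intro b u
    have hcut : T'.cut (b.val + b.val + 1) u = b := by
      simp only [hTdef', rightTree, rightCut, par_double_add_one, half_double_add_one, one_ne_zero',
        if_false]
    by_cases hu : b.val + b.val + 1 ∈ u
    · have := T'.node_le_cut le_rfl hu
      rw [hcut] at this
      exact Or.inl ⟨T.node_le_side le_rfl hu, this⟩
    · have := T'.node_inf_cut le_rfl hu
      rw [hcut] at this
      exact Or.inr ⟨T.node_inf_side le_rfl hu, this⟩
  have key : ∀ {n : M} {a : BAElt A} {b : BAElt B}, Respects T T' n a b →
      T'.side (a.val + a.val) = b := fun h => (h1 _).right_unique hT h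
  refine ⟨fun a => (T'.side (a + a)).val, ⟨?_, fun b => (T.side (b + b + 1)).val, ?_, ?_, ?_⟩,
    ?_, ?_, ?_, ?_, ?_⟩
  · exact T'.fnB_side (by fun_prop)
  · exact T.fnB_side (by fun_prop)
  · intro a
    exact congrArg BAElt.val ((h2 (T'.side (a + a))).swap.right_unique hT' (h1 ⟨a⟩).swap)
  · intro b
    exact congrArg BAElt.val (key (h2 ⟨b⟩))
  · intro a b
    exact congrArg BAElt.val (key (((h1 ⟨a⟩).mono le_self_add).sup ((h1 ⟨b⟩).mono le_add_self)))
  · intro a b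
    exact congrArg BAElt.val (key (((h1 ⟨a⟩).mono le_self_add).inf ((h1 ⟨b⟩).mono le_add_self)))
  · intro a
    exact congrArg BAElt.val (key (h1 ⟨a⟩).compl)
  · exact congrArg BAElt.val (key (n := 0) Respects.bot)
  · exact congrArg BAElt.val (key (n := 0) Respects.top)

/-! ### Choice from the categoricity of random graphs -/

/-- The least element of a set. -/
noncomputable def least (z : M) : M := mu (fun i => i < z ∧ i ∈ z)

@[fun_prop] lemma fn_least {n : ℕ} {φ : (Fin n → M) → M} (hφ : Fn φ) :
    Fn (fun x => least (φ x)) := fn_comp₁ (f := least) (by unfold least; fun_prop) hφ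

lemma least_mem {i z : M} (h : i ∈ z) : least z ∈ z :=
  (mu_spec (P := fun i => i < z ∧ i ∈ z) ⟨i, lt_of_mem h, h⟩).1.2

lemma least_le {i z : M} (h : i ∈ z) : least z ≤ i :=
  mu_le (P := fun i => i < z ∧ i ∈ z) ⟨lt_of_mem h, h⟩

/-- The vertex `z` is joined to its elements, provided that a `Θ`-witness for its least element
appears below `z`. -/
def Arrow (Θ : Rel₂ M) (x z : M) : Prop := x ∈ z ∧ ∃ m, m < z ∧ Θ (least z) m

/-- The adjacency relation of the graph whose edges are the arrows of `Θ`. -/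
def Edge (Θ : Rel₂ M) (x z : M) : Prop := Arrow Θ x z ∨ Arrow Θ z x

@[fun_prop] lemma dp_edge {n : ℕ} (Θ : Rel₂ M) {φ ψ : (Fin n → M) → M} (hφ : Fn φ) (hψ : Fn ψ) :
    Dp (fun x => Edge Θ (φ x) (ψ x)) :=
  Dp.comp₂ (R := Edge Θ) (by unfold Edge Arrow; fun_prop) hφ hψ

/-- The characteristic function of a relation. -/
noncomputable def chi (R : M → M → Prop) (a b : M) : M :=
  open Classical in if R a b then 1 else 0

@[simp] lemma chi_eq_one {R : M → M → Prop} {a b : M} : chi R a b = 1 ↔ R a b := by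
  unfold chi; split_ifs with h <;> simp [h, one_ne_zero'.symm]

lemma isRel_chi {R : M → M → Prop} (hR : Dp (fun x : Fin 2 → M => R (x 0) (x 1))) :
    (str (M := M)).IsRel (chi R) := by
  refine ⟨hR, fun a b => ?_⟩
  unfold chi
  split_ifs
  · exact Or.inr rfl
  · exact Or.inl rfl

/-- Only the `Θ`-witness for the least element of the first set is needed to find a vertex. -/
lemma isRandomGraph_edge {Θ : Rel₂ M} (hΘ : ∀ n, ∃ m, Θ n m) :
    (str (M := M)).IsRandomGraph (chi (Edge Θ)) where
  rel := isRel_chi (by fun_prop)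
  irrefl a h := by
    rcases chi_eq_one.1 h with h | h <;> exact lt_irrefl _ (lt_of_mem h.1)
  symm a b h := chi_eq_one.2 (chi_eq_one.1 h).symm
  random f g hf hg hfne _ hfg := by
    obtain ⟨hf, -, d, hd⟩ := hf
    obtain ⟨-, -, d', hd'⟩ := hg
    have hd : ∀ a, f a = 1 → a ≤ d := fun a h => not_lt.1 fun h' =>
      one_ne_zero' (h.symm.trans (hd a h'))
    have hd' : ∀ a, g a = 1 → a ≤ d' := fun a h => not_lt.1 fun h' =>
      one_ne_zero' (h.symm.trans (hd' a h'))
    obtain ⟨f, rfl⟩ : ∃ F : Fun₁ M, F.toFun = f := ⟨⟨f, hf⟩, rfl⟩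
    obtain ⟨hn, hn'⟩ := mu_spec (P := fun a => f a = 1) hfne
    obtain ⟨m, hm⟩ := hΘ (mu fun a => f a = 1)
    generalize (mu fun a => f a = 1) = n at hn hn' hm
    -- The new vertex `z` has the elements of the first set and one large element as its elements.
    obtain ⟨D, hD⟩ : ∃ D, D = d + d' + m + 1 := ⟨_, rfl⟩
    have h1 : d < D := by rw [hD, lt_add_one_iff, add_assoc]; exact le_self_add
    have h2 : d' < D := by rw [hD, lt_add_one_iff, add_comm d, add_assoc]; exact le_self_add
    have h3 : m < D := by rw [hD, lt_add_one_iff]; exact le_add_self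
    obtain ⟨z, hz⟩ : ∃ z : M, ∀ i, i ∈ z ↔ i < D + 1 ∧ (f i = 1 ∨ i = D) :=
      exists_code (by fun_prop) _
    have hDz : D < z := lt_of_mem ((hz D).2 ⟨lt_add_one_iff.2 le_rfl, Or.inr rfl⟩)
    have hfz : ∀ i, f i = 1 → i ∈ z := fun i hi =>
      (hz i).2 ⟨lt_add_one_iff.2 ((hd i hi).trans h1.le), Or.inl hi⟩
    have hleast : least z = n := by
      refine le_antisymm (least_le (hfz n hn)) (not_lt.1 fun h => ?_)
      rcases ((hz _).1 (least_mem (hfz n hn))).2 with h4 | h4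
      · exact hn' _ h h4
      · rw [h4] at h
        exact lt_asymm h ((hd n hn).trans_lt h1)
    refine ⟨z, fun a ha => ?_, fun b hb h => ?_⟩
    · exact chi_eq_one.2 (Or.inl ⟨hfz a ha, m, h3.trans hDz, by rwa [hleast]⟩)
    · rcases chi_eq_one.1 h with h | h
      · rcases ((hz b).1 h.1).2 with h4 | h4
        · exact hfg b ⟨h4, hb⟩
        · exact not_lt.2 (hd' b hb) (h4 ▸ h2)
      · exact lt_asymm (lt_of_mem h.1) ((hd' b hb).trans_lt (h2.trans hDz))

/-- The graph of the total relation, whose vertices are found by an explicit function, is compared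
with the graph of `Θ`, where a vertex above `n` that has `n` as its least neighbour bounds a witness
for `n`. -/
lemma choice_of_catRandomGraph (hcat : (str (M := M)).CatRandomGraph) : Choice M := by
  intro Θ hΘ
  obtain ⟨h, ⟨hh, k, hk, hkh, hhk⟩, hiso⟩ := hcat _ _
    (isRandomGraph_edge (Θ := ⟨fun _ _ => True, by fun_prop⟩) (fun _ => ⟨0, trivial⟩))
    (isRandomGraph_edge hΘ)
  obtain ⟨h, rfl⟩ : ∃ F : Fun₁ M, F.toFun = h := ⟨⟨h, hh⟩, rfl⟩
  obtain ⟨k, rfl⟩ : ∃ F : Fun₁ M, F.toFun = k := ⟨⟨k, hk⟩, rfl⟩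
  have hiso : ∀ a b, Edge ⟨fun _ _ => True, by fun_prop⟩ a b ↔ Edge Θ (h a) (h b) := fun a b =>
    chi_eq_one.symm.trans ((hiso a b).trans chi_eq_one)
  -- The preimage of `z n` has the preimage of `n` as its only neighbour among the preimages of
  -- `0, …, n`, and lies outside these.
  let z : Fun₁ M := ⟨fun n => code (fun i => i = k n ∨ i = bnd k (n + 1)) (bnd k (n + 1) + 1),
    by fun_prop⟩
  have hz : ∀ n i, i ∈ z n ↔ i < bnd k (n + 1) + 1 ∧ (i = k n ∨ i = bnd k (n + 1)) :=
    fun n i => mem_code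
  have hbnd : ∀ n i, i ≤ n → k i < bnd k (n + 1) := fun n i hi => lt_bnd (lt_add_one_iff.2 hi)
  have hlt : ∀ n, bnd k (n + 1) < z n := fun n =>
    lt_of_mem ((hz n _).2 ⟨lt_add_one_iff.2 le_rfl, Or.inr rfl⟩)
  have hkz : ∀ n, k n ∈ z n := fun n =>
    (hz n _).2 ⟨lt_add_one_iff.2 (hbnd n n le_rfl).le, Or.inl rfl⟩
  have hkey : ∀ n, ∃ m, m < h (z n) ∧ Θ n m := by
    intro n
    have h1 : ∀ i, i < n → ¬ Edge Θ i (h (z n)) := by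
      intro i hi hE
      rw [← hhk i, ← hiso] at hE
      rcases hE with hE | hE
      · rcases ((hz n _).1 hE.1).2 with h2 | h2
        · have := congrArg h h2
          rw [hhk, hhk] at this
          exact hi.ne this
        · exact (hbnd n i hi.le).ne h2
      · exact lt_asymm (lt_of_mem hE.1) ((hbnd n i hi.le).trans (hlt n))
    have h2 : n < h (z n) := by
      refine not_le.1 fun h2 => ?_
      have := hbnd n _ h2
      rw [hkh] at this
      exact lt_asymm this (hlt n)
    have h3 : Edge Θ n (h (z n)) := by
      rw [← hhk n, ← hiso, hhk]
      exact Or.inl ⟨hkz n, 0, (zero_le' _).trans_lt (lt_of_mem (hkz n)), trivial⟩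
    rcases h3 with ⟨h3, h4⟩ | h3
    · have h5 : least (h (z n)) = n := by
        refine le_antisymm (least_le h3) (not_lt.1 fun h5 => ?_)
        exact h1 _ h5 (Or.inl ⟨least_mem h3, h4⟩)
      rwa [h5] at h4
    · exact absurd (lt_of_mem h3.1) (not_lt.2 h2.le)
  exact ⟨⟨fun n => mu (fun m => m < h (z n) ∧ Θ n m), by fun_prop⟩,
    fun n => (mu_spec (hkey n)).1.2⟩

/-! ### Dense linear orders with least element `0` -/

/-- `L` is a dense linear order with least element `0` and without greatest element. -/
structure IsDense₀ (L : Rel₂ M) : Prop where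
  irrefl : ∀ a, ¬ L a a
  trans : ∀ a b c, L a b → L b c → L a c
  total : ∀ a b, L a b ∨ a = b ∨ L b a
  zero : ∀ a, a ≠ 0 → L 0 a
  dense : ∀ a b, L a b → ∃ c, L a c ∧ L c b
  noMax : ∀ a, ∃ b, L a b

lemma IsDense₀.ne_zero {L : Rel₂ M} (hL : IsDense₀ L) {a b : M} (h : L a b) : b ≠ 0 := by
  rintro rfl
  by_cases ha : a = 0
  · rw [ha] at h; exact hL.irrefl 0 h
  · exact hL.irrefl 0 (hL.trans _ _ _ (hL.zero a ha) h)

lemma IsDense₀.of_equiv {L R : Rel₂ M} (hL : IsDense₀ L) (σ : M ≃ M) (h0 : σ 0 = 0)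
    (hR : ∀ a b, R a b ↔ L (σ a) (σ b)) : IsDense₀ R where
  irrefl a := by rw [hR]; exact hL.irrefl _
  trans a b c := by rw [hR, hR, hR]; exact hL.trans _ _ _
  total a b := by
    rw [hR, hR]
    exact (hL.total (σ a) (σ b)).imp_right (Or.imp_left fun h => σ.injective h)
  zero a ha := by
    rw [hR, h0]
    exact hL.zero _ fun h => ha (σ.injective (h.trans h0.symm))
  dense a b h := by
    obtain ⟨c, h1, h2⟩ := hL.dense _ _ ((hR a b).1 h)
    exact ⟨σ.symm c, by rwa [hR, σ.apply_symm_apply], by rwa [hR, σ.apply_symm_apply]⟩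
  noMax a := by
    obtain ⟨c, h1⟩ := hL.noMax (σ a)
    exact ⟨σ.symm c, by rwa [hR, σ.apply_symm_apply]⟩

/-- Removing the least element leaves a dense linear order without end points. -/
lemma IsDense₀.isDLO {L : Rel₂ M} (hL : IsDense₀ L) :
    (str (M := M)).IsDLO (chi fun a b => L (a + 1) (b + 1)) where
  rel := isRel_chi (by fun_prop)
  irrefl a h := hL.irrefl _ (chi_eq_one.1 h)
  trans a b c h h' := chi_eq_one.2 (hL.trans _ _ _ (chi_eq_one.1 h) (chi_eq_one.1 h'))
  total a b := by
    rcases hL.total (a + 1) (b + 1) with h | h | h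
    · exact Or.inl (chi_eq_one.2 h)
    · exact Or.inr (Or.inl (add_right_cancel h))
    · exact Or.inr (Or.inr (chi_eq_one.2 h))
  dense a b h := by
    obtain ⟨c, h1, h2⟩ := hL.dense _ _ (chi_eq_one.1 h)
    obtain ⟨d, rfl⟩ := (eq_zero_or_add_one c).resolve_left (hL.ne_zero h1)
    exact ⟨d, chi_eq_one.2 h1, chi_eq_one.2 h2⟩
  noMin a := by
    have ha : a + 1 ≠ 0 := (pos_of_ne fun h => not_lt_zero' a (h ▸ lt_add_one_iff.2 le_rfl)).ne'
    obtain ⟨c, h1, h2⟩ := hL.dense _ _ (hL.zero (a + 1) ha)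
    obtain ⟨d, rfl⟩ := (eq_zero_or_add_one c).resolve_left (hL.ne_zero h1)
    exact ⟨d, chi_eq_one.2 h2⟩
  noMax a := by
    obtain ⟨c, h1⟩ := hL.noMax (a + 1)
    obtain ⟨d, rfl⟩ := (eq_zero_or_add_one c).resolve_left (hL.ne_zero h1)
    exact ⟨d, chi_eq_one.2 h1⟩

variable (M) in
/-- The lexicographic order of finite sets, as binary sequences starting with the lowest digit: the
order of the dyadic rationals in `[0, 1)`. -/
def lex : Rel₂ M :=
  ⟨fun x y => ∃ i, i < y ∧ i ∈ y ∧ i ∉ x ∧ ∀ j, j < i → (j ∈ x ↔ j ∈ y), by fun_prop⟩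

lemma lex_iff {x y : M} : lex M x y ↔ ∃ i, i ∈ y ∧ i ∉ x ∧ ∀ j, j < i → (j ∈ x ↔ j ∈ y) :=
  ⟨fun ⟨i, _, h⟩ => ⟨i, h⟩, fun ⟨i, h⟩ => ⟨i, lt_of_mem h.1, h⟩⟩

/-- The set `x ∪ {D}`. -/
noncomputable def adjoin (x D : M) : M := code (fun i => i ∈ x ∨ i = D) (x + D + 1)

@[fun_prop] lemma fn_adjoin {n : ℕ} {φ ψ : (Fin n → M) → M} (hφ : Fn φ) (hψ : Fn ψ) :
    Fn (fun x => adjoin (φ x) (ψ x)) := fn_comp₂ (f := adjoin) (by unfold adjoin; fun_prop) hφ hψ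

lemma mem_adjoin {x D i : M} : i ∈ adjoin x D ↔ i ∈ x ∨ i = D := by
  unfold adjoin
  rw [mem_code]
  refine ⟨And.right, fun h => ⟨?_, h⟩⟩
  rw [lt_add_one_iff]
  rcases h with h | rfl
  · exact (lt_of_mem h).le.trans le_self_add
  · exact le_add_self

lemma lex_adjoin {x D : M} (h : x ≤ D) : lex M x (adjoin x D) := by
  refine lex_iff.2 ⟨D, mem_adjoin.2 (Or.inr rfl), fun h' => not_lt.2 h (lt_of_mem h'),
    fun j hj => ?_⟩
  rw [mem_adjoin]
  have := hj.ne
  tauto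

lemma adjoin_lex {x y D : M} (hxy : lex M x y) (h : y ≤ D) : lex M (adjoin x D) y := by
  obtain ⟨i, h1, h2, h3⟩ := lex_iff.1 hxy
  have h4 := (lt_of_mem h1).trans_le h
  refine lex_iff.2 ⟨i, h1, ?_, fun j hj => ?_⟩
  · rw [mem_adjoin]
    have := h4.ne
    tauto
  · rw [mem_adjoin, ← h3 j hj]
    have := (hj.trans h4).ne
    tauto

lemma isDense₀_lex : IsDense₀ (lex M) where
  irrefl a h := by
    obtain ⟨i, h1, h2, _⟩ := lex_iff.1 h
    exact h2 h1
  trans a b c h h' := by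
    obtain ⟨i, h1, h2, h3⟩ := lex_iff.1 h
    obtain ⟨j, h4, h5, h6⟩ := lex_iff.1 h'
    rcases lt_trichotomy i j with hij | rfl | hij
    · exact lex_iff.2 ⟨i, (h6 i hij).1 h1, h2, fun k hk => (h3 k hk).trans (h6 k (hk.trans hij))⟩
    · exact absurd h1 h5
    · exact lex_iff.2 ⟨j, h4, fun h => h5 ((h3 j hij).1 h),
        fun k hk => (h3 k (hk.trans hij)).trans (h6 k hk)⟩
  total a b := by
    by_cases hab : ∃ i, ¬ (i ∈ a ↔ i ∈ b)
    · obtain ⟨i, hi, hi'⟩ := exists_least hab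
      by_cases h : i ∈ b
      · exact Or.inl (lex_iff.2 ⟨i, h, by tauto, fun j hj => not_not.1 (hi' j hj)⟩)
      · exact Or.inr (Or.inr (lex_iff.2 ⟨i, by tauto, h, fun j hj => (not_not.1 (hi' j hj)).symm⟩))
    · push Not at hab
      exact Or.inr (Or.inl (set_ext fun i => by have := hab i; tauto))
  zero a ha := by
    have : ∃ i, i ∈ a := by
      by_contra h
      push Not at h
      exact ha (set_ext fun i => iff_of_false (h i) (notMem_zero i))
    obtain ⟨i, hi, hi'⟩ := exists_least this
    exact lex_iff.2 ⟨i, hi, notMem_zero i, fun j hj => iff_of_false (notMem_zero j) (hi' j hj)⟩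
  dense a b h := ⟨adjoin a (a + b), lex_adjoin le_self_add, adjoin_lex h le_add_self⟩
  noMax a := ⟨adjoin a a, lex_adjoin le_rfl⟩

/-! ### A dense order with late witnesses -/

/-- The least number outside a set. -/
noncomputable def miss (x : M) : M := mu (fun i => i < x + 1 ∧ i ∉ x)

@[fun_prop] lemma fn_miss {n : ℕ} {φ : (Fin n → M) → M} (hφ : Fn φ) :
    Fn (fun x => miss (φ x)) := fn_comp₁ (f := miss) (by unfold miss; fun_prop) hφ

lemma miss_spec (x : M) : miss x ∉ x ∧ ∀ j, j < miss x → j ∈ x := by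
  have h : x < x + 1 ∧ x ∉ x := ⟨lt_add_one_iff.2 le_rfl, fun h => lt_irrefl _ (lt_of_mem h)⟩
  obtain ⟨⟨h1, h2⟩, h3⟩ := mu_spec (P := fun i => i < x + 1 ∧ i ∉ x) ⟨x, h⟩
  exact ⟨h2, fun j hj => not_not.1 fun h' => h3 j hj ⟨hj.trans h1, h'⟩⟩

lemma miss_eq {x n : M} (h : n ∉ x) (h' : ∀ j, j < n → j ∈ x) : miss x = n := by
  obtain ⟨h1, h2⟩ := miss_spec x
  exact le_antisymm (not_lt.1 fun h3 => h (h2 n h3)) (not_lt.1 fun h3 => h1 (h' _ h3))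

/-- The set of all numbers up to `n + 1 + m` except `n`. -/
noncomputable def gap (n m : M) : M := code (fun i => i ≠ n) (n + 1 + m + 1)

@[fun_prop] lemma fn_gap {n : ℕ} {φ ψ : (Fin n → M) → M} (hφ : Fn φ) (hψ : Fn ψ) :
    Fn (fun x => gap (φ x) (ψ x)) :=
  fn_comp₂ (f := gap) (by unfold gap; simp only [ne_eq]; fun_prop) hφ hψ

lemma mem_gap {n m i : M} : i ∈ gap n m ↔ i ≤ n + 1 + m ∧ i ≠ n := by
  unfold gap
  rw [mem_code (hP := by simp only [ne_eq]; fun_prop), lt_add_one_iff]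

lemma lt_add_one_add (n m : M) : n < n + 1 + m := (lt_add_one_iff.2 le_rfl).trans_le le_self_add

lemma miss_gap (n m : M) : miss (gap n m) = n :=
  miss_eq (fun h => (mem_gap.1 h).2 rfl)
    (fun _ hj => mem_gap.2 ⟨(hj.trans (lt_add_one_add n m)).le, hj.ne⟩)

lemma gap_ne_zero (n m : M) : gap n m ≠ 0 := fun h =>
  notMem_zero _ (h ▸ mem_gap.2 ⟨le_rfl, (lt_add_one_add n m).ne'⟩ : n + 1 + m ∈ (0 : M))

lemma lt_gap (n m : M) : m < gap n m :=
  lt_of_le_of_lt le_add_self (lt_of_mem (mem_gap.2 ⟨le_rfl, (lt_add_one_add n m).ne'⟩ :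
    n + 1 + m ∈ gap n m))

/-- The late point of block `n`, the set of all `x` with `miss x = n`: its position is determined
by the least `Θ`-witness for `n`. -/
noncomputable def late (Θ : Rel₂ M) (n : M) : M := gap n (mu (Θ n))

open Classical in
/-- The permutation exchanging, in each block `n`, the points `gap n 0` and `late Θ n`. It need not
be a function of the model. -/
noncomputable def twist (Θ : Rel₂ M) (x : M) : M :=
  if x = gap (miss x) 0 then late Θ (miss x) else
    if x = late Θ (miss x) then gap (miss x) 0 else x

lemma miss_late (Θ : Rel₂ M) (n : M) : miss (late Θ n) = n := miss_gap _ _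

lemma miss_twist (Θ : Rel₂ M) (x : M) : miss (twist Θ x) = miss x := by
  unfold twist
  split_ifs
  · exact miss_late _ _
  · exact miss_gap _ _
  · rfl

lemma twist_gap (Θ : Rel₂ M) (n : M) : twist Θ (gap n 0) = late Θ n := by
  unfold twist
  rw [miss_gap, if_pos rfl]

lemma twist_late (Θ : Rel₂ M) (n : M) : twist Θ (late Θ n) = gap n 0 := by
  unfold twist
  rw [miss_late]
  split_ifs with h
  · exact h
  · rfl
  · contradiction

lemma twist_twist (Θ : Rel₂ M) (x : M) : twist Θ (twist Θ x) = x := by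
  by_cases h : x = gap (miss x) 0
  · rw [h, twist_gap, twist_late]
  · by_cases h' : x = late Θ (miss x)
    · rw [h', twist_late, twist_gap]
    · have : twist Θ x = x := by unfold twist; rw [if_neg h, if_neg h']
      rw [this, this]

lemma twist_of_miss_eq {Θ : Rel₂ M} {x n : M} (h : miss x = n) :
    twist Θ x = late Θ n ∨ x = late Θ n ∨ twist Θ x = x := by
  subst h
  unfold twist
  split_ifs with h h'
  · exact Or.inl rfl
  · exact Or.inr (Or.inl h')
  · exact Or.inr (Or.inr rfl)

/-- Whenever `n` has a `Θ`-witness, a point between `late Θ n` and the first point of the next block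
bounds one. -/
lemma exists_lt_of_lex {Θ : Rel₂ M} {x n : M} (hΘ : ∃ m, Θ n m) (h1 : lex M (late Θ n) (twist Θ x))
    (h2 : lex M (twist Θ x) (seg (n + 1))) : ∃ m, m < x ∧ Θ n m := by
  have hmu := (mu_spec hΘ).1
  obtain ⟨j, hj, hjx, hj'⟩ := lex_iff.1 h2
  obtain ⟨i, hi, hil, hi'⟩ := lex_iff.1 h1
  rw [mem_seg, lt_add_one_iff] at hj
  have hmiss : miss (twist Θ x) = j := miss_eq hjx fun k hk =>
    (hj' k hk).2 (mem_seg.2 (hk.trans_le (hj.trans (lt_add_one_iff.2 le_rfl).le)))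
  have hlow : ∀ k, k < n → k ∈ late Θ n := fun k hk =>
    mem_gap.2 ⟨(hk.trans (lt_add_one_add n _)).le, hk.ne⟩
  have hjn : j = n := by
    refine hj.eq_of_not_lt fun hjn => ?_
    rcases lt_trichotomy i j with h | rfl | h
    · exact hil (hlow i (h.trans hjn))
    · exact hjx hi
    · exact hjx ((hi' j h).1 (hlow j hjn))
  subst hjn
  have hmui : mu (Θ j) < i := by
    refine not_le.1 fun h => hil (mem_gap.2 ⟨h.trans le_add_self, ?_⟩)
    rintro rfl
    exact hjx hi
  rcases twist_of_miss_eq (Θ := Θ) ((miss_twist Θ x).symm.trans hmiss) with h | h | h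
  · exact absurd hi (by rwa [h])
  · exact ⟨mu (Θ j), h ▸ lt_gap _ _, hmu⟩
  · rw [h] at hi
    exact ⟨mu (Θ j), hmui.trans (lt_of_mem hi), hmu⟩

/-- Membership in the late point does not need the least witness, only a bounded search. -/
lemma mem_late {Θ : Rel₂ M} {n i : M} (hΘ : ∃ m, Θ n m) :
    i ∈ late Θ n ↔ i ≠ n ∧ ∀ m, m < i → n + 1 + m < i → ¬ Θ n m := by
  obtain ⟨h1, h2⟩ := mu_spec hΘ
  unfold late
  rw [mem_gap, and_comm]
  refine and_congr_right fun _ => ⟨fun h m _ hm => h2 m ?_, fun h => not_lt.1 fun hlt => ?_⟩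
  · exact lt_of_add_lt_add_left (hm.trans_le h)
  · exact h (mu (Θ n)) (lt_of_le_of_lt le_add_self hlt) hlt h1

lemma eq_late_iff {Θ : Rel₂ M} {n x : M} (hΘ : ∃ m, Θ n m) :
    x = late Θ n ↔ ∃ m, m < x ∧ Θ n m ∧ (∀ m', m' < m → ¬ Θ n m') ∧ x = gap n m := by
  obtain ⟨h1, h2⟩ := mu_spec hΘ
  constructor
  · rintro rfl
    exact ⟨mu (Θ n), lt_gap _ _, h1, h2, rfl⟩
  · rintro ⟨m, _, h3, h4, rfl⟩
    have : mu (Θ n) = m := le_antisymm (mu_le h3) (not_lt.1 fun h => h4 _ h h1)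
    rw [late, this]

/-- Membership in `twist Θ x` by bounded quantifiers over `Θ`. -/
lemma mem_twist {Θ : Rel₂ M} (hΘ : ∀ n, ∃ m, Θ n m) {x i : M} : i ∈ twist Θ x ↔
    (x = gap (miss x) 0 → i ≠ miss x ∧ ∀ m, m < i → miss x + 1 + m < i → ¬ Θ (miss x) m) ∧
    (x ≠ gap (miss x) 0 →
      ((∃ m, m < x ∧ Θ (miss x) m ∧ (∀ m', m' < m → ¬ Θ (miss x) m') ∧ x = gap (miss x) m) →
        i ∈ gap (miss x) 0) ∧
      (¬ (∃ m, m < x ∧ Θ (miss x) m ∧ (∀ m', m' < m → ¬ Θ (miss x) m') ∧ x = gap (miss x) m) →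
        i ∈ x)) := by
  rw [← eq_late_iff (hΘ _), ← mem_late (hΘ _)]
  unfold twist
  split_ifs with h h' <;> tauto

lemma lt_of_mem_twist {Θ : Rel₂ M} {x i : M} (hx : x ≠ gap (miss x) 0) (h : i ∈ twist Θ x) :
    i < x := by
  unfold twist at h
  rw [if_neg hx] at h
  split_ifs at h with h'
  · obtain ⟨h1, h2⟩ := mem_gap.1 h
    refine lt_of_mem (h' ▸ mem_gap.2 ⟨h1.trans ?_, h2⟩ : i ∈ x)
    rw [add_zero]
    exact le_self_add
  · exact lt_of_mem h

/-- The first difference between the positions of two points is bounded in terms of the points,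
even though the positions are not. -/
lemma lex_twist_bound {Θ : Rel₂ M} {x y i : M} (h1 : i ∈ twist Θ y) (h2 : i ∉ twist Θ x)
    (h3 : ∀ j, j < i → (j ∈ twist Θ x ↔ j ∈ twist Θ y)) : i ≤ x + y + 1 := by
  by_contra hi
  rw [not_le] at hi
  have hyi : y < i := lt_of_le_of_lt ((le_add_self).trans le_self_add) hi
  by_cases hy : y = gap (miss y) 0
  swap
  · exact lt_asymm hyi (lt_of_mem_twist hy h1)
  generalize miss y = k at hy
  have hk : k < y := by
    refine (lt_add_one_add k 0).trans (lt_of_mem ?_)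
    rw [hy]
    exact mem_gap.2 ⟨le_rfl, (lt_add_one_add k 0).ne'⟩
  have hty : twist Θ y = late Θ k := by rw [hy, twist_gap]
  rw [hty] at h1 h3
  have hmem : ∀ j, j ≤ i → j ≠ k → j ∈ late Θ k := fun j hj hjk =>
    mem_gap.2 ⟨hj.trans (mem_gap.1 h1).1, hjk⟩
  by_cases hx : x = gap (miss x) 0
  · generalize miss x = k' at hx
    have htx : twist Θ x = late Θ k' := by rw [hx, twist_gap]
    rw [htx] at h2 h3
    have hself : ∀ k, k ∉ late Θ k := fun k h => (mem_gap.1 h).2 rfl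
    rcases lt_trichotomy k k' with h | h | h
    · exact hself k ((h3 k (hk.trans hyi)).1 (mem_gap.2 ⟨(h.trans (lt_add_one_add _ _)).le, h.ne⟩))
    · rw [h] at h1; exact h2 h1
    · exact hself k' ((h3 k' (h.trans (hk.trans hyi))).2
        (mem_gap.2 ⟨(h.trans (lt_add_one_add _ _)).le, h.ne⟩))
  · have h4 : x + k + 1 < i := by
      refine lt_trans ?_ hi
      grind
    have h5 : k < x + k + 1 := lt_add_one_iff.2 le_add_self
    have h6 := lt_of_mem_twist hx ((h3 _ h4).2 (hmem _ h4.le h5.ne'))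
    exact not_lt.2 (le_self_add.trans le_self_add) h6

/-- The order in which every point `x` has the position `twist Θ x`. -/
noncomputable def lateOrder (Θ : Rel₂ M) (hΘ : ∀ n, ∃ m, Θ n m) : Rel₂ M where
  rel x y := lex M (twist Θ x) (twist Θ y)
  dp := by
    have hmem : Dp (fun v : Fin 2 → M => v 0 ∈ twist Θ (v 1)) := by
      simp only [mem_twist hΘ, ne_eq]
      fun_prop
    obtain ⟨S, hS⟩ : ∃ S : Rel₂ M, ∀ i x, S i x ↔ i ∈ twist Θ x :=
      ⟨⟨fun i x => i ∈ twist Θ x, hmem⟩, fun _ _ => Iff.rfl⟩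
    have : Dp (fun v : Fin 2 → M => ∃ i, i ≤ v 0 + v 1 + 1 ∧ S i (v 1) ∧ ¬ S i (v 0) ∧
      ∀ j, j < i → (S j (v 0) ↔ S j (v 1))) := by fun_prop
    refine this.congr fun v => ?_
    simp only [hS]
    rw [lex_iff]
    exact ⟨fun ⟨i, _, h⟩ => ⟨i, h⟩, fun ⟨i, h⟩ => ⟨i, lex_twist_bound h.1 h.2.1 h.2.2, h⟩⟩

lemma lateOrder_iff {Θ : Rel₂ M} {hΘ : ∀ n, ∃ m, Θ n m} {x y : M} :
    lateOrder Θ hΘ x y ↔ lex M (twist Θ x) (twist Θ y) := Iff.rfl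

lemma twist_seg (Θ : Rel₂ M) (n : M) : twist Θ (seg n) = seg n := by
  have h1 : miss (seg n) = n := miss_eq (by simp) (by simp)
  have h2 : ∀ m, seg n ≠ gap n m := fun m h => by
    have : n + 1 + m ∈ seg n := h ▸ mem_gap.2 ⟨le_rfl, (lt_add_one_add n m).ne'⟩
    exact lt_asymm (mem_seg.1 this) (lt_add_one_add n m)
  unfold twist
  rw [h1, if_neg (h2 0), if_neg (show seg n ≠ late Θ n from h2 _)]

lemma isDense₀_lateOrder (Θ : Rel₂ M) (hΘ : ∀ n, ∃ m, Θ n m) : IsDense₀ (lateOrder Θ hΘ) :=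
  isDense₀_lex.of_equiv ⟨twist Θ, twist Θ, twist_twist Θ, twist_twist Θ⟩
    (by have := twist_seg Θ 0; rwa [seg_zero] at this) (fun _ _ => Iff.rfl)

/-- The points `gap n 0` and `seg (n + 1)` span an interval that does not depend on `Θ`. -/
lemma lateOrder_gap_seg (Θ : Rel₂ M) (hΘ : ∀ n, ∃ m, Θ n m) (n : M) :
    lateOrder Θ hΘ (gap n 0) (seg (n + 1)) := by
  rw [lateOrder_iff, twist_gap, twist_seg]
  refine lex_iff.2 ⟨n, mem_seg.2 (lt_add_one_iff.2 le_rfl), fun h => (mem_gap.1 h).2 rfl,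
    fun j hj => iff_of_true (mem_gap.2 ⟨(hj.trans (lt_add_one_add _ _)).le, hj.ne⟩) ?_⟩
  exact mem_seg.2 (lt_add_one_iff.2 hj.le)

/-- Only numbers that bound a `Θ`-witness for `n` lie between `gap n 0` and `seg (n + 1)`. -/
lemma exists_lt_of_between {Θ : Rel₂ M} {hΘ : ∀ n, ∃ m, Θ n m} {x n : M}
    (h1 : lateOrder Θ hΘ (gap n 0) x) (h2 : lateOrder Θ hΘ x (seg (n + 1))) :
    ∃ m, m < x ∧ Θ n m := by
  rw [lateOrder_iff, twist_gap] at h1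
  rw [lateOrder_iff, twist_seg] at h2
  exact exists_lt_of_lex (hΘ n) h1 h2

/-! ### Choice from the categoricity of dense linear orders -/

lemma pre_add_one {x : M} (h : x ≠ 0) : pre x + 1 = x := by
  rw [← suc_eq]
  exact ((eq_zero_or_suc x).resolve_left h).symm

/-- The lexicographic order, where a point of an interval is found by an explicit function, is
compared with the late order, in which the points between `gap n 0` and `seg (n + 1)` bound a
witness for `n`. -/
lemma choice_of_catDLO (hcat : (str (M := M)).CatDLO) : Choice M := by
  intro Θ hΘ
  obtain ⟨h, ⟨hh, k, hk, hkh, hhk⟩, hiso⟩ := hcat _ _ (isDense₀_lex (M := M)).isDLO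
    (isDense₀_lateOrder Θ hΘ).isDLO
  obtain ⟨h, rfl⟩ : ∃ F : Fun₁ M, F.toFun = h := ⟨⟨h, hh⟩, rfl⟩
  obtain ⟨k, rfl⟩ : ∃ F : Fun₁ M, F.toFun = k := ⟨⟨k, hk⟩, rfl⟩
  have hiso : ∀ a b, lex M (a + 1) (b + 1) ↔ lateOrder Θ hΘ (h a + 1) (h b + 1) := fun a b =>
    chi_eq_one.symm.trans ((hiso a b).trans chi_eq_one)
  -- The images of `x n` and `y n` are the points `gap n 0` and `seg (n + 1)`.
  let x : Fun₁ M := ⟨fun n => k (pre (gap n 0)), by fun_prop⟩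
  let y : Fun₁ M := ⟨fun n => k (pre (seg (n + 1))), by fun_prop⟩
  let z : Fun₁ M := ⟨fun n => pre (adjoin (x n + 1) (x n + y n + 1)), by fun_prop⟩
  have hx : ∀ n, h (x n) + 1 = gap n 0 := fun n => by
    simp only [x, hhk]
    exact pre_add_one (gap_ne_zero n 0)
  have hy : ∀ n, h (y n) + 1 = seg (n + 1) := fun n => by
    simp only [y, hhk]
    refine pre_add_one fun h => ?_
    exact notMem_zero n (h ▸ mem_seg.2 (lt_add_one_iff.2 le_rfl))
  have hkey : ∀ n, ∃ m, m < h (z n) + 1 ∧ Θ n m := by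
    intro n
    have h1 : lex M (x n + 1) (y n + 1) := by
      rw [hiso, hx, hy]
      exact lateOrder_gap_seg Θ hΘ n
    have h2 : lex M (x n + 1) (z n + 1) ∧ lex M (z n + 1) (y n + 1) := by
      have h3 : lex M (x n + 1) (adjoin (x n + 1) (x n + y n + 1)) := lex_adjoin (by
        rw [add_right_comm]; exact le_self_add)
      have h4 : z n + 1 = adjoin (x n + 1) (x n + y n + 1) := pre_add_one (isDense₀_lex.ne_zero h3)
      rw [h4]
      exact ⟨h3, adjoin_lex h1 (by rw [add_assoc]; exact le_add_self)⟩
    rw [hiso, hiso, hx, hy] at h2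
    exact exists_lt_of_between h2.1 h2.2
  exact ⟨⟨fun n => mu (fun m => m < h (z n) + 1 ∧ Θ n m), by fun_prop⟩,
    fun n => (mu_spec (hkey n)).1.2⟩

/-! ### Finite sets as a vector space over the field with two elements -/

/-- The symmetric difference of two finite sets. -/
noncomputable def xor (x y : M) : M := code (fun i => ¬ (i ∈ x ↔ i ∈ y)) (x + y)

@[fun_prop] lemma fn_xor {n : ℕ} {φ ψ : (Fin n → M) → M} (hφ : Fn φ) (hψ : Fn ψ) :
    Fn (fun x => xor (φ x) (ψ x)) := fn_comp₂ (f := xor) (by unfold xor; fun_prop) hφ hψ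

lemma mem_xor {x y i : M} : i ∈ xor x y ↔ ¬ (i ∈ x ↔ i ∈ y) := by
  unfold xor
  rw [mem_code]
  refine ⟨And.right, fun h => ⟨?_, h⟩⟩
  by_cases hx : i ∈ x
  · exact (lt_of_mem hx).trans_le le_self_add
  · exact (lt_of_mem (by tauto : i ∈ y)).trans_le le_add_self

lemma xor_comm (x y : M) : xor x y = xor y x := set_ext fun i => by simp only [mem_xor]; tauto

lemma xor_assoc (x y z : M) : xor (xor x y) z = xor x (xor y z) :=
  set_ext fun i => by simp only [mem_xor]; tauto

@[simp] lemma xor_self (x : M) : xor x x = 0 := set_ext fun i => by simp [mem_xor]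

@[simp] lemma xor_zero (x : M) : xor x 0 = x := set_ext fun i => by simp [mem_xor]

@[simp] lemma zero_xor (x : M) : xor 0 x = x := by rw [xor_comm, xor_zero]

lemma xor_xor_xor_comm (x y z w : M) : xor (xor x y) (xor z w) = xor (xor x z) (xor y w) :=
  set_ext fun i => by simp only [mem_xor]; tauto

lemma xor_left_self (x y : M) : xor x (xor x y) = y := by rw [← xor_assoc, xor_self, zero_xor]

/-- The set `{a}`. -/
noncomputable def single (a : M) : M := adjoin 0 a

@[fun_prop] lemma fn_single {n : ℕ} {φ : (Fin n → M) → M} (hφ : Fn φ) :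
    Fn (fun x => single (φ x)) := by unfold single; fun_prop

@[simp] lemma mem_single {a i : M} : i ∈ single a ↔ i = a := by
  unfold single; rw [mem_adjoin]; simp

/-- The sum of the `F i` over the elements `i < N` of `u`. -/
noncomputable def partialSum (F : M → M) (u N : M) : M :=
  open Classical in prec 0 (fun i s => if i ∈ u then xor s (F i) else s) N

/-- The linear extension of `F`, from singletons to all finite sets. -/
noncomputable def lin (F : M → M) (u : M) : M := partialSum F u u

@[fun_prop] lemma fn_partialSum {n : ℕ} {φ ψ : (Fin n → M) → M} {F : M → (Fin n → M) → M}
    (hF : Fn (fun y : Fin (n + 1) → M => F (y 0) (fun i => y i.succ))) (hφ : Fn φ) (hψ : Fn ψ) :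
    Fn (fun x => partialSum (fun i => F i x) (φ x) (ψ x)) := by
  classical
  have := fn_prec (g := fun i s x => if i ∈ φ x then xor s (F i x) else s) (fn_const 0)
    (Fn.ite (dp_mem (fn_proj 0) hφ.weaken.weaken) (fn_xor (fn_proj 1) hF.shift) (fn_proj 1)) hψ
  unfold partialSum
  convert this

@[fun_prop] lemma fn_lin {n : ℕ} {φ : (Fin n → M) → M} {F : M → (Fin n → M) → M}
    (hF : Fn (fun y : Fin (n + 1) → M => F (y 0) (fun i => y i.succ))) (hφ : Fn φ) :
    Fn (fun x => lin (fun i => F i x) (φ x)) := fn_partialSum hF hφ hφ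

lemma partialSum_zero (F : Fun₁ M) (u : M) : partialSum F u 0 = 0 := prec_zero

lemma partialSum_add_one (F : Fun₁ M) (u N : M) [Decidable (N ∈ u)] : partialSum F u (N + 1) =
    if N ∈ u then xor (partialSum F u N) (F N) else partialSum F u N := by
  unfold partialSum
  rw [prec_add_one]
  congr

lemma partialSum_of_le (F : Fun₁ M) {u N : M} (h : u ≤ N) : partialSum F u N = lin F u := by
  classical
  revert h
  refine induct (P := fun N => u ≤ N → partialSum F u N = lin F u) (fun h => ?_)
    (fun N ih h => ?_) N (by unfold lin; fun_prop)
  · rw [nonpos_iff_eq_zero.1 h]; rfl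
  · rcases h.lt_or_eq with h | rfl
    · have h' := lt_add_one_iff.1 h
      rw [partialSum_add_one, if_neg fun hN => not_lt.2 h' (lt_of_mem hN), ih h']
    · rfl

lemma lin_zero (F : Fun₁ M) : lin F 0 = 0 := partialSum_zero F 0

lemma lin_xor (F : Fun₁ M) (u v : M) : lin F (xor u v) = xor (lin F u) (lin F v) := by
  classical
  have key : ∀ N, partialSum F (xor u v) N = xor (partialSum F u N) (partialSum F v N) := by
    intro N
    refine induct (P := fun N => partialSum F (xor u v) N =
      xor (partialSum F u N) (partialSum F v N)) (by simp [partialSum_zero]) (fun N ih => ?_) N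
    simp only [partialSum_add_one, ih, mem_xor]
    refine set_ext fun i => ?_
    by_cases hu : N ∈ u <;> by_cases hv : N ∈ v <;> simp only [hu, hv, mem_xor, if_true, if_false,
      iff_true, iff_false, not_true, not_false_iff] <;> tauto
  have := key (xor u v + u + v)
  rwa [partialSum_of_le F (by rw [add_assoc]; exact le_self_add),
    partialSum_of_le F (by rw [add_right_comm]; exact le_add_self),
    partialSum_of_le F le_add_self] at this

lemma lin_congr (F G : Fun₁ M) {u : M} (h : ∀ i, i ∈ u → F i = G i) : lin F u = lin G u := by
  classical
  unfold lin
  suffices ∀ N, partialSum F u N = partialSum G u N from this u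
  intro N
  refine induct (P := fun N => partialSum F u N = partialSum G u N) (by simp [partialSum_zero])
    (fun N ih => ?_) N
  rw [partialSum_add_one, partialSum_add_one, ih]
  split_ifs with hN
  · rw [h N hN]
  · rfl

/-- Every finite set is a sum of singletons. -/
lemma span_induction {P : M → Prop} (h0 : P 0) (hs : ∀ u a, P u → P (xor u (single a))) (u : M)
    (hP : Dp (fun x : Fin 1 → M => P (x 0)) := by fun_prop) : P u := by
  obtain ⟨R, rfl⟩ : ∃ R : Rel₁ M, R.rel = P := ⟨⟨P, hP⟩, rfl⟩
  have hmem : ∀ n i, i ∈ code (fun i => i ∈ u) n ↔ i < n ∧ i ∈ u := fun n i => mem_code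
  have key : ∀ n, R (code (fun i => i ∈ u) n) := by
    intro n
    refine induct (P := fun n => R (code (fun i => i ∈ u) n)) ?_ (fun n ih => ?_) n
    · convert h0
      exact set_ext fun i => by rw [hmem]; simp
    · by_cases hn : n ∈ u
      · convert hs _ n ih using 1
        refine set_ext fun i => ?_
        rw [mem_xor, hmem, hmem, mem_single, lt_add_one_iff, le_iff_lt_or_eq]
        by_cases hi : i = n
        · subst hi; simp [hn]
        · simp [hi]
      · convert ih using 1
        refine set_ext fun i => ?_
        rw [hmem, hmem, lt_add_one_iff, le_iff_lt_or_eq]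
        refine and_congr_left fun hi => or_iff_left ?_
        rintro rfl; exact hn hi
  convert key u
  exact set_ext fun i => by rw [hmem]; exact ⟨fun h => ⟨lt_of_mem h, h⟩, And.right⟩

lemma lin_single (F : Fun₁ M) (a : M) : lin F (single a) = F a := by
  classical
  have key : ∀ N, partialSum F (single a) N = if a < N then F a else 0 := by
    intro N
    refine induct (P := fun N => partialSum F (single a) N = if a < N then F a else 0)
      (by simp [partialSum_zero]) (fun N ih => ?_) N
    rw [partialSum_add_one, ih]
    by_cases h : N = a
    · subst h; simp [one_ne_zero']
    · have : a < N + 1 ↔ a < N := by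
        rw [lt_add_one_iff, le_iff_lt_or_eq]; exact or_iff_left (Ne.symm h)
      simp [h, this]
  unfold lin
  rw [key, if_pos (lt_of_mem (mem_single.2 rfl))]

lemma lin_self (u : M) : lin single u = u := by
  have h : ∀ u, lin (⟨single, by fun_prop⟩ : Fun₁ M) u = u := by
    intro u
    refine span_induction (P := fun u => lin (⟨single, by fun_prop⟩ : Fun₁ M) u = u) (lin_zero _)
      (fun u a ih => by rw [lin_xor, ih, lin_single]) u
  exact h u

/-! ### The interval algebra of a dense linear order -/

variable {L : Rel₂ M}

variable (L) in
/-- The maximum of two points of the order `L`. -/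
noncomputable def maxL (i j : M) : M := open Classical in if L i j then j else i

variable (L) in
/-- The product of the singleton `{i}` with the set `v`. -/
noncomputable def translate (i v : M) : M := lin (fun j => single (maxL L i j)) v

variable (L) in
/-- The bilinear product extending the maximum of `L` from singletons to all finite sets.
Identifying the singleton `{i}` with the final segment of `L` starting at `i`, finite sets become
the finite unions of half-open intervals of `L`, with symmetric difference as sum and intersection
as product. -/
noncomputable def mulL (u v : M) : M := lin (fun i => translate L i v) u

@[fun_prop] lemma fn_maxL {n : ℕ} {φ ψ : (Fin n → M) → M} (hφ : Fn φ) (hψ : Fn ψ) :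
    Fn (fun x => maxL L (φ x) (ψ x)) := by unfold maxL; fun_prop

@[fun_prop] lemma fn_translate {n : ℕ} {φ ψ : (Fin n → M) → M} (hφ : Fn φ) (hψ : Fn ψ) :
    Fn (fun x => translate L (φ x) (ψ x)) :=
  fn_comp₂ (f := translate L) (by unfold translate; fun_prop) hφ hψ

@[fun_prop] lemma fn_mulL {n : ℕ} {φ ψ : (Fin n → M) → M} (hφ : Fn φ) (hψ : Fn ψ) :
    Fn (fun x => mulL L (φ x) (ψ x)) := fn_comp₂ (f := mulL L) (by unfold mulL; fun_prop) hφ hψ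

variable (L) in
lemma translate_eq (i v : M) : translate L i v =
    lin (⟨fun j => single (maxL L i j), by fun_prop⟩ : Fun₁ M) v := rfl

variable (L) in
lemma mulL_eq (u v : M) : mulL L u v = lin (⟨fun i => translate L i v, by fun_prop⟩ : Fun₁ M) u :=
  rfl

@[simp] lemma translate_zero (i : M) : translate L i 0 = 0 := by rw [translate_eq, lin_zero]

lemma translate_xor (i u v : M) :
    translate L i (xor u v) = xor (translate L i u) (translate L i v) :=
  lin_xor ⟨fun j => single (maxL L i j), by fun_prop⟩ u v

@[simp] lemma translate_single (i j : M) : translate L i (single j) = single (maxL L i j) := by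
  rw [translate_eq, lin_single]

@[simp] lemma zero_mulL (v : M) : mulL L 0 v = 0 := by rw [mulL_eq, lin_zero]

lemma xor_mulL (u u' v : M) : mulL L (xor u u') v = xor (mulL L u v) (mulL L u' v) :=
  lin_xor ⟨fun i => translate L i v, by fun_prop⟩ u u'

@[simp] lemma single_mulL (i v : M) : mulL L (single i) v = translate L i v := by
  rw [mulL_eq, lin_single]

@[simp] lemma mulL_zero (u : M) : mulL L u 0 = 0 :=
  span_induction (P := fun u => mulL L u 0 = 0) (zero_mulL 0)
    (fun u a ih => by rw [xor_mulL, ih, single_mulL, translate_zero, xor_zero]) u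

lemma mulL_xor (u v v' : M) : mulL L u (xor v v') = xor (mulL L u v) (mulL L u v') :=
  span_induction (P := fun u => mulL L u (xor v v') = xor (mulL L u v) (mulL L u v')) (by simp)
    (fun u a ih => by
      simp only [xor_mulL, ih, single_mulL, translate_xor]
      rw [xor_xor_xor_comm]) u

lemma IsDense₀.maxL_comm (hL : IsDense₀ L) (i j : M) : maxL L i j = maxL L j i := by
  have h1 := hL.total i j
  have h2 := hL.irrefl i
  have h3 := hL.trans i j i
  unfold maxL
  split_ifs <;> tauto

lemma maxL_self (i : M) : maxL L i i = i := by
  unfold maxL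
  split_ifs <;> rfl

lemma IsDense₀.maxL_assoc (hL : IsDense₀ L) (i j k : M) :
    maxL L (maxL L i j) k = maxL L i (maxL L j k) := by
  have h1 := hL.total i j
  have h2 := hL.trans i j k
  have h3 := hL.total j k
  have h4 := hL.trans j i k
  have h5 := hL.trans i k j
  by_cases hij : L i j <;> by_cases hjk : L j k <;> by_cases hik : L i k <;>
    simp only [maxL, hij, hjk, hik, if_true, if_false] <;> grind

lemma IsDense₀.zero_maxL (hL : IsDense₀ L) (j : M) : maxL L 0 j = j := by
  unfold maxL
  split_ifs with h
  · rfl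
  · by_contra h'; exact h (hL.zero j (Ne.symm h'))

lemma IsDense₀.mulL_comm (hL : IsDense₀ L) (u v : M) : mulL L u v = mulL L v u := by
  have h1 : ∀ i v, translate L i v = mulL L v (single i) := fun i v =>
    span_induction (P := fun v => translate L i v = mulL L v (single i)) (by simp)
      (fun v a ih => by rw [translate_xor, ih, xor_mulL, translate_single, single_mulL,
        translate_single, hL.maxL_comm]) v
  exact span_induction (P := fun u => mulL L u v = mulL L v u) (by simp)
    (fun u a ih => by rw [xor_mulL, ih, mulL_xor, single_mulL, h1]) u

lemma IsDense₀.translate_translate (hL : IsDense₀ L) (i j v : M) :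
    translate L (maxL L i j) v = translate L i (translate L j v) :=
  span_induction (P := fun v => translate L (maxL L i j) v = translate L i (translate L j v))
    (by simp) (fun v a ih => by
      rw [translate_xor, ih, translate_xor, translate_xor, translate_single, translate_single,
        translate_single, hL.maxL_assoc]) v

lemma IsDense₀.mulL_assoc (hL : IsDense₀ L) (u v w : M) :
    mulL L (mulL L u v) w = mulL L u (mulL L v w) := by
  have h1 : ∀ i v, mulL L (translate L i v) w = translate L i (mulL L v w) := fun i v =>
    span_induction (P := fun v => mulL L (translate L i v) w = translate L i (mulL L v w)) (by simp)
      (fun v a ih => by rw [translate_xor, xor_mulL, ih, xor_mulL, translate_xor, translate_single,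
        single_mulL, single_mulL, hL.translate_translate]) v
  exact span_induction (P := fun u => mulL L (mulL L u v) w = mulL L u (mulL L v w)) (by simp)
    (fun u a ih => by rw [xor_mulL, xor_mulL, ih, xor_mulL, single_mulL, single_mulL, h1]) u

lemma IsDense₀.mulL_self (hL : IsDense₀ L) (u : M) : mulL L u u = u :=
  span_induction (P := fun u => mulL L u u = u) (by simp) (fun u a ih => by
    have h1 : mulL L (single a) (single a) = single a := by
      rw [single_mulL, translate_single, maxL_self]
    rw [xor_mulL, mulL_xor, mulL_xor, ih, h1, hL.mulL_comm (single a) u, xor_assoc, xor_left_self])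
    u

lemma IsDense₀.one_mulL (hL : IsDense₀ L) (u : M) : mulL L (single 0) u = u :=
  span_induction (P := fun u => mulL L (single 0) u = u) (by simp) (fun u a ih => by
    rw [mulL_xor, ih, single_mulL, translate_single, hL.zero_maxL]) u

/-- The elements of the interval algebra of `L`. -/
@[ext] structure IntervalElt (L : Rel₂ M) where
  /-- the set of end points, as a number -/
  val : M

noncomputable instance : Zero (IntervalElt L) := ⟨⟨0⟩⟩

noncomputable instance : Add (IntervalElt L) := ⟨fun u v => ⟨xor u.val v.val⟩⟩

instance : Neg (IntervalElt L) := ⟨fun u => u⟩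

/-- The interval algebra as a Boolean ring. -/
noncomputable abbrev IsDense₀.booleanRing (hL : IsDense₀ L) : BooleanRing (IntervalElt L) where
  mul u v := ⟨mulL L u.val v.val⟩
  one := ⟨single 0⟩
  add_assoc _ _ _ := IntervalElt.ext (xor_assoc _ _ _)
  zero_add _ := IntervalElt.ext (zero_xor _)
  add_zero _ := IntervalElt.ext (xor_zero _)
  add_comm _ _ := IntervalElt.ext (xor_comm _ _)
  neg_add_cancel _ := IntervalElt.ext (xor_self _)
  mul_assoc _ _ _ := IntervalElt.ext (hL.mulL_assoc _ _ _)
  one_mul _ := IntervalElt.ext (hL.one_mulL _)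
  mul_one _ := IntervalElt.ext ((hL.mulL_comm _ _).trans (hL.one_mulL _))
  zero_mul _ := IntervalElt.ext (zero_mulL _)
  mul_zero _ := IntervalElt.ext (mulL_zero _)
  left_distrib _ _ _ := IntervalElt.ext (mulL_xor _ _ _)
  right_distrib _ _ _ := IntervalElt.ext (xor_mulL _ _ _)
  isIdempotentElem _ := IntervalElt.ext (hL.mulL_self _)
  nsmul := nsmulRec
  zsmul := zsmulRec

variable (L) in
/-- The operations of the interval algebra of `L`. -/
noncomputable def intervalOps : BoolOps M where
  join u v := xor (xor u v) (mulL L u v)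
  meet u v := mulL L u v
  compl u := xor (single 0) u
  bot := 0
  top := single 0

lemma translate_eq_self (i : M) {u : M} (h : ∀ j, j ∈ u → maxL L i j = j) :
    translate L i u = u := by
  refine Eq.trans ?_ (lin_self u)
  exact lin_congr ⟨fun j => single (maxL L i j), by fun_prop⟩ ⟨single, by fun_prop⟩
    (fun j hj => congrArg single (h j hj))

/-- If `e` is the first end point of `u` and `x` lies strictly between `e` and the next one, then
the interval `[e, x)` is contained in `u`, but it is neither empty nor the whole of `u`. -/
lemma IsDense₀.interval_spec (hL : IsDense₀ L) {u e x : M} (he : e ∈ u)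
    (hmin : ∀ j, j ∈ u → ¬ L j e) (hex : L e x) (hx : ∀ j, j ∈ u → j ≠ e → L x j) :
    xor (single e) (single x) ≠ 0 ∧
      mulL L (xor (single e) (single x)) u = xor (single e) (single x) ∧
      xor (single e) (single x) ≠ u := by
  have hne : x ≠ e := by rintro rfl; exact hL.irrefl _ hex
  have hxu : x ∉ u := fun h => hL.irrefl x (hx x h hne)
  have hxb : x ∈ xor (single e) (single x) := by simp [mem_xor, hne]
  refine ⟨fun h => notMem_zero x (h ▸ hxb), ?_, fun h => hxu (h ▸ hxb)⟩
  have h1 : translate L e u = u := translate_eq_self e fun j hj => by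
    unfold maxL
    split_ifs with h
    · rfl
    · have := hL.total e j
      have := hmin j hj
      tauto
  have h2 : translate L x (xor (single e) u) = xor (single e) u :=
      translate_eq_self x fun j hj => by
    rw [mem_xor, mem_single] at hj
    have h3 : j ≠ e := by rintro rfl; tauto
    unfold maxL
    rw [if_pos (hx j (by tauto) h3)]
  have h3 : translate L x (single e) = single x := by
    rw [translate_single, hL.maxL_comm]
    unfold maxL
    rw [if_pos hex]
  have h4 : translate L x u = xor (single x) (xor (single e) u) := by
    have h5 := translate_xor (L := L) x (single e) (xor (single e) u)
    rwa [xor_left_self, h3, h2] at h5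
  rw [xor_mulL, single_mulL, single_mulL, h1, h4]
  refine set_ext fun i => ?_
  simp only [mem_xor]
  tauto

/-- The interval algebra is a Boolean ring, hence a Boolean algebra; a non-empty union of intervals
is split inside its first interval. -/
lemma IsDense₀.isAtomlessBA (hL : IsDense₀ L) : (str (M := M)).IsAtomlessBA (intervalOps L) := by
  let := hL.booleanRing
  have toB : ∀ {a b : AsBoolAlg (IntervalElt L)}, a = b → (ofBoolAlg a).val = (ofBoolAlg b).val :=
    fun h => by rw [h]
  let t : M → AsBoolAlg (IntervalElt L) := fun a => toBoolAlg ⟨a⟩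
  refine
  { fun_join := ?_
    fun_meet := ?_
    fun_compl := ?_
    join_comm := fun a b => toB (sup_comm (t a) (t b))
    meet_comm := fun a b => toB (inf_comm (t a) (t b))
    join_assoc := fun a b c => toB (sup_assoc (t a) (t b) (t c))
    meet_assoc := fun a b c => toB (inf_assoc (t a) (t b) (t c))
    join_meet_self := fun a b => toB (sup_inf_self (a := t a) (b := t b))
    meet_join_self := fun a b => toB (inf_sup_self (a := t a) (b := t b))
    join_meet_distrib := fun a b c => toB (sup_inf_left (t a) (t b) (t c))
    meet_join_distrib := fun a b c => toB (inf_sup_left (t a) (t b) (t c))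
    join_bot := fun a => toB (sup_bot_eq (t a))
    meet_top := fun a => toB (inf_top_eq (t a))
    join_compl := fun a => toB (sup_compl_eq_top (x := t a))
    meet_compl := fun a => toB (inf_compl_self (t a))
    atomless := ?_ }
  · change Fn _
    unfold intervalOps; fun_prop
  · change Fn _
    unfold intervalOps; fun_prop
  · change Fn _
    unfold intervalOps; fun_prop
  · intro u hu
    have hu' : ∃ e, e ∈ u := by
      by_contra h
      push Not at h
      exact hu (set_ext fun i => iff_of_false (h i) (notMem_zero i))
    have hmax := exists_maximal ⟨fun a b => L b a, by fun_prop⟩ hL.irrefl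
      (fun a b c h h' => hL.trans _ _ _ h' h) ⟨fun i => i, by fun_prop⟩
    obtain ⟨e, he, hmin⟩ : ∃ e, e ∈ u ∧ ∀ j, j ∈ u → ¬ L j e := by
      obtain ⟨e, he⟩ := hu'
      rcases hmax ⟨fun i => i ∈ u, by fun_prop⟩ u with h | ⟨e, _, he, h⟩
      · exact absurd he (h e (lt_of_mem he))
      · exact ⟨e, he, fun j hj => h j (lt_of_mem hj) hj⟩
    obtain ⟨x, hex, hx⟩ : ∃ x, L e x ∧ ∀ j, j ∈ u → j ≠ e → L x j := by
      rcases hmax ⟨fun i => i ∈ u ∧ ¬ i = e, by fun_prop⟩ u with h | ⟨e', _, ⟨he', hne⟩, h⟩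
      · obtain ⟨x, hx⟩ := hL.noMax e
        exact ⟨x, hx, fun j hj hje => absurd ⟨hj, hje⟩ (h j (lt_of_mem hj))⟩
      · have hee' : L e e' := by
          have h1 := hL.total e e'
          have h2 := hmin e' he'
          tauto
        obtain ⟨x, hx, hx'⟩ := hL.dense e e' hee'
        refine ⟨x, hx, fun j hj hje => ?_⟩
        have h1 : ¬ L j e' := h j (lt_of_mem hj) ⟨hj, hje⟩
        rcases hL.total j e' with h2 | rfl | h2
        · exact absurd h2 h1
        · exact hx'
        · exact hL.trans _ _ _ hx' h2
    obtain ⟨h1, h2, h3⟩ := hL.interval_spec he hmin hex hx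
    generalize xor (single e) (single x) = b at h1 h2 h3
    have h4 : mulL L b (xor u b) = 0 := by rw [mulL_xor, h2, hL.mulL_self, xor_self]
    refine ⟨b, xor u b, h1, fun h => h3 ?_, ?_, h4⟩
    · have h : xor u b = 0 := h
      rw [← xor_zero b, ← h, xor_comm u b, xor_left_self]
    · change xor (xor b (xor u b)) (mulL L b (xor u b)) = u
      rw [h4, xor_zero, xor_comm u b, xor_left_self]

/-- A proper non-zero part of the interval `[a, a')` has an end point strictly between. -/
lemma IsDense₀.exists_between_of_mulL_eq (hL : IsDense₀ L) {a a' c : M} (haa' : L a a')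
    (hc : mulL L c (xor (single a) (single a')) = c) (hc0 : c ≠ 0)
    (hc1 : c ≠ xor (single a) (single a')) : ∃ e, e ∈ c ∧ L a e ∧ L e a' := by
  classical
  by_contra hn
  push Not at hn
  obtain ⟨w, hw⟩ : ∃ w, w = xor (single a) (single a') := ⟨_, rfl⟩
  rw [← hw] at hc hc1
  let G : Fun₁ M := ⟨fun i => if L a i then 0 else w, by fun_prop⟩
  have h1 : mulL L c w = lin G c := by
    rw [mulL_eq]
    refine lin_congr _ _ fun i hi => ?_
    simp only [G, hw, translate_xor, translate_single]
    have h2 := hn i hi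
    by_cases hai : L a i
    · have h3 := hL.total i a'
      have h4 := hL.trans i a i
      have h5 := hL.irrefl i
      have h6 := hL.trans i a' i
      have h7 : maxL L i a = i := by unfold maxL; rw [if_neg (by tauto)]
      have h8 : maxL L i a' = i := by unfold maxL; rw [if_neg (h2 hai)]
      rw [if_pos hai, h7, h8, xor_self]
    · have h3 : maxL L i a = a := by
        have := hL.total a i
        unfold maxL
        split_ifs <;> tauto
      have h4 : maxL L i a' = a' := by
        unfold maxL
        refine if_pos ?_
        rcases hL.total a i with h | rfl | h
        · exact absurd h hai
        · exact haa'
        · exact hL.trans _ _ _ h haa'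
      rw [if_neg hai, h3, h4]
  have h2 : ∀ N, partialSum G c N = 0 ∨ partialSum G c N = w := by
    intro N
    refine induct (P := fun N => partialSum G c N = 0 ∨ partialSum G c N = w)
      (Or.inl (partialSum_zero _ _)) (fun N ih => ?_) N
    rw [partialSum_add_one]
    simp only [G] at ih ⊢
    split_ifs
    · rwa [xor_zero]
    · rcases ih with h | h <;> rw [h]
      · exact Or.inr (zero_xor w)
      · exact Or.inl (xor_self w)
    · exact ih
  rcases h2 c with h | h
  · exact hc0 (by rw [← hc, h1]; exact h)
  · exact hc1 (by rw [← hc, h1]; exact h)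

/-! ### Choice from the categoricity of atomless Boolean algebras -/

/-- The interval algebra of the lexicographic order, where elements are split by an explicit
function, is compared with that of the late order, in which every proper part of the interval
from `gap n 0` to `seg (n + 1)` has an end point in between, and this end point bounds a witness for
`n`. -/
lemma choice_of_catAtomlessBA (hcat : (str (M := M)).CatAtomlessBA) : Choice M := by
  intro Θ hΘ
  obtain ⟨h, ⟨hh, k, hk, hkh, hhk⟩, -, hmeet, -, hbot, -⟩ := hcat _ _
    (isDense₀_lex (M := M)).isAtomlessBA (isDense₀_lateOrder Θ hΘ).isAtomlessBA
  obtain ⟨h, rfl⟩ : ∃ F : Fun₁ M, F.toFun = h := ⟨⟨h, hh⟩, rfl⟩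
  obtain ⟨k, rfl⟩ : ∃ F : Fun₁ M, F.toFun = k := ⟨⟨k, hk⟩, rfl⟩
  have hmeet : ∀ a b, h (mulL (lex M) a b) = mulL (lateOrder Θ hΘ) (h a) (h b) := hmeet
  have hbot : h 0 = 0 := hbot
  have hinj : ∀ a b, h a = h b → a = b := fun a b hab => by rw [← hkh a, hab, hkh]
  -- The preimage `u n` of a known interval `w n` is split inside its first interval, and the image
  -- of the part `b n` splits `w n`.
  let w : Fun₁ M := ⟨fun n => xor (single (gap n 0)) (single (seg (n + 1))), by fun_prop⟩
  let u : Fun₁ M := ⟨fun n => k (w n), by fun_prop⟩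
  let e : Fun₁ M := ⟨fun n => mu (fun e => e < u n ∧ e ∈ u n ∧ ∀ j, j < u n → j ∈ u n →
    ¬ lex M j e), by fun_prop⟩
  let b : Fun₁ M := ⟨fun n => xor (single (e n)) (single (adjoin (e n) (e n + u n))), by fun_prop⟩
  have hkey : ∀ n, ∃ m, m < h (b n) ∧ Θ n m := by
    intro n
    have hw : h (u n) = w n := hhk _
    have hord := lateOrder_gap_seg Θ hΘ n
    have hne : gap n 0 ≠ seg (n + 1) := fun h' =>
      (isDense₀_lateOrder Θ hΘ).irrefl _ (h' ▸ hord)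
    have hu : u n ≠ 0 := fun h' => by
      rw [h', hbot] at hw
      have : gap n 0 ∈ w n := by simp [w, mem_xor, hne]
      rw [← hw] at this
      exact notMem_zero _ this
    have he : ∃ e, e < u n ∧ e ∈ u n ∧ ∀ j, j < u n → j ∈ u n → ¬ lex M j e := by
      have hu' : ∃ e, e ∈ u n := by
        by_contra h'
        push Not at h'
        exact hu (set_ext fun i => iff_of_false (h' i) (notMem_zero i))
      obtain ⟨e, he⟩ := hu'
      rcases exists_maximal ⟨fun a b => lex M b a, by fun_prop⟩ isDense₀_lex.irrefl
        (fun a b c h h' => isDense₀_lex.trans _ _ _ h' h) ⟨fun i => i, by fun_prop⟩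
        ⟨fun i => i ∈ u n, by fun_prop⟩ (u n) with h | ⟨e, he, he', h⟩
      · exact absurd he (h e (lt_of_mem he))
      · exact ⟨e, he, he', h⟩
    obtain ⟨⟨_, he1, he2⟩, _⟩ := mu_spec he
    obtain ⟨h1, h2, h3⟩ := isDense₀_lex.interval_spec (u := u n) (e := e n)
      (x := adjoin (e n) (e n + u n)) he1 (fun j hj => he2 j (lt_of_mem hj) hj)
      (lex_adjoin le_self_add) (fun j hj hje => by
        refine adjoin_lex ?_ ((lt_of_mem hj).le.trans le_add_self)
        have h4 := isDense₀_lex.total (e n) j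
        have h5 := he2 j (lt_of_mem hj) hj
        exact h4.resolve_right (not_or.2 ⟨Ne.symm hje, h5⟩))
    obtain ⟨x, hx, hx1, hx2⟩ := (isDense₀_lateOrder Θ hΘ).exists_between_of_mulL_eq hord
      (c := h (b n)) (by
        change mulL _ _ (w n) = _
        rw [← hw, ← hmeet]
        exact congrArg h h2)
      (fun h' => h1 (hinj _ _ (h'.trans hbot.symm)))
      (fun h' => h3 (hinj _ _ (h'.trans hw.symm)))
    obtain ⟨m, hm, hm'⟩ := exists_lt_of_between hx1 hx2
    exact ⟨m, hm.trans (lt_of_mem hx), hm'⟩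
  exact ⟨⟨fun n => mu (fun m => m < h (b n) ∧ Θ n m), by fun_prop⟩,
    fun n => (mu_spec (hkey n)).1.2⟩

end PRAModel

/-- Over `PRA²`, `RCA₀` (that is, `QF-AC`) is equivalent to the categoricity of countable dense
linear orders without end points, of countable random graphs, and of countable atomless Boolean
algebras: the equivalences hold in every model `(M, 𝒳)` of `PRA²`. -/
theorem mainTheorem1 {M : Type u} (S : PRA2.Str M) (hS : S.IsModel) :
    (S.QFAC ↔ S.CatDLO) ∧ (S.QFAC ↔ S.CatRandomGraph) ∧ (S.QFAC ↔ S.CatAtomlessBA) := by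
  let : PRAModel M := ⟨S, hS⟩
  have h : S.QFAC ↔ PRAModel.Choice M := PRAModel.qfac_iff_choice
  exact ⟨h.trans ⟨PRAModel.catDLO_of_choice, PRAModel.choice_of_catDLO⟩,
    h.trans ⟨PRAModel.catRandomGraph_of_choice, PRAModel.choice_of_catRandomGraph⟩,
    h.trans ⟨PRAModel.catAtomlessBA_of_choice, PRAModel.choice_of_catAtomlessBA⟩⟩
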